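/- Let $k$ be a field that is finitely generated (over its prime field), let $V\subset\mathbf P^3$ be a smooth cubic surface over $k$, and let $p\colon V\to\mathbf P^2$ be a birational morphism defined over $k$. Call a line of $V_{\bar k}$ that $p$ maps to a point a *blown-down line*, and let $P\subset V(k)$ be the set of $k$-points that lie on no blown-down line. Three $k$-points $u,v,w$ (possibly coinciding) of a plane cubic $D$ over $k$ are called *collinear*, and we write $w=u\circ v$, if either $u+v+w$ is the intersection cycle of $D$ with a $k$-line (with multiplicities), or $u,v,w$ lie on a $k$-line contained in $D$; thus $\circ$ is a partial and possibly multivalued operation. If $C$ is a section of $V$ by a plane defined over $k$ and $C$ does not contain a blown-down line, then $p$ embeds $C$ in $\mathbf P^2$ as a plane cubic $p(C)$, and for $x,y\in C(k)$ one puts $$x\circ_{(C,p)}y:=p^{-1}\bigl(p(x)\circ p(y)\bigr)\in C(k),$$ where $\circ$ is taken on $p(C)$. **Theorem.** $P$ is finitely generated with respect to the operations $\circ_{(C,p)}$ (for all $C$ as above), even under the restriction (**C**) the operation $x\circ_{(C,p)}y$ is applied only to different previously constructed points. That is, there is a finite subset $S\subset P$ such that the smallest subset of $P$ that contains $S$,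 and contains with any two different points $x\neq y$ every value $x\circ_{(C,p)}y$ lying in $P$ (for every $C$ through $x$ and $y$), is $P$ itself. -/

import Mathlib

open scoped LinearAlgebra.Projectivization

namespace CubicSurface

/-- The `K`-points of projective `n`-space, in homogeneous coordinates. -/
abbrev ProjPt (K : Type*) [Field K] (n : ℕ) : Type _ :=
  ℙ K (Fin (n + 1) → K)

/-- The values of a tuple of polynomials over `k` at (a representative of) a point of projective
space over an extension `K`. It is used only for tuples of forms of one and the same degree; for
these, whether it is zero, and the projective point it defines when it is not zero, do not depend
on the representative. -/
noncomputable def evalTuple {k K : Type*} [Field k] [Field K] [Algebra k K] {n m : ℕ}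
    (f : Fin (m + 1) → MvPolynomial (Fin (n + 1)) k) (x : ProjPt K n) : Fin (m + 1) → K :=
  fun j => MvPolynomial.aeval x.rep (f j)

/-- The form `f` over `k` vanishes at the point `x` of projective space over an extension `K`. -/
def Vanishes {k K : Type*} [Field k] [Field K] [Algebra k K] {n : ℕ}
    (f : MvPolynomial (Fin (n + 1)) k) (x : ProjPt K n) : Prop :=
  MvPolynomial.aeval x.rep f = 0

/-- The geometric point defined by a `k`-rational point of projective space. -/
noncomputable def toGeom {k : Type*} [Field k] {n : ℕ} (x : ProjPt k n) :
    ProjPt (AlgebraicClosure k) n :=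
  Projectivization.mk (AlgebraicClosure k)
    (fun i => algebraMap k (AlgebraicClosure k) (x.rep i)) (by
      intro h
      apply x.rep_nonzero
      funext i
      have hi := congrFun h i
      simpa using hi)

/-- `F = 0` is a smooth cubic surface in projective 3-space over `k`: `F` is a cubic form, and
over the algebraic closure `F` and its partial derivatives have no common zero. -/
def IsSmoothCubicSurface {k : Type*} [Field k] (F : MvPolynomial (Fin 4) k) : Prop :=
  F.IsHomogeneous 3 ∧
    ∀ x : ProjPt (AlgebraicClosure k) 3, Vanishes F x →
      ∃ i, ¬ Vanishes (n := 3) (MvPolynomial.pderiv i F) x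

/-- The geometric points of the surface `V : F = 0`. -/
abbrev GeomPt {k : Type*} [Field k] (F : MvPolynomial (Fin 4) k) : Type _ :=
  {x : ProjPt (AlgebraicClosure k) 3 // Vanishes F x}

/-- The set `V(k)` of `k`-rational points of the surface `V : F = 0`. -/
abbrev RatPt {k : Type*} [Field k] (F : MvPolynomial (Fin 4) k) : Type _ :=
  {x : ProjPt k 3 // Vanishes F (toGeom x)}

/-- The inclusion of `V(k)` into the geometric points of `V`. -/
noncomputable def RatPt.geom {k : Type*} [Field k] {F : MvPolynomial (Fin 4) k} (x : RatPt F) :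
    GeomPt F :=
  ⟨toGeom x.1, x.2⟩

/-- `p` is (the map on geometric points of) a morphism from `V : F = 0` to the projective plane
defined over `k`: near every point it is given by three forms of the same degree with coefficients
in `k`. (Multiplying the three forms by a form that vanishes off the neighbourhood, one may ask
that they give `p` wherever they do not all vanish.) -/
def IsMorphism {k : Type*} [Field k] (F : MvPolynomial (Fin 4) k)
    (p : GeomPt F → ProjPt (AlgebraicClosure k) 2) : Prop :=
  ∀ x : GeomPt F, ∃ (d : ℕ) (f : Fin 3 → MvPolynomial (Fin 4) k),
    (∀ j, (f j).IsHomogeneous d) ∧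
    evalTuple (n := 3) (m := 2) f x.1 ≠ 0 ∧
    ∀ (y : GeomPt F) (h : evalTuple (n := 3) (m := 2) f y.1 ≠ 0),
      p y = Projectivization.mk (AlgebraicClosure k) (evalTuple (n := 3) (m := 2) f y.1) h

/-- The morphism `p` from `V : F = 0` to the projective plane is birational over `k`: there is a
rational map `q` from the plane to `V` over `k`, given by four forms of the same degree that are
not all zero, such that `p ∘ q` and `q ∘ p` are the identity where `q` is defined. -/
def IsBirational {k : Type*} [Field k] (F : MvPolynomial (Fin 4) k)
    (p : GeomPt F → ProjPt (AlgebraicClosure k) 2) : Prop :=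
  ∃ (d : ℕ) (q : Fin 4 → MvPolynomial (Fin 3) k),
    (∀ j, (q j).IsHomogeneous d) ∧ q ≠ 0 ∧
    (∀ (u : ProjPt (AlgebraicClosure k) 2) (h : evalTuple (n := 2) (m := 3) q u ≠ 0),
      ∃ hV : Vanishes F (Projectivization.mk (AlgebraicClosure k) _ h),
        p ⟨Projectivization.mk (AlgebraicClosure k) _ h, hV⟩ = u) ∧
    (∀ (x : GeomPt F) (h : evalTuple (n := 2) (m := 3) q (p x) ≠ 0),
      Projectivization.mk (AlgebraicClosure k) _ h = x.1)

/-- `l` (a two-dimensional space of vectors) is a line over the algebraic closure of `k` that lies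
on `V : F = 0` and is blown down by `p`, that is, mapped by `p` to one point. -/
def IsBlownDownLine {k : Type*} [Field k] {F : MvPolynomial (Fin 4) k}
    (p : GeomPt F → ProjPt (AlgebraicClosure k) 2)
    (l : Submodule (AlgebraicClosure k) (Fin 4 → AlgebraicClosure k)) : Prop :=
  Module.finrank (AlgebraicClosure k) l = 2 ∧
    (∀ x : ProjPt (AlgebraicClosure k) 3, x.submodule ≤ l → Vanishes F x) ∧
    ∃ u : ProjPt (AlgebraicClosure k) 2, ∀ x : GeomPt F, x.1.submodule ≤ l → p x = u

/-- The complement of the blown-down lines in `V(k)`. -/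
def complementOfBlownDownLines {k : Type*} [Field k] {F : MvPolynomial (Fin 4) k}
    (p : GeomPt F → ProjPt (AlgebraicClosure k) 2) : Set (RatPt F) :=
  {x | ∀ l, IsBlownDownLine p l → ¬ (x.geom).1.submodule ≤ l}

/-- The plane `∑ hᵢ Xᵢ = 0`, as a space of vectors over the algebraic closure. -/
def planeSpace {k : Type*} [Field k] (h : Fin 4 → k) :
    Submodule (AlgebraicClosure k) (Fin 4 → AlgebraicClosure k) where
  carrier := {v | ∑ i, algebraMap k (AlgebraicClosure k) (h i) * v i = 0}
  zero_mem' := by simp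
  add_mem' := by
    intro v w hv hw
    simp only [Set.mem_ofPred_eq] at hv hw ⊢
    simp only [Pi.add_apply, mul_add, Finset.sum_add_distrib, hv, hw, add_zero]
  smul_mem' := by
    intro c v hv
    simp only [Set.mem_ofPred_eq] at hv ⊢
    have : ∑ i, algebraMap k (AlgebraicClosure k) (h i) * (c • v) i =
        c * ∑ i, algebraMap k (AlgebraicClosure k) (h i) * v i := by
      rw [Finset.mul_sum]
      exact Finset.sum_congr rfl fun i _ => by simp only [Pi.smul_apply, smul_eq_mul]; ring
    rw [this, hv, mul_zero]

/-- The geometric points of the section `C` of `V : F = 0` by the plane `∑ hᵢ Xᵢ = 0`. -/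
def planeSection {k : Type*} [Field k] (F : MvPolynomial (Fin 4) k) (h : Fin 4 → k) :
    Set (GeomPt F) :=
  {x | x.1.submodule ≤ planeSpace h}

/-- `G(s a + t b)` as a polynomial in `s, t`: the restriction of `G` to the line spanned by
`a, b`. -/
noncomputable def lineRestriction {k : Type*} [Field k] {n : ℕ}
    (G : MvPolynomial (Fin (n + 1)) k) (a b : Fin (n + 1) → k) : MvPolynomial (Fin 2) k :=
  MvPolynomial.aeval (fun i => MvPolynomial.C (a i) * MvPolynomial.X 0 +
    MvPolynomial.C (b i) * MvPolynomial.X 1) G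

/-- Three `k`-points `u 0, u 1, u 2` of the cubic `G = 0` (possibly coinciding) are collinear:
they lie on a line over `k` that either belongs to the cubic, or cuts it exactly in the cycle
`u 0 + u 1 + u 2`. The point `u j` has coordinates `(s j : t j)` on the line, so it is the zero of
the linear form `t j * X 0 - s j * X 1`. -/
def CollinearOnCubic {k : Type*} [Field k] {n : ℕ} (G : MvPolynomial (Fin (n + 1)) k)
    (u : Fin 3 → ProjPt k n) : Prop :=
  ∃ a b : Fin (n + 1) → k, LinearIndependent k ![a, b] ∧
    ∃ s t : Fin 3 → k,
      (∀ j, ∃ h : s j • a + t j • b ≠ 0, u j = Projectivization.mk k (s j • a + t j • b) h) ∧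
      (lineRestriction G a b = 0 ∨
        ∃ c : k, c ≠ 0 ∧ lineRestriction G a b =
          MvPolynomial.C c * ∏ j, (MvPolynomial.C (t j) * MvPolynomial.X 0 -
            MvPolynomial.C (s j) * MvPolynomial.X 1))

/-- `G = 0` is an equation, over `k`, of the image `p(C)` as a plane cubic. A plane section of a
smooth cubic surface is geometrically reduced, so `p(C)` is determined by its geometric points. -/
def IsImageCubic {k : Type*} [Field k] {F : MvPolynomial (Fin 4) k}
    (p : GeomPt F → ProjPt (AlgebraicClosure k) 2) (h : Fin 4 → k)
    (G : MvPolynomial (Fin 3) k) : Prop :=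
  G.IsHomogeneous 3 ∧ G ≠ 0 ∧
    ∀ u : ProjPt (AlgebraicClosure k) 2,
      Vanishes (n := 2) G u ↔ ∃ x ∈ planeSection F h, p x = u

/-- `z = x ∘_(C,p) y`, where `C` is the section of `V : F = 0` by the plane `∑ hᵢ Xᵢ = 0` over
`k`: `C` contains no blown-down line, `x, y, z` are `k`-points of `C`, and `p(z) = p(x) ∘ p(y)` on
the plane cubic `p(C)`. -/
def IsModifiedComposition {k : Type*} [Field k] {F : MvPolynomial (Fin 4) k}
    (p : GeomPt F → ProjPt (AlgebraicClosure k) 2) (h : Fin 4 → k) (x y z : RatPt F) : Prop :=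
  h ≠ 0 ∧ (∀ l, IsBlownDownLine p l → ¬ l ≤ planeSpace h) ∧
    x.geom ∈ planeSection F h ∧ y.geom ∈ planeSection F h ∧ z.geom ∈ planeSection F h ∧
    ∃ G : MvPolynomial (Fin 3) k, IsImageCubic p h G ∧
      ∃ u v w : ProjPt k 2,
        p x.geom = toGeom u ∧ p y.geom = toGeom v ∧ p z.geom = toGeom w ∧
        CollinearOnCubic (n := 2) G ![u, v, w]

/-- The points constructed from `S`, inside the complement of the blown-down lines, by applying the
operations `∘_(C,p)`, for all plane sections `C` over `k` as above, to pairs of *different*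
previously constructed points. -/
inductive Generated {k : Type*} [Field k] {F : MvPolynomial (Fin 4) k}
    (p : GeomPt F → ProjPt (AlgebraicClosure k) 2) (S : Set (RatPt F)) : RatPt F → Prop
  | base (x : RatPt F) (hx : x ∈ S) : Generated p S x
  | step (h : Fin 4 → k) (x y z : RatPt F) (hx : Generated p S x) (hy : Generated p S y)
      (hne : x ≠ y) (hz : z ∈ complementOfBlownDownLines p)
      (hop : IsModifiedComposition p h x y z) : Generated p S z

end CubicSurface

/-! The morphism `p` is inverted by plane cubics. There are cubic forms `q = (q 0, ..., q 3)` over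
$k$ such that `q` inverts `p` off the finitely many base points of `q`, and the fibre of `p` over a
base point is a blown-down line, every blown-down line arising in this way. Hence $P$ is the set of
points $q(a)$ with $a$ a rational point of the plane off the base locus (`IsImage.mem_complement`,
`exists_isImage_of_mem_complement`), and the section by $\sum l_i X_i=0$ has the image cubic $\sum
l_i q_i=0$ (`isImageCubic`).

Let $a,b,c$ be different collinear rational points off the base locus. Some plane over $k$ passes
through $q(a),q(b),q(c)$. The corresponding cubic contains $a,b,c$, so it contains their line or
cuts it exactly in $a+b+c$. Thus $q(c)$ is a value of the operation at $q(a),q(b)$, provided that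
the plane contains no blown-down line (`exists_isModifiedComposition`). Generation therefore reduces
to drawing lines in $\mathbf P^2$. The proviso holds when two of the three points are `Separated`,
and a generic point is separated from a given one, because each of the finitely many blown-down
lines spans a single plane with the given point (`exists_separating`).

Over an infinite field three general points suffice (`exists_generators`): two of them give their
line, joining its points to the third gives a generic point, and every point lies on a line through
two generic ones. Over a finite field $V(k)$ is itself finite.

The cubic forms come from a Jacobian computation (`exists_jacobian`). Divide the components of a
birational inverse by their common factor, and let $d$ be their degree. The minors of the rows
$q,\partial_{c+1}q,\partial_{c+2}q$ are $c'X_c$ times the gradient of $F$ at $q$. Having an inverse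
morphism, `q` is immersive off the base locus, so $c'$ has no zero there and is constant; comparing
degrees, $d+2(d-1)=1+2d$, so $d=3$. Along lines through a base point the same identity shows that
the derivative of `q` has rank two (`exists_independent_dirDeriv`). This yields the finiteness of
the base locus (`finite_base`) and the identification of the fibre over a base point with a line
(`exists_eq_of_rel`). -/

section

open MvPolynomial

/-! ### Algebra: coprime vectors, Taylor expansion, factors of forms, kernels of polynomial maps. -/

/-- Over a unique factorization domain, a vector proportional to a vector whose entries have no
common prime factor is a multiple of it. -/
theorem exists_eq_mul_of_proportional {R ι : Type*} [CommRing R] [IsDomain R]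
    [UniqueFactorizationMonoid R] [Fintype ι] (a g : ι → R) (hg0 : ∃ i, g i ≠ 0)
    (hg : ∀ π, Irreducible π → ∃ i, ¬ π ∣ g i) (h : ∀ i j, a i * g j = a j * g i) :
    ∃ c, ∀ i, a i = c * g i := by
  classical
  obtain ⟨i₀, hi₀⟩ := hg0
  let : StrongNormalizationMonoid R := UniqueFactorizationMonoid.strongNormalizationMonoid
  let : StrongNormalizedGCDMonoid R := UniqueFactorizationMonoid.toStrongNormalizedGCDMonoid R
  have hdvd : g i₀ ∣ a i₀ := by
    -- `g i₀` divides every `a i₀ * g j = a j * g i₀`, hence `a i₀` times the gcd of the entries of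
    -- `g`, which is a unit.
    have h1 : g i₀ ∣ Finset.univ.gcd (fun j => a i₀ * g j) :=
      Finset.dvd_gcd fun j _ => ⟨a j, by rw [h i₀ j, mul_comm]⟩
    rw [Finset.gcd_mul_left] at h1
    have hu : IsUnit (Finset.univ.gcd g) := by
      by_contra hnu
      obtain ⟨π, hπ, hd⟩ := WfDvdMonoid.exists_irreducible_factor hnu
        (fun h0 => hi₀ (Finset.gcd_eq_zero_iff.1 h0 i₀ (Finset.mem_univ _)))
      obtain ⟨i, hi⟩ := hg π hπ
      exact hi (hd.trans (Finset.gcd_dvd (Finset.mem_univ i)))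
    exact (hu.dvd_mul_right.1 h1).trans (normalize_associated _).dvd
  obtain ⟨c, hc⟩ := hdvd
  refine ⟨c, fun i => mul_right_cancel₀ hi₀ ?_⟩
  rw [h i i₀, hc]; ring

/-- The entries of a nonzero vector over a unique factorization domain have a common factor whose
removal leaves entries without a common prime factor. -/
theorem exists_eq_mul_coprime {R ι : Type*} [CommRing R] [IsDomain R]
    [UniqueFactorizationMonoid R] [Fintype ι] (q : ι → R) (hq : ∃ i, q i ≠ 0) :
    ∃ (D : R) (q' : ι → R), D ≠ 0 ∧ (∀ i, q i = D * q' i) ∧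
      ∀ π, Irreducible π → ∃ i, ¬ π ∣ q' i := by
  classical
  obtain ⟨i₀, hi₀⟩ := hq
  let : StrongNormalizationMonoid R := UniqueFactorizationMonoid.strongNormalizationMonoid
  let : StrongNormalizedGCDMonoid R := UniqueFactorizationMonoid.toStrongNormalizedGCDMonoid R
  obtain ⟨q', hq', h1⟩ := Finset.extract_gcd (s := Finset.univ) q ⟨i₀, Finset.mem_univ _⟩
  refine ⟨Finset.univ.gcd q, q', fun h0 => hi₀ (Finset.gcd_eq_zero_iff.1 h0 i₀ (Finset.mem_univ _)),
    fun i => hq' i (Finset.mem_univ i), fun π hπ => ?_⟩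
  by_contra hall
  push Not at hall
  exact hπ.not_isUnit (isUnit_of_dvd_one (h1 ▸ Finset.dvd_gcd fun j _ => hall j))

/-- The chain rule for a derivation applied to a value of a polynomial. -/
theorem derivation_aeval {σ k R : Type*} [CommRing k] [CommRing R] [Algebra k R] [Fintype σ]
    (D : Derivation k R R) (x : σ → R) (G : MvPolynomial σ k) :
    D (aeval x G) = ∑ i, aeval x (pderiv i G) * D (x i) := by
  classical
  induction G using MvPolynomial.induction_on with
  | C a => simp [algHom_C]
  | add p q hp hq => simp only [map_add, hp, hq, add_mul, Finset.sum_add_distrib]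
  | mul_X p j hp =>
    simp only [map_mul, aeval_X, Derivation.leibniz, hp, smul_eq_mul, pderiv_X, map_add, add_mul,
      Finset.sum_add_distrib, Finset.mul_sum]
    congr 1
    · rw [Finset.sum_eq_single j]
      · simp
      · intro b _ hb; simp [hb.symm]
      · simp
    · exact Finset.sum_congr rfl fun i _ => by ring

/-- Second order Taylor expansion of a polynomial. -/
theorem exists_aeval_add {σ k R : Type*} [CommRing k] [CommRing R] [Algebra k R] [Fintype σ]
    (x y : σ → R) (G : MvPolynomial σ k) :
    ∃ r : σ → σ → R, aeval (x + y) G = aeval x G + ∑ i, aeval x (pderiv i G) * y i +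
      ∑ i, ∑ j, y i * y j * r i j := by
  classical
  induction G using MvPolynomial.induction_on with
  | C a => exact ⟨0, by simp [algHom_C]⟩
  | add p q hp hq =>
    obtain ⟨r, hr⟩ := hp
    obtain ⟨s, hs⟩ := hq
    refine ⟨r + s, ?_⟩
    simp only [map_add, hr, hs, add_mul, Finset.sum_add_distrib, Pi.add_apply, mul_add]
    ring
  | mul_X p l hp =>
    obtain ⟨r, hr⟩ := hp
    refine ⟨fun i j => r i j * (x l + y l) + if j = l then aeval x (pderiv i p) else 0, ?_⟩
    have h1 : ∑ i, aeval x (pderiv i (p * X l)) * y i =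
        aeval x p * y l + (∑ i, aeval x (pderiv i p) * y i) * x l := by
      simp only [map_mul, aeval_X, Derivation.leibniz, smul_eq_mul, pderiv_X, map_add, add_mul,
        Finset.sum_add_distrib, Finset.sum_mul]
      congr 1
      · rw [Finset.sum_eq_single l]
        · simp
        · intro b _ hb; simp [hb.symm]
        · simp
      · exact Finset.sum_congr rfl fun i _ => by ring
    have h2 : ∑ i, ∑ j, y i * y j * (r i j * (x l + y l) +
        if j = l then aeval x (pderiv i p) else 0) =
        (∑ i, ∑ j, y i * y j * r i j) * (x l + y l) +
          (∑ i, aeval x (pderiv i p) * y i) * y l := by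
      simp only [mul_add, Finset.sum_add_distrib, Finset.sum_mul, mul_ite, mul_zero,
        Finset.sum_ite_eq', Finset.mem_univ, if_true]
      congr 1
      · congr 1 <;> exact Finset.sum_congr rfl fun i _ => Finset.sum_congr rfl fun j _ => by ring
      · exact Finset.sum_congr rfl fun i _ => by ring
    rw [h1, h2, map_mul, map_mul, hr, aeval_X, aeval_X, Pi.add_apply]
    ring

/-- Values of forms scale. -/
theorem MvPolynomial.IsHomogeneous.aeval_smul_vec {σ k R : Type*} [CommRing k] [CommRing R]
    [Algebra k R] {G : MvPolynomial σ k} {n : ℕ} (hG : G.IsHomogeneous n) (c : R) (x : σ → R) :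
    MvPolynomial.aeval (c • x) G = c ^ n * MvPolynomial.aeval x G := by
  rw [aeval_def, aeval_def, eval₂_eq, eval₂_eq, Finset.mul_sum]
  refine Finset.sum_congr rfl fun d hd => ?_
  have : ∑ i ∈ d.support, d i = n := by
    exact (hG.degree_eq_sum_deg_support hd).symm
  simp only [Pi.smul_apply, smul_eq_mul, mul_pow, Finset.prod_mul_distrib,
    Finset.prod_pow_eq_pow_sum, this]
  ring

/-- The factors of a nonzero form are forms. -/
theorem MvPolynomial.IsHomogeneous.exists_of_mul {σ k : Type*} [Field k]
    {A B : MvPolynomial σ k} {n : ℕ} (h : (A * B).IsHomogeneous n) (h0 : A * B ≠ 0) :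
    ∃ a b, a + b = n ∧ A.IsHomogeneous a ∧ B.IsHomogeneous b := by
  classical
  have hA0 := left_ne_zero_of_mul h0
  have hB0 := right_ne_zero_of_mul h0
  -- Scaling the variables by a new indeterminate turns homogeneous components into coefficients, so
  -- a form becomes a monomial. Over a domain a product is a monomial only if each factor has equal
  -- lowest and highest degree.
  let φ : MvPolynomial σ k →ₐ[k] Polynomial (MvPolynomial σ k) :=
    MvPolynomial.aeval fun i => Polynomial.C (X i) * Polynomial.X
  have hφ : ∀ G : MvPolynomial σ k, ∀ n, (φ G).coeff n = homogeneousComponent n G := by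
    intro G n
    induction G using MvPolynomial.induction_on' with
    | monomial d a =>
      have : φ (monomial d a) = Polynomial.monomial d.degree (monomial d a) := by
        rw [aeval_monomial, monomial_eq (a := a), ← Polynomial.C_mul_X_pow_eq_monomial]
        simp only [mul_pow, Finsupp.prod, Finset.prod_mul_distrib, Finset.prod_pow_eq_pow_sum,
          Finsupp.degree_apply, map_mul, map_prod, map_pow, mul_assoc]
        rfl
      rw [this, Polynomial.coeff_monomial]
      rw [homogeneousComponent_of_mem
        (show monomial d a ∈ homogeneousSubmodule σ k d.degree from isHomogeneous_monomial a rfl)]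
      simp only [eq_comm]
    | add p q hp hq => rw [map_add, Polynomial.coeff_add, hp, hq, map_add]
  have hinj : ∀ G, G ≠ 0 → φ G ≠ 0 := by
    intro G hG h
    apply hG
    rw [← sum_homogeneousComponent G]
    exact Finset.sum_eq_zero fun i _ => by rw [← hφ, h, Polynomial.coeff_zero]
  have hAB : φ A * φ B = Polynomial.monomial n (A * B) := by
    rw [← map_mul]
    ext1 m
    rw [hφ, Polynomial.coeff_monomial, homogeneousComponent_of_mem h]
    simp only [eq_comm]
  have hd := congrArg Polynomial.natDegree hAB
  have ht := congrArg Polynomial.natTrailingDegree hAB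
  rw [Polynomial.natDegree_mul (hinj _ hA0) (hinj _ hB0), Polynomial.natDegree_monomial_eq _ h0]
    at hd
  rw [Polynomial.natTrailingDegree_mul (hinj _ hA0) (hinj _ hB0),
    Polynomial.natTrailingDegree_monomial h0] at ht
  have key : ∀ G, (φ G).natTrailingDegree = (φ G).natDegree →
      G.IsHomogeneous (φ G).natDegree := by
    intro G hG
    have : G = homogeneousComponent (φ G).natDegree G := by
      conv_lhs => rw [← sum_homogeneousComponent G]
      have h3 : ∀ i, i ≠ (φ G).natDegree → homogeneousComponent i G = 0 := by
        intro i hi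
        rw [← hφ]
        rcases lt_or_gt_of_ne hi with h | h
        · exact Polynomial.coeff_eq_zero_of_lt_natTrailingDegree (by omega)
        · exact Polynomial.coeff_eq_zero_of_natDegree_lt h
      by_cases hm : (φ G).natDegree ∈ Finset.range (G.totalDegree + 1)
      · exact Finset.sum_eq_single_of_mem _ hm fun i _ hi => h3 i hi
      · rw [Finset.mem_range, not_lt] at hm
        rw [homogeneousComponent_eq_zero (φ G).natDegree G (Nat.lt_of_succ_le hm)]
        refine Finset.sum_eq_zero fun i hi => h3 i ?_
        rw [Finset.mem_range] at hi; omega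
    have h4 := homogeneousComponent_isHomogeneous (φ G).natDegree G
    rwa [← this] at h4
  have h1 := (φ A).natTrailingDegree_le_natDegree
  have h2 := (φ B).natTrailingDegree_le_natDegree
  exact ⟨_, _, hd, key A (by omega), key B (by omega)⟩

/-- The kernel of a map from a polynomial ring in `n + 1` variables to one in `n` variables that
has algebraic target over its image is generated by any prime element of the kernel. -/
theorem dvd_of_algHom_eq_zero {K : Type*} [Field K] {n : ℕ} {F G : MvPolynomial (Fin (n + 1)) K}
    (hF : Prime F) (ψ : MvPolynomial (Fin (n + 1)) K →ₐ[K] MvPolynomial (Fin n) K)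
    (hψ : Algebra.IsAlgebraic ψ.range (MvPolynomial (Fin n) K)) (hF0 : ψ F = 0) (hG : ψ G = 0) :
    F ∣ G := by
  classical
  -- The quotient by `F` has transcendence degree at most `n`. A transcendence basis of the target,
  -- chosen among the images of the variables, therefore lifts to a transcendence basis of the
  -- quotient, and the induced map is injective on the algebra that the lifts generate. A nonzero
  -- kernel element, being algebraic over this algebra, would produce a nonzero kernel element
  -- inside it.
  by_contra hFG
  let I : Ideal (MvPolynomial (Fin (n + 1)) K) := Ideal.span {F}
  have hI : I.IsPrime := (Ideal.span_singleton_prime hF.ne_zero).2 hF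
  let A := MvPolynomial (Fin (n + 1)) K ⧸ I
  have hdom : IsDomain A := Ideal.Quotient.isDomain I
  have hfaith : FaithfulSMul K A :=
    (faithfulSMul_iff_algebraMap_injective K A).mpr (algebraMap K A).injective
  let ψ' : A →ₐ[K] MvPolynomial (Fin n) K := Ideal.Quotient.liftₐ I ψ (fun a ha => by
    obtain ⟨b, rfl⟩ := Ideal.mem_span_singleton.1 ha
    rw [map_mul, hF0, zero_mul])
  have hψ' : ∀ a, ψ' (Ideal.Quotient.mkₐ K I a) = ψ a := fun a => rfl
  -- a transcendence basis among the images of the variables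
  have hadj : Algebra.adjoin K (Set.range fun i => ψ (X i)) = ψ.range := by
    rw [← Algebra.map_top, ← MvPolynomial.adjoin_range_X, AlgHom.map_adjoin, ← Set.range_comp]
    rfl
  have halg : Algebra.IsAlgebraic (Algebra.adjoin K (Set.range fun i => ψ (X i)))
      (MvPolynomial (Fin n) K) := by rw [hadj]; exact hψ
  obtain ⟨t, hts, ht⟩ := exists_isTranscendenceBasis_subset (R := K)
    (Set.range fun i => ψ (X i))
  have htf : Finite t := ((Set.finite_range _).subset hts).to_subtype
  have hcard : Cardinal.mk t = n := by
    rw [ht.cardinalMk_eq_trdeg, MvPolynomial.trdeg_of_isDomain]; simp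
  choose f hf using fun x : t => hts x.2
  let y : t → A := fun x => Ideal.Quotient.mkₐ K I (X (f x))
  have hy' : ψ' ∘ y = ((↑) : t → MvPolynomial (Fin n) K) := funext fun x => hf x
  have hy : AlgebraicIndependent K y := by
    refine AlgebraicIndependent.of_comp ψ' ?_
    rw [hy']; exact ht.1
  -- Otherwise the `n + 1` classes of the variables, which generate the quotient, would be
  -- algebraically independent, against the relation `F`.
  have htr : Algebra.trdeg K A ≤ n := by
    by_contra hlt
    rw [not_le] at hlt
    have hle : Cardinal.lift (Cardinal.mk (Fin (n + 1))) ≤ Cardinal.lift (Algebra.trdeg K A) := by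
      simpa using Order.succ_le_of_lt hlt
    have hadj2 : Algebra.adjoin K (Set.range fun i => Ideal.Quotient.mkₐ K I (X i)) = ⊤ := by
      have : (Set.range fun i => Ideal.Quotient.mkₐ K I (X i)) =
          Ideal.Quotient.mkₐ K I '' Set.range X := by rw [← Set.range_comp]; rfl
      rw [this, ← AlgHom.map_adjoin, MvPolynomial.adjoin_range_X, Algebra.map_top]
      exact (AlgHom.range_eq_top _).2 (Ideal.Quotient.mkₐ_surjective _ _)
    have : Algebra.IsAlgebraic (Algebra.adjoin K (Set.range fun i => Ideal.Quotient.mkₐ K I (X i)))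
        A := by
      rw [hadj2]
      exact ⟨fun a => isAlgebraic_algebraMap (⟨a, Algebra.mem_top⟩ : (⊤ : Subalgebra K A))⟩
    have hb := Algebra.IsAlgebraic.isTranscendenceBasis_of_lift_le_trdeg_of_finite K
      (fun i => Ideal.Quotient.mkₐ K I (X i)) hle
    have h0 := (algebraicIndependent_iff.1 hb.1) F (by
      have := MvPolynomial.aeval_unique (Ideal.Quotient.mkₐ K I)
      rw [show (fun i => Ideal.Quotient.mkₐ K I (X i)) = (Ideal.Quotient.mkₐ K I) ∘ X from rfl,
        ← this]
      exact Ideal.Quotient.eq_zero_iff_mem.2 (Ideal.mem_span_singleton_self F))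
    exact hF.ne_zero h0
  have hbas : IsTranscendenceBasis K y :=
    hy.isTranscendenceBasis_of_lift_trdeg_le_of_finite (by rw [hcard]; simpa using htr)
  have halgA := hbas.isAlgebraic
  have hne : Ideal.Quotient.mkₐ K I G ≠ 0 := fun h =>
    hFG (Ideal.mem_span_singleton.1 (Ideal.Quotient.eq_zero_iff_mem.1 h))
  have := Ideal.comap_ne_bot_of_algebraic_mem (R := Algebra.adjoin K (Set.range y))
    (I := RingHom.ker ψ'.toRingHom) hne (by rw [RingHom.mem_ker]; exact hG) (halgA.isAlgebraic _)
  apply this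
  rw [eq_bot_iff]
  rintro ⟨c, hc⟩ hc0
  rw [Ideal.mem_comap, RingHom.mem_ker] at hc0
  replace hc0 : ψ' c = 0 := hc0
  have hc' := hc
  rw [Algebra.adjoin_range_eq_range_aeval] at hc'
  obtain ⟨P, hP⟩ := hc'
  have hP : aeval y P = c := hP
  have hP0 : P = 0 := (algebraicIndependent_iff.1 ht.1) P (by
    rw [← hy', ← hc0, ← hP]
    rw [← AlgHom.comp_apply, MvPolynomial.comp_aeval]
    rfl)
  ext
  simp [← hP, hP0]

/-! ### Zeros of forms, and irreducibility of a smooth cubic surface. -/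

/-- A form of positive degree in at least two variables over an algebraically closed field has a
nontrivial zero. -/
theorem exists_ne_zero_aeval_eq_zero {K : Type*} [Field K] [IsAlgClosed K] {n m : ℕ}
    {G : MvPolynomial (Fin (n + 2)) K} (hG : G.IsHomogeneous (m + 1)) :
    ∃ x : Fin (n + 2) → K, x ≠ 0 ∧ aeval x G = 0 := by
  classical
  let a : Fin (n + 2) → K := Pi.single 0 1
  let b : Fin (n + 2) → K := Pi.single 1 1
  let P : (Fin (n + 2) → K) → (Fin (n + 2) → K) → Polynomial K := fun a b =>
    aeval (fun i => Polynomial.C (a i) + Polynomial.X * Polynomial.C (b i)) G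
  have hev : ∀ a b c, (P a b).eval c = aeval (a + c • b) G := by
    intro a b c
    rw [← Polynomial.coe_aeval_eq_eval, ← AlgHom.coe_toRingHom]
    simp only [P]
    rw [AlgHom.coe_toRingHom, ← AlgHom.comp_apply, MvPolynomial.comp_aeval]
    congr 2
    funext i
    simp only [map_add, map_mul, Polynomial.aeval_C, Polynomial.aeval_X, Pi.add_apply,
      Pi.smul_apply, smul_eq_mul, Algebra.algebraMap_self, RingHom.id_apply]
  -- The zero polynomial has degree `⊥` and belongs to the first case. If `G` is a nonzero constant
  -- `r` on the line `a + c • b`, then homogeneity gives `r * s ^ (m + 1)` at `b + s • a`, so `b` is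
  -- a zero.
  by_cases hd : (P a b).degree ≠ 0
  · obtain ⟨c, hc⟩ := IsAlgClosed.exists_root _ hd
    refine ⟨a + c • b, fun h => ?_, by rw [← hev]; exact hc⟩
    simpa [a, b] using congrFun h 0
  · rw [not_not] at hd
    obtain ⟨r, hr⟩ : ∃ r, ∀ c : K, aeval (a + c • b) G = r :=
      ⟨_, fun c => by
        have := hev a b c
        rw [Polynomial.eq_C_of_degree_eq_zero hd, Polynomial.eval_C] at this
        exact this.symm⟩
    have hz : P b a = Polynomial.C r * Polynomial.X ^ (m + 1) := by
      rw [← sub_eq_zero]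
      refine Polynomial.eq_zero_of_infinite_isRoot _ ?_
      refine Set.Infinite.mono (s := {0}ᶜ) ?_ (Set.finite_singleton (0 : K)).infinite_compl
      intro s hs
      have hs : s ≠ 0 := hs
      have h1 : b + s • a = s • (a + s⁻¹ • b) := by
        rw [smul_add, smul_smul, mul_inv_cancel₀ hs, one_smul, add_comm (s • a)]
      simp only [Set.mem_ofPred_eq, Polynomial.IsRoot, Polynomial.eval_sub, Polynomial.eval_mul,
        Polynomial.eval_C, Polynomial.eval_pow, Polynomial.eval_X]
      rw [hev, h1, hG.aeval_smul_vec, hr]; ring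
    refine ⟨b, fun h => by simpa [b] using congrFun h 1, ?_⟩
    have := hev b a 0
    rw [hz] at this
    simpa using this.symm

/-- The equation of a smooth surface of degree three is irreducible over an algebraically closed
field. -/
theorem irreducible_of_smooth {K : Type*} [Field K] [IsAlgClosed K] {F : MvPolynomial (Fin 4) K}
    (hF : F.IsHomogeneous 3)
    (hs : ∀ x : Fin 4 → K, x ≠ 0 → aeval x F = 0 → ∃ i, aeval x (pderiv i F) ≠ 0) :
    Irreducible F := by
  have hF0 : F ≠ 0 := by
    rintro rfl
    obtain ⟨i, hi⟩ := hs (Pi.single 0 1) (fun h => by simpa using congrFun h 0) (map_zero _)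
    exact hi (by simp)
  -- At a common zero of two complementary factors the product and its gradient vanish, against
  -- smoothness.
  have hnc : ∀ A B : MvPolynomial (Fin 4) K, F = A * B → ∀ x : Fin 4 → K, x ≠ 0 → aeval x A = 0 →
      aeval x B = 0 → False := by
    intro A B h x hx hA hB
    obtain ⟨i, hi⟩ := hs x hx (by rw [h, map_mul, hA, zero_mul])
    apply hi
    rw [h, Derivation.leibniz, map_add, smul_eq_mul, smul_eq_mul, map_mul, map_mul, hA, hB]
    ring
  have hlin : ∀ A B : MvPolynomial (Fin 4) K, F = A * B → A.IsHomogeneous 1 →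
      B.IsHomogeneous 2 → False := by
    intro A B h hA hB
    have hEuler := hA.sum_X_mul_pderiv
    -- the linear form `A` has coefficients `a`
    let a : Fin 4 → K := fun i => coeff 0 (pderiv i A)
    have ha : ∀ i, pderiv i A = C (a i) := fun i => by
      have h0 : (pderiv i A).IsHomogeneous 0 := hA.pderiv
      exact totalDegree_eq_zero_iff_eq_C.1 ((totalDegree_zero_iff_isHomogeneous _).2 h0)
    have hAe : ∀ x : Fin 4 → K, aeval x A = ∑ i, a i * x i := by
      intro x
      have := congrArg (aeval x) hEuler
      simp only [ha, map_sum, map_mul, aeval_X, one_smul, algHom_C, Algebra.algebraMap_self,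
        RingHom.id_apply] at this
      rw [← this]
      exact Finset.sum_congr rfl fun i _ => mul_comm _ _
    -- Three independent vectors of the plane `A = 0` turn `B` into a ternary quadratic form; a
    -- nontrivial zero of it is a common zero of `A` and `B`.
    have hdim : 2 < Module.finrank K (LinearMap.ker (Fintype.linearCombination K a)) := by
      have h1 := LinearMap.finrank_range_add_finrank_ker (Fintype.linearCombination K a)
      have h2 := Submodule.finrank_le (LinearMap.range (Fintype.linearCombination K a))
      simp at h1 h2
      omega
    obtain ⟨v, hv⟩ := exists_linearIndependent_of_le_finrank (Nat.succ_le_of_lt hdim)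
    have hB' : (MvPolynomial.aeval (fun i => ∑ j, C ((v j : Fin 4 → K) i) * X j) B :
        MvPolynomial (Fin 3) K).IsHomogeneous (1 + 1) := by
      have := hB.aeval (fun i => ∑ j, C ((v j : Fin 4 → K) i) * X j) (n := 1) (fun i =>
        IsHomogeneous.sum _ _ _ fun j _ => isHomogeneous_C_mul_X _ j)
      simpa using this
    obtain ⟨y, hy, hy0⟩ := exists_ne_zero_aeval_eq_zero hB'
    have hx : aeval (∑ j, y j • (v j : Fin 4 → K)) B = 0 := by
      rw [← hy0, ← AlgHom.comp_apply, MvPolynomial.comp_aeval]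
      congr 2
      funext i
      simp [mul_comm]
    refine hnc A B h _ (fun h0 => hy ?_) ?_ hx
    · funext j
      refine (Fintype.linearIndependent_iff.1 hv) y ?_ j
      apply Subtype.ext
      simpa using h0
    · have hmem : (∑ j, y j • v j) ∈ (⊤ : Submodule K _) := trivial
      have h3 := (∑ j, y j • v j).2
      rw [LinearMap.mem_ker, Fintype.linearCombination_apply] at h3
      rw [hAe, ← h3]
      simp [mul_comm]
  refine ⟨fun hu => ?_, fun A B h => ?_⟩
  · obtain ⟨r, -, hr⟩ := isUnit_iff_eq_C_of_isReduced.1 hu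
    have := hF.inj_right (hr ▸ isHomogeneous_C _ r) hF0
    omega
  · obtain ⟨a, b, hab, hA, hB⟩ := MvPolynomial.IsHomogeneous.exists_of_mul (h ▸ hF) (h ▸ hF0)
    have hu : ∀ {G : MvPolynomial (Fin 4) K}, G ≠ 0 → G.IsHomogeneous 0 → IsUnit G := by
      intro G hG0 hG
      have := totalDegree_eq_zero_iff_eq_C.1 ((totalDegree_zero_iff_isHomogeneous _).2 hG)
      rw [this] at hG0 ⊢
      exact (IsUnit.mk0 _ fun h => hG0 (by rw [h, C_0])).map C
    have hA0 : A ≠ 0 := left_ne_zero_of_mul (h ▸ hF0)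
    have hB0 : B ≠ 0 := right_ne_zero_of_mul (h ▸ hF0)
    have : a ≤ 3 := by omega
    interval_cases a
    · exact Or.inl (hu hA0 hA)
    · exact (hlin A B h hA (by obtain rfl : b = 2 := by omega
                               exact hB)).elim
    · exact (hlin B A (h.trans (mul_comm _ _)) (by obtain rfl : b = 1 := by omega
                                                   exact hB) hA).elim
    · obtain rfl : b = 0 := by omega
      exact Or.inr (hu hB0 hB)

/-! ### Maximal minors of three vectors of length four. -/

/-- The vector of signed maximal minors of three vectors of length four. -/
def cross4 {R : Type*} [CommRing R] (a b c : Fin 4 → R) : Fin 4 → R :=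
  ![a 1 * (b 2 * c 3 - b 3 * c 2) - a 2 * (b 1 * c 3 - b 3 * c 1) + a 3 * (b 1 * c 2 - b 2 * c 1),
    -(a 0 * (b 2 * c 3 - b 3 * c 2) - a 2 * (b 0 * c 3 - b 3 * c 0) +
      a 3 * (b 0 * c 2 - b 2 * c 0)),
    a 0 * (b 1 * c 3 - b 3 * c 1) - a 1 * (b 0 * c 3 - b 3 * c 0) + a 3 * (b 0 * c 1 - b 1 * c 0),
    -(a 0 * (b 1 * c 2 - b 2 * c 1) - a 1 * (b 0 * c 2 - b 2 * c 0) +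
      a 2 * (b 0 * c 1 - b 1 * c 0))]

/-- A vector orthogonal to three vectors is proportional to their vector of minors. -/
theorem cross4_mul_comm {R : Type*} [CommRing R] {a b c g : Fin 4 → R}
    (ha : ∑ i, a i * g i = 0) (hb : ∑ i, b i * g i = 0) (hc : ∑ i, c i * g i = 0) (i j : Fin 4) :
    cross4 a b c i * g j = cross4 a b c j * g i := by
  simp only [Fin.sum_univ_four] at ha hb hc
  have h01 : cross4 a b c 0 * g 1 = cross4 a b c 1 * g 0 := by
    simp [cross4]
    linear_combination (b 2 * c 3 - b 3 * c 2) * ha - (a 2 * c 3 - a 3 * c 2) * hb +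
      (a 2 * b 3 - a 3 * b 2) * hc
  have h02 : cross4 a b c 0 * g 2 = cross4 a b c 2 * g 0 := by
    simp [cross4]
    linear_combination -(b 1 * c 3 - b 3 * c 1) * ha + (a 1 * c 3 - a 3 * c 1) * hb -
      (a 1 * b 3 - a 3 * b 1) * hc
  have h03 : cross4 a b c 0 * g 3 = cross4 a b c 3 * g 0 := by
    simp [cross4]
    linear_combination (b 1 * c 2 - b 2 * c 1) * ha - (a 1 * c 2 - a 2 * c 1) * hb +
      (a 1 * b 2 - a 2 * b 1) * hc
  have h12 : cross4 a b c 1 * g 2 = cross4 a b c 2 * g 1 := by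
    simp [cross4]
    linear_combination (b 0 * c 3 - b 3 * c 0) * ha - (a 0 * c 3 - a 3 * c 0) * hb +
      (a 0 * b 3 - a 3 * b 0) * hc
  have h13 : cross4 a b c 1 * g 3 = cross4 a b c 3 * g 1 := by
    simp [cross4]
    linear_combination -(b 0 * c 2 - b 2 * c 0) * ha + (a 0 * c 2 - a 2 * c 0) * hb -
      (a 0 * b 2 - a 2 * b 0) * hc
  have h23 : cross4 a b c 2 * g 3 = cross4 a b c 3 * g 2 := by
    simp [cross4]
    linear_combination (b 0 * c 1 - b 1 * c 0) * ha - (a 0 * c 1 - a 1 * c 0) * hb +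
      (a 0 * b 1 - a 1 * b 0) * hc
  fin_cases i <;> fin_cases j <;> first | rfl | assumption | (symm; assumption)

/-- A relation between four vectors gives a relation between their vectors of minors. -/
theorem cross4_mul_of_relation {R : Type*} [CommRing R] {a x y z : Fin 4 → R} {r s t d : R}
    (h : ∀ i, r * x i + s * y i + t * z i = d * a i) (i : Fin 4) :
    cross4 a y z i * s = cross4 a z x i * r := by
  -- The third argument is zero by `h`; expanding it by multilinearity, the terms in `z` and `a`
  -- drop out as repeated rows.
  have h0 : cross4 a z (fun i => r * x i + s * y i + t * z i - d * a i) i = 0 := by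
    simp only [h, sub_self]
    fin_cases i <;> simp [cross4]
  rw [← sub_eq_zero, ← neg_eq_zero, ← h0]
  fin_cases i <;> simp [cross4] <;> ring

/-- Three vectors of length four whose maximal minors vanish are linearly dependent. -/
theorem exists_relation_of_cross4_eq_zero {K : Type*} [Field K] {a b c : Fin 4 → K}
    (h : cross4 a b c = 0) :
    ∃ α β γ : K, ¬ (α = 0 ∧ β = 0 ∧ γ = 0) ∧ ∀ i, α * a i + β * b i + γ * c i = 0 := by
  by_contra hcon
  push Not at hcon
  have hli : LinearIndependent K ![a, b, c] := by
    rw [Fintype.linearIndependent_iff]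
    intro w hw
    by_contra! hne
    obtain ⟨i, hi⟩ := hne
    by_cases h0 : w 0 = 0 ∧ w 1 = 0 ∧ w 2 = 0
    · fin_cases i
      · exact hi h0.1
      · exact hi h0.2.1
      · exact hi h0.2.2
    · obtain ⟨j, hj⟩ := hcon (w 0) (w 1) (w 2) (fun h1 h2 h3 => h0 ⟨h1, h2, h3⟩)
      apply hj
      have := congrFun hw j
      simpa [Fin.sum_univ_three] using this
  -- Independent vectors complete to a basis; expanding its nonzero determinant along the added row
  -- `e` expresses it through the minors.
  obtain ⟨e, he⟩ := exists_linearIndependent_cons_of_lt_finrank hli (by simp)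
  have hdet : (Matrix.of (Fin.cons e ![a, b, c] : Fin 4 → Fin 4 → K)).det ≠ 0 := by
    have := (Matrix.linearIndependent_rows_iff_isUnit
      (A := Matrix.of (Fin.cons e ![a, b, c] : Fin 4 → Fin 4 → K))).1 he
    rw [Matrix.isUnit_iff_isUnit_det] at this
    exact this.ne_zero
  apply hdet
  have h0 := congrFun h 0
  have h1 := congrFun h 1
  have h2 := congrFun h 2
  have h3 := congrFun h 3
  simp [cross4] at h0 h1 h2 h3
  rw [Matrix.det_succ_row_zero]
  simp [Fin.sum_univ_four, Matrix.det_fin_three, Fin.succAbove]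
  linear_combination e 0 * h0 + e 1 * h1 + e 2 * h2 + e 3 * h3

theorem aeval_aeval_vec {σ τ k R : Type*} [CommRing k] [CommRing R] [Algebra k R]
    (u : τ → R) (q : σ → MvPolynomial τ k) (G : MvPolynomial σ k) :
    aeval u (aeval q G) = aeval (fun l => aeval u (q l)) G := by
  rw [← AlgHom.comp_apply, MvPolynomial.comp_aeval]

/-! ### Parametrizations inverted by a morphism: immersivity, Jacobian and degree. -/

/-- `q` is a nonzero rational parametrization over `k` of the smooth cubic surface `F = 0`, which is
inverted by a morphism to the plane over `k`. The relation `M` between coordinate vectors is the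
graph of the morphism. -/
structure Parametrization {k K : Type*} [Field k] [Field K] [Algebra k K]
    (F : MvPolynomial (Fin 4) k) (q : Fin 4 → MvPolynomial (Fin 3) k)
    (M : (Fin 4 → K) → (Fin 3 → K) → Prop) : Prop where
  cubic : F.IsHomogeneous 3
  smooth : ∀ y : Fin 4 → K, y ≠ 0 → aeval y F = 0 → ∃ i, aeval y (pderiv i F) ≠ 0
  ne_zero : ∃ i, q i ≠ 0
  relation : aeval q F = 0
  mem : ∀ y u, M y u → y ≠ 0 ∧ aeval y F = 0 ∧ u ≠ 0
  exists_local : ∀ y : Fin 4 → K, y ≠ 0 → aeval y F = 0 →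
    ∃ (e : ℕ) (f : Fin 3 → MvPolynomial (Fin 4) k), (∀ j, (f j).IsHomogeneous e) ∧
      (∃ j, aeval y (f j) ≠ 0) ∧ (∀ i j, aeval q (f i) * X j = aeval q (f j) * X i) ∧
      ∀ y' : Fin 4 → K, y' ≠ 0 → aeval y' F = 0 → (∃ j, aeval y' (f j) ≠ 0) → ∀ u : Fin 3 → K,
        M y' u ↔ u ≠ 0 ∧ ∀ i j, aeval y' (f i) * u j = aeval y' (f j) * u i

namespace Parametrization

variable {k K : Type*} [Field k] [Field K] [Algebra k K]
  {F : MvPolynomial (Fin 4) k} {q : Fin 4 → MvPolynomial (Fin 3) k}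
  {M : (Fin 4 → K) → (Fin 3 → K) → Prop}

theorem aeval_eq_zero (h : Parametrization F q M) (u : Fin 3 → K) :
    aeval (fun i => aeval u (q i)) F = 0 := by
  rw [← aeval_aeval_vec, h.relation, map_zero]

/-- The parametrization is injective on tangent spaces. -/
theorem exists_tangent (h : Parametrization F q M) {u : Fin 3 → K}
    (hu : ∃ i, aeval u (q i) ≠ 0) :
    ∃ φ : Fin 3 → K, φ ≠ 0 ∧ (∀ i j, φ i * u j = φ j * u i) ∧
      ∀ (v : Fin 3 → K) (α : K), (∀ i, ∑ a, v a * aeval u (pderiv a (q i)) = α * aeval u (q i)) →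
        ∀ i j, φ i * v j = φ j * v i := by
  obtain ⟨e, f, hf, ⟨j₀, hj₀⟩, hR, -⟩ := h.exists_local (fun i => aeval u (q i))
    (fun h0 => by obtain ⟨i, hi⟩ := hu; exact hi (congrFun h0 i)) (h.aeval_eq_zero u)
  -- `φ` is the value at `q(u)` of the forms that give the morphism, so it is proportional to `u`.
  -- The second claim comes from differentiating `f i (q) * X j = f j (q) * X i` along `v`: by
  -- Euler's formula the derivative of `f i (q)` is `α * e * φ i`, and these terms cancel because
  -- `φ` is proportional to `u`.
  refine ⟨fun j => aeval (fun i => aeval u (q i)) (f j), fun h0 => hj₀ (congrFun h0 j₀),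
    fun i j => ?_, fun v α hv i j => ?_⟩
  · have := congrArg (aeval u) (hR i j)
    simpa only [map_mul, aeval_X, aeval_aeval_vec] using this
  · have hE : ∀ i, ∑ a, v a * aeval u (pderiv a (aeval q (f i))) =
        α * (e * aeval (fun i => aeval u (q i)) (f i)) := by
      intro i
      have h1 := congrArg (aeval (fun i => aeval u (q i))) ((hf i).sum_X_mul_pderiv)
      simp only [map_sum, map_mul, aeval_X, nsmul_eq_mul, map_natCast] at h1
      rw [← h1, Finset.mul_sum]
      simp only [derivation_aeval, map_sum, map_mul, aeval_aeval_vec, Finset.mul_sum]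
      rw [Finset.sum_comm]
      refine Finset.sum_congr rfl fun l _ => ?_
      rw [← mul_assoc, ← hv l, Finset.sum_mul]
      exact Finset.sum_congr rfl fun a _ => by ring
    have hd : ∀ a, aeval u (pderiv a (aeval q (f i))) * u j +
        aeval (fun i => aeval u (q i)) (f i) * (if a = j then 1 else 0) =
        aeval u (pderiv a (aeval q (f j))) * u i +
        aeval (fun i => aeval u (q i)) (f j) * (if a = i then 1 else 0) := by
      intro a
      have := congrArg (fun G => aeval u (pderiv a G)) (hR i j)
      simp only [Derivation.leibniz, pderiv_X, smul_eq_mul, map_add, map_mul, aeval_X,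
        aeval_aeval_vec, Pi.single_apply, eq_comm (a := a)] at this ⊢
      simp only [apply_ite (aeval u), map_one, map_zero] at this
      linear_combination this
    have hs := Finset.sum_congr (rfl : (Finset.univ : Finset (Fin 3)) = Finset.univ)
      fun a _ => congrArg (fun t => v a * t) (hd a)
    simp only [mul_add, Finset.sum_add_distrib, ← mul_assoc, ← Finset.sum_mul, hE] at hs
    simp only [mul_ite, mul_one, mul_zero, Finset.sum_ite_eq', Finset.mem_univ, if_true] at hs
    have h2 := congrArg (aeval u) (hR i j)
    simp only [map_mul, aeval_X, aeval_aeval_vec] at h2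
    linear_combination hs - α * e * h2

theorem exists_aeval_ne_zero [Infinite K] (h : Parametrization F q M) :
    ∃ (u : Fin 3 → K) (i : Fin 4), aeval u (q i) ≠ 0 := by
  obtain ⟨i, hi⟩ := h.ne_zero
  by_contra! hcon
  apply hi
  apply MvPolynomial.map_injective (algebraMap k K) (algebraMap k K).injective
  rw [map_zero]
  refine MvPolynomial.funext fun u => ?_
  rw [eval_map, map_zero, ← aeval_def]
  exact hcon u i

/-- Constant forms have zero derivative in every direction, whereas off the base locus the
directions killed by the derivative are all proportional to one nonzero vector (`exists_tangent`).
-/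
theorem degree_ne_zero [Infinite K] (h : Parametrization F q M) {d : ℕ}
    (hq : ∀ i, (q i).IsHomogeneous d) : d ≠ 0 := by
  rintro rfl
  obtain ⟨u, hu⟩ := h.exists_aeval_ne_zero
  obtain ⟨φ, hφ, -, ht⟩ := h.exists_tangent hu
  apply hφ
  have hd : ∀ a i, pderiv a (q i) = 0 := fun a i => by
    rw [totalDegree_eq_zero_iff_eq_C.1 ((totalDegree_zero_iff_isHomogeneous _).2 (hq i)), pderiv_C]
  have h2 : ∀ v : Fin 3 → K, ∀ i j, φ i * v j = φ j * v i := fun v => ht v 0 (by simp [hd])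
  funext i
  have := h2 (Pi.single (i + 1) 1) i (i + 1)
  rw [Pi.single_eq_same, Pi.single_eq_of_ne (by fin_cases i <;> decide)] at this
  simpa using this

/-- The minors of the Jacobian of the parametrization, as multiples of the gradient of `F`. -/
theorem exists_jacobian [IsAlgClosed K] (h : Parametrization F q M) {d : ℕ}
    (hq : ∀ i, (q i).IsHomogeneous d) (hcop : ∀ π, Irreducible π → ∃ i, ¬ π ∣ q i) :
    d = 3 ∧ ∃ c₀ : k, c₀ ≠ 0 ∧ ∀ c i, cross4 q (fun l => pderiv (c + 1) (q l))
      (fun l => pderiv (c + 2) (q l)) i = C c₀ * X c * aeval q (pderiv i F) := by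
  have : Infinite K := IsAlgClosed.instInfinite
  -- an irreducible polynomial has a zero outside the base locus
  have hnull : ∀ π : MvPolynomial (Fin 3) k, Irreducible π →
      ∃ u : Fin 3 → K, aeval u π = 0 ∧ ∃ i, aeval u (q i) ≠ 0 := by
    intro π hπ
    obtain ⟨i, hi⟩ := hcop π hπ
    -- If all `q i` vanished on the zero locus of `π`, the Nullstellensatz would make `π` divide
    -- each of them.
    by_contra! hcon
    apply hi
    have hprime : (Ideal.span {π}).IsPrime :=
      (Ideal.span_singleton_prime hπ.ne_zero).2 hπ.prime
    rw [← Ideal.mem_span_singleton, ← IsPrime.vanishingIdeal_zeroLocus (K := K) (Ideal.span {π})]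
    intro u hu
    exact hcon u (hu π (Ideal.mem_span_singleton_self π)) i
  let g : Fin 4 → MvPolynomial (Fin 3) k := fun i => aeval q (pderiv i F)
  let N : Fin 3 → Fin 4 → MvPolynomial (Fin 3) k := fun c =>
    cross4 q (fun l => pderiv (c + 1) (q l)) (fun l => pderiv (c + 2) (q l))
  have hgev : ∀ u : Fin 3 → K, (∃ i, aeval u (q i) ≠ 0) → ∃ i, aeval u (g i) ≠ 0 := by
    intro u hu
    obtain ⟨i, hi⟩ := h.smooth (fun i => aeval u (q i))
      (fun h0 => by obtain ⟨i, hi⟩ := hu; exact hi (congrFun h0 i)) (h.aeval_eq_zero u)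
    exact ⟨i, by rwa [aeval_aeval_vec]⟩
  obtain ⟨u₀, hu₀⟩ := h.exists_aeval_ne_zero
  have hg0 : ∃ i, g i ≠ 0 := by
    obtain ⟨i, hi⟩ := hgev u₀ hu₀
    exact ⟨i, fun h0 => hi (by rw [h0, map_zero])⟩
  have hgcop : ∀ π, Irreducible π → ∃ i, ¬ π ∣ g i := by
    intro π hπ
    obtain ⟨u, hu, hqu⟩ := hnull π hπ
    obtain ⟨i, hi⟩ := hgev u hqu
    refine ⟨i, fun ⟨t, ht⟩ => hi ?_⟩
    rw [ht, map_mul, hu, zero_mul]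
  -- Euler's formula and differentiation of `F(q) = 0` make `g` orthogonal to `q` and to its partial
  -- derivatives. The minors are orthogonal to these as well, so they are multiples of the coprime
  -- vector `g`.
  have horth0 : ∑ i, q i * g i = 0 := by
    have := congrArg (aeval q) h.cubic.sum_X_mul_pderiv
    simpa only [map_sum, map_mul, aeval_X, nsmul_eq_mul, h.relation, mul_zero] using this
  have horth : ∀ a, ∑ i, pderiv a (q i) * g i = 0 := by
    intro a
    have := derivation_aeval (pderiv a) q F
    rw [h.relation, map_zero] at this
    rw [this]
    exact Finset.sum_congr rfl fun i _ => mul_comm _ _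
  have hC : ∀ c, ∃ t, ∀ i, N c i = t * g i := fun c =>
    exists_eq_mul_of_proportional _ _ hg0 hgcop
      (cross4_mul_comm horth0 (horth (c + 1)) (horth (c + 2)))
  choose t ht using hC
  have hEuler : ∀ i, X 0 * pderiv 0 (q i) + X 1 * pderiv 1 (q i) + X 2 * pderiv 2 (q i) =
      (d : MvPolynomial (Fin 3) k) * q i := fun i => by
    have := (hq i).sum_X_mul_pderiv
    rwa [Fin.sum_univ_three, nsmul_eq_mul] at this
  -- Euler's relation for the `q i` compares the three choices of omitted derivative; since the
  -- variables are coprime, `t` is then a multiple `c'` of the vector of variables.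
  have htX : ∀ a b, t a * X b = t b * X a := by
    obtain ⟨i, hi⟩ := hg0
    have key : ∀ a b, N a i * X b = N b i * X a → t a * X b = t b * X a := by
      intro a b hab
      apply mul_right_cancel₀ hi
      rw [ht, ht] at hab
      linear_combination hab
    have h01 := key 0 1 (cross4_mul_of_relation hEuler i)
    have h12 := key 1 2 (cross4_mul_of_relation (r := X 1) (s := X 2) (t := X 0)
      (d := (d : MvPolynomial (Fin 3) k))
      (fun i => show X 1 * pderiv 1 (q i) + X 2 * pderiv 2 (q i) + X 0 * pderiv 0 (q i) = _ by
        rw [← hEuler i]; ring) i)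
    have h20 := key 2 0 (cross4_mul_of_relation (r := X 2) (s := X 0) (t := X 1)
      (d := (d : MvPolynomial (Fin 3) k))
      (fun i => show X 2 * pderiv 2 (q i) + X 0 * pderiv 0 (q i) + X 1 * pderiv 1 (q i) = _ by
        rw [← hEuler i]; ring) i)
    intro a b
    fin_cases a <;> fin_cases b <;> first | rfl | assumption | (symm; assumption)
  obtain ⟨c', hc'⟩ := exists_eq_mul_of_proportional t (fun a => X a) ⟨0, X_ne_zero 0⟩
    (fun π hπ => by
      by_contra! hall
      obtain ⟨u, hu, i, hi⟩ := hnull π hπ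
      have hu0 : u = (0 : K) • u := by
        funext a
        obtain ⟨s, hs⟩ := hall a
        have := congrArg (aeval u) hs
        rw [map_mul, hu, zero_mul, aeval_X] at this
        simp [this]
      apply hi
      rw [hu0, (hq i).aeval_smul_vec, zero_pow (h.degree_ne_zero hq), zero_mul]) htX
  have hN : ∀ c i, N c i = c' * X c * g i := fun c i => by rw [ht, hc']
  -- At a zero `u` of `c'` off the base locus the three rows would be dependent. By `exists_tangent`
  -- the resulting direction is proportional to `u`; as its entry at `c` is zero and `u c ≠ 0`, the
  -- direction vanishes, and then so does the coefficient of `q(u)`.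
  have hc'ev : ∀ u : Fin 3 → K, (∃ i, aeval u (q i) ≠ 0) → aeval u c' ≠ 0 := by
    intro u hu hc0
    have hu0 : u ≠ 0 := by
      rintro rfl
      obtain ⟨i, hi⟩ := hu
      apply hi
      have := (hq i).aeval_smul_vec (0 : K) (0 : Fin 3 → K)
      rwa [zero_smul, zero_pow (h.degree_ne_zero hq), zero_mul] at this
    obtain ⟨c, hc⟩ := Function.ne_iff.1 hu0
    obtain ⟨φ, hφ, hφu, hφt⟩ := h.exists_tangent hu
    have hz : cross4 (fun i => aeval u (q i)) (fun i => aeval u (pderiv (c + 1) (q i)))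
        (fun i => aeval u (pderiv (c + 2) (q i))) = 0 := by
      funext i
      have := congrArg (aeval u) (hN c i)
      rw [map_mul, map_mul, hc0, zero_mul, zero_mul] at this
      rw [Pi.zero_apply, ← this]
      fin_cases i <;> simp [N, cross4]
    obtain ⟨α, β, γ, hne, hrel⟩ := exists_relation_of_cross4_eq_zero hz
    have hv := hφt (Pi.single (c + 1) β + Pi.single (c + 2) γ) (-α) (fun i => by
      simp only [Pi.add_apply, add_mul, Finset.sum_add_distrib, Pi.single_apply, ite_mul, zero_mul,
        Finset.sum_ite_eq', Finset.mem_univ, if_true]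
      linear_combination hrel i)
    have h12 : c + 1 ≠ c := by fin_cases c <;> decide
    have h13 : c + 2 ≠ c := by fin_cases c <;> decide
    have h23 : c + 1 ≠ c + 2 := by fin_cases c <;> decide
    have hφc : φ c ≠ 0 := by
      intro h0
      apply hφ
      funext i
      have := hφu i c
      rw [h0, zero_mul] at this
      exact (mul_eq_zero.1 this).resolve_right hc
    have hβ : β = 0 := by
      have := hv c (c + 1)
      simp only [Pi.add_apply, Pi.single_eq_same, Pi.single_eq_of_ne h23,
        Pi.single_eq_of_ne h12.symm, Pi.single_eq_of_ne h13.symm, add_zero, mul_zero] at this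
      exact (mul_eq_zero.1 this).resolve_left hφc
    have hγ : γ = 0 := by
      have := hv c (c + 2)
      simp only [Pi.add_apply, Pi.single_eq_same, Pi.single_eq_of_ne h23.symm,
        Pi.single_eq_of_ne h12.symm, Pi.single_eq_of_ne h13.symm, zero_add, add_zero, mul_zero]
        at this
      exact (mul_eq_zero.1 this).resolve_left hφc
    obtain ⟨i, hi⟩ := hu
    refine hne ⟨?_, hβ, hγ⟩
    have := hrel i
    rw [hβ, hγ, zero_mul, zero_mul, add_zero, add_zero] at this
    exact (mul_eq_zero.1 this).resolve_right hi
  have hc'0 : c' ≠ 0 := fun h0 => hc'ev u₀ hu₀ (by rw [h0, map_zero])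
  have hunit : IsUnit c' := by
    by_contra hnu
    obtain ⟨π, hπ, s, hs⟩ := WfDvdMonoid.exists_irreducible_factor hnu hc'0
    obtain ⟨u, hu, hqu⟩ := hnull π hπ
    exact hc'ev u hqu (by rw [hs, map_mul, hu, zero_mul])
  obtain ⟨c₀, hc₀, rfl⟩ := isUnit_iff_eq_C_of_isReduced.1 hunit
  refine ⟨?_, c₀, hc₀.ne_zero, hN⟩
  obtain ⟨i, hi⟩ := hg0
  -- The minors have degree `d + 2 * (d - 1)` and the right-hand side, with constant `c'`, has
  -- degree `1 + 2 * d`. With `d ≠ 0`, which keeps the subtraction honest, this forces `d = 3`.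
  have h1 : (N 0 i).IsHomogeneous (d + ((d - 1) + (d - 1))) := by
    have hm : ∀ a b c, (q a * (pderiv (0 + 1) (q b) * pderiv (0 + 2) (q c) -
        pderiv (0 + 1) (q c) * pderiv (0 + 2) (q b))).IsHomogeneous (d + ((d - 1) + (d - 1))) :=
      fun a b c => (hq a).mul
        ((((hq b).pderiv).mul ((hq c).pderiv)).sub (((hq c).pderiv).mul ((hq b).pderiv)))
    fin_cases i
    · exact ((hm 1 2 3).sub (hm 2 1 3)).add (hm 3 1 2)
    · exact (((hm 0 2 3).sub (hm 2 0 3)).add (hm 3 0 2)).neg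
    · exact ((hm 0 1 3).sub (hm 1 0 3)).add (hm 3 0 1)
    · exact (((hm 0 1 2).sub (hm 1 0 2)).add (hm 2 0 1)).neg
  have h2 : (N 0 i).IsHomogeneous (0 + 1 + d * 2) := by
    rw [hN]
    exact ((isHomogeneous_C _ _).mul (isHomogeneous_X _ _)).mul ((h.cubic.pderiv).aeval q hq)
  have h3 : N 0 i ≠ 0 := by
    rw [hN]
    exact mul_ne_zero (mul_ne_zero hc'0 (X_ne_zero _)) hi
  have h4 := h1.inj_right h2 h3
  have := h.degree_ne_zero hq
  omega

end Parametrization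

/-! ### Determinants, directional derivatives, and polynomials along a line. -/

/-- The determinant of three vectors of length three. -/
def det3 {R : Type*} [CommRing R] (y v w : Fin 3 → R) : R :=
  y 0 * (v 1 * w 2 - v 2 * w 1) + y 1 * (v 2 * w 0 - v 0 * w 2) + y 2 * (v 0 * w 1 - v 1 * w 0)

/-- Cramer's rule without denominators. -/
theorem det3_smul_eq {R : Type*} [CommRing R] (u v w x : Fin 3 → R) (a : Fin 3) :
    det3 u v w * x a = det3 x v w * u a + det3 u x w * v a + det3 u v x * w a := by
  fin_cases a <;> simp [det3] <;> ring

theorem exists_det3_eq_one {K : Type*} [Field K] {u v : Fin 3 → K}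
    (h : ¬ ∀ i j, u i * v j = u j * v i) : ∃ w, det3 u v w = 1 := by
  have key : ∀ w, det3 u v w ≠ 0 → ∃ w, det3 u v w = 1 := by
    intro w hw
    refine ⟨(det3 u v w)⁻¹ • w, ?_⟩
    have : det3 u v ((det3 u v w)⁻¹ • w) = (det3 u v w)⁻¹ * det3 u v w := by
      generalize (det3 u v w)⁻¹ = c
      simp [det3]; ring
    rw [this, inv_mul_cancel₀ hw]
  by_contra hcon
  have hz : ∀ w, det3 u v w = 0 := fun w => by
    by_contra hw
    exact hcon (key w hw)
  have h0 := hz ![1, 0, 0]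
  have h1 := hz ![0, 1, 0]
  have h2 := hz ![0, 0, 1]
  simp [det3] at h0 h1 h2
  apply h
  intro i j
  fin_cases i <;> fin_cases j <;> simp <;>
    first
    | ring1
    | (linear_combination h0)
    | (linear_combination h1)
    | (linear_combination h2)
    | (linear_combination -h0)
    | (linear_combination -h1)
    | (linear_combination -h2)

/-- By multilinearity, the minors for directions `v`, `w` combine those for the coordinate
directions, with the minors of `(v, w)` as coefficients. This carries the Jacobian identity from
coordinate directions to arbitrary ones, `det3 y v w` taking the place of a coordinate of `y`. -/
theorem cross4_combination {R : Type*} [CommRing R] {A : Fin 4 → R} {D : Fin 3 → Fin 4 → R} {g : R}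
    {y : Fin 3 → R} (v w : Fin 3 → R) {i : Fin 4} (e0 : cross4 A (D 1) (D 2) i = y 0 * g)
    (e1 : cross4 A (D 2) (D 0) i = y 1 * g) (e2 : cross4 A (D 0) (D 1) i = y 2 * g) :
    cross4 A (fun l => ∑ a, D a l * v a) (fun l => ∑ a, w a * D a l) i = g * det3 y v w := by
  fin_cases i <;> simp [cross4, Fin.sum_univ_three, det3] at e0 e1 e2 ⊢ <;>
    linear_combination (v 1 * w 2 - v 2 * w 1) * e0 + (v 2 * w 0 - v 0 * w 2) * e1 +
      (v 0 * w 1 - v 1 * w 0) * e2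

/-- The derivative of a vector of forms at `u` in the direction `v`. -/
noncomputable def dirDeriv {K : Type*} [Field K] (q : Fin 4 → MvPolynomial (Fin 3) K)
    (u v : Fin 3 → K) : Fin 4 → K :=
  fun i => ∑ a, v a * aeval u (pderiv a (q i))

theorem dirDeriv_add_smul {K : Type*} [Field K] (q : Fin 4 → MvPolynomial (Fin 3) K)
    (u v w : Fin 3 → K) (α β : K) :
    dirDeriv q u (α • v + β • w) = α • dirDeriv q u v + β • dirDeriv q u w := by
  funext i
  simp only [dirDeriv, Pi.add_apply, Pi.smul_apply, smul_eq_mul, add_mul, Finset.sum_add_distrib,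
    Finset.mul_sum, mul_assoc]

theorem polynomial_eval_aeval {K σ : Type*} [Field K] (y : σ → Polynomial K) (c : K)
    (G : MvPolynomial σ K) :
    (aeval y G).eval c = aeval (fun a => (y a).eval c) G := by
  rw [← Polynomial.coe_aeval_eq_eval, ← AlgHom.coe_toRingHom]
  rw [AlgHom.coe_toRingHom, ← AlgHom.comp_apply, MvPolynomial.comp_aeval]

/-- A nonzero vector of polynomials is a power of the variable times a vector that does not vanish
at zero. -/
theorem exists_eq_X_pow_mul {K ι : Type*} [Field K] (Q : ι → Polynomial K)
    (hQ : ∃ i, Q i ≠ 0) :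
    ∃ (m : ℕ) (s : ι → Polynomial K), (∀ i, Q i = Polynomial.X ^ m * s i) ∧
      ∃ i, (s i).eval 0 ≠ 0 := by
  obtain ⟨i, hi⟩ := hQ
  induction hn : (Q i).natDegree using Nat.strong_induction_on generalizing Q with
  | _ n ih =>
    by_cases h : ∃ j, (Q j).eval 0 ≠ 0
    · exact ⟨0, Q, fun j => by simp, h⟩
    · push Not at h
      have hd : ∀ j, ∃ t, Q j = Polynomial.X * t := fun j =>
        Polynomial.X_dvd_iff.2 (by rw [Polynomial.coeff_zero_eq_eval_zero, h j])
      choose t ht using hd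
      have hti : t i ≠ 0 := fun h0 => hi (by rw [ht, h0, mul_zero])
      obtain ⟨m, s, hs, hs0⟩ := ih (t i).natDegree
        (by rw [← hn, ht i, Polynomial.natDegree_X_mul hti]; omega) t hti rfl
      exact ⟨m + 1, s, fun j => by rw [ht, hs]; ring, hs0⟩

/-! ### Cubic parametrizations: base change, and the derivative at a base point. -/

/-- A nonzero parametrization by cubic forms, with its Jacobian. -/
structure CubicParametrization {k K : Type*} [Field k] [Field K] [Algebra k K]
    (F : MvPolynomial (Fin 4) k) (q : Fin 4 → MvPolynomial (Fin 3) k)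
    (M : (Fin 4 → K) → (Fin 3 → K) → Prop) : Prop extends Parametrization F q M where
  homog : ∀ i, (q i).IsHomogeneous 3
  jacobian : ∃ c₀ : k, c₀ ≠ 0 ∧ ∀ c i, cross4 q (fun l => pderiv (c + 1) (q l))
      (fun l => pderiv (c + 2) (q l)) i = C c₀ * X c * aeval q (pderiv i F)

namespace CubicParametrization

/-- Extension of the base field. -/
theorem map {k K : Type*} [Field k] [Field K] [Algebra k K]
    {F : MvPolynomial (Fin 4) k} {q : Fin 4 → MvPolynomial (Fin 3) k}
    {M : (Fin 4 → K) → (Fin 3 → K) → Prop} (h : CubicParametrization F q M) :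
    CubicParametrization (K := K) (MvPolynomial.map (algebraMap k K) F)
      (fun i => MvPolynomial.map (algebraMap k K) (q i)) M := by
  have hmap : ∀ G : MvPolynomial (Fin 4) k,
      aeval (fun i => MvPolynomial.map (algebraMap k K) (q i))
        (MvPolynomial.map (algebraMap k K) G) = MvPolynomial.map (algebraMap k K) (aeval q G) := by
    intro G
    induction G using MvPolynomial.induction_on with
    | C a => simp [algHom_C]
    | add p q hp hq => simp only [map_add, hp, hq]
    | mul_X p i hp => simp only [map_mul, hp, map_X, aeval_X]
  refine { cubic := h.cubic.map _, smooth := ?_, ne_zero := ?_, relation := ?_, mem := ?_,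
           exists_local := ?_, homog := fun i => (h.homog i).map _, jacobian := ?_ }
  · intro y hy hF
    rw [aeval_map_algebraMap] at hF
    obtain ⟨i, hi⟩ := h.smooth y hy hF
    exact ⟨i, by rwa [pderiv_map, aeval_map_algebraMap]⟩
  · obtain ⟨i, hi⟩ := h.ne_zero
    exact ⟨i, fun h0 => hi (MvPolynomial.map_injective _ (algebraMap k K).injective
      (by rw [h0, map_zero]))⟩
  · rw [hmap, h.relation, map_zero]
  · intro y u hy
    rw [aeval_map_algebraMap]
    exact h.mem y u hy
  · intro y hy hF
    rw [aeval_map_algebraMap] at hF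
    obtain ⟨e, f, hf, hfy, hR, hM⟩ := h.exists_local y hy hF
    refine ⟨e, fun i => MvPolynomial.map (algebraMap k K) (f i), fun j => (hf j).map _, ?_, ?_, ?_⟩
    · simpa only [aeval_map_algebraMap] using hfy
    · intro i j
      rw [hmap, hmap]
      have := congrArg (MvPolynomial.map (algebraMap k K)) (hR i j)
      simpa only [map_mul, map_X] using this
    · simpa only [aeval_map_algebraMap] using hM
  · obtain ⟨c₀, hc₀, hJ⟩ := h.jacobian
    refine ⟨algebraMap k K c₀, fun h0 => hc₀ ((algebraMap k K).injective (by rw [h0, map_zero])),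
      fun c i => ?_⟩
    have := congrArg (MvPolynomial.map (algebraMap k K)) (hJ c i)
    simp only [map_mul, map_X, map_C] at this
    rw [pderiv_map, hmap, ← this]
    simp only [pderiv_map]
    fin_cases i <;> simp [cross4]

variable {K : Type*} [Field K]
  {F : MvPolynomial (Fin 4) K} {q : Fin 4 → MvPolynomial (Fin 3) K}
  {M : (Fin 4 → K) → (Fin 3 → K) → Prop}

/-- The Jacobian along a line. -/
theorem cross4_ne_zero (h : CubicParametrization F q M) {u v w : Fin 3 → K}
    (hd : det3 u v w = 1) {m : ℕ} {s : Fin 4 → Polynomial K}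
    (hs : ∀ i, aeval (fun a => Polynomial.C (u a) + Polynomial.X * Polynomial.C (v a)) (q i) =
      Polynomial.X ^ m * s i) (hs0 : ∃ i, (s i).eval 0 ≠ 0) :
    ∃ i, cross4 (fun i => (s i).eval 0) (fun i => (s i).derivative.eval 0) (dirDeriv q u w) i
      ≠ 0 := by
  obtain ⟨c₀, hc₀, hJ⟩ := h.jacobian
  -- Along `y = u + T v` the Jacobian identity equates the minors of `q(y)`, its derivative in `T`,
  -- and the derivative along `w` with `c₀` times the gradient of `F` at `q(y)`, because `det3 y v w
  -- = 1`. Substituting `q(y) = T ^ m * s` lets both sides be divided by `T ^ (2 * m)`. The identity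
  -- therefore survives at `T = 0`, where `s(0)` is a point of the surface with nonzero gradient.
  set y : Fin 3 → Polynomial K := fun a => Polynomial.C (u a) + Polynomial.X * Polynomial.C (v a)
    with hy
  have hsF : aeval s F = 0 := by
    have h1 := congrArg (aeval y) h.relation
    rw [aeval_aeval_vec, map_zero] at h1
    have h2 : (fun l => aeval y (q l)) = (Polynomial.X ^ m : Polynomial K) • s := funext hs
    rw [h2, h.cubic.aeval_smul_vec] at h1
    exact (mul_eq_zero.1 h1).resolve_left (by simp)
  obtain ⟨i, hi⟩ := h.smooth (fun i => (s i).eval 0)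
    (fun h0 => by obtain ⟨i, hi⟩ := hs0; exact hi (congrFun h0 i))
    (by rw [← polynomial_eval_aeval, hsF, Polynomial.eval_zero])
  refine ⟨i, fun hcr => hi ?_⟩
  let r : Fin 4 → Polynomial K := fun l => ∑ a, Polynomial.C (w a) * aeval y (pderiv a (q l))
  have hder : ∀ l, Polynomial.derivative (Polynomial.X ^ m * s l) =
      ∑ a, aeval y (pderiv a (q l)) * Polynomial.C (v a) := by
    intro l
    have hyd : ∀ a, Polynomial.derivative (y a) = Polynomial.C (v a) := fun a => by simp [hy]
    have := derivation_aeval (Polynomial.derivative' (R := K)) y (q l)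
    rw [hs l] at this
    change Polynomial.derivative _ = ∑ a, _ * Polynomial.derivative (y a) at this
    simpa only [hyd] using this
  have hgrad : aeval y (aeval q (pderiv i F)) = (Polynomial.X ^ m) ^ 2 * aeval s (pderiv i F) := by
    rw [aeval_aeval_vec]
    have h2 : (fun l => aeval y (q l)) = (Polynomial.X ^ m : Polynomial K) • s := funext hs
    rw [h2, (h.cubic.pderiv (i := i)).aeval_smul_vec]
  have hE : ∀ c, cross4 (fun l => aeval y (q l)) (fun l => aeval y (pderiv (c + 1) (q l)))
      (fun l => aeval y (pderiv (c + 2) (q l))) i =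
      Polynomial.C c₀ * y c * aeval y (aeval q (pderiv i F)) := by
    intro c
    have := congrArg (aeval y) (hJ c i)
    simp only [map_mul, aeval_X, algHom_C] at this
    rw [Polynomial.algebraMap_eq] at this
    rw [← this]
    fin_cases i <;> simp [cross4]
  have hdet : det3 y (fun a => Polynomial.C (v a)) (fun a => Polynomial.C (w a)) = 1 := by
    have : det3 y (fun a => Polynomial.C (v a)) (fun a => Polynomial.C (w a)) =
        Polynomial.C (det3 u v w) := by
      simp only [det3, hy, map_add, map_sub, map_mul]; ring
    rw [this, hd, map_one]
  have hcross : cross4 (fun l => aeval y (q l))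
      (fun l => ∑ a, aeval y (pderiv a (q l)) * Polynomial.C (v a)) r i =
      Polynomial.C c₀ * aeval y (aeval q (pderiv i F)) := by
    have hE' : ∀ c, cross4 (fun l => aeval y (q l)) (fun l => aeval y (pderiv (c + 1) (q l)))
        (fun l => aeval y (pderiv (c + 2) (q l))) i =
        y c * (Polynomial.C c₀ * aeval y (aeval q (pderiv i F))) := fun c => by
      rw [hE]; ring
    have := cross4_combination (D := fun a l => aeval y (pderiv a (q l)))
      (fun a => Polynomial.C (v a)) (fun a => Polynomial.C (w a)) (hE' 0) (hE' 1) (hE' 2)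
    rw [hdet, mul_one] at this
    exact this
  -- The derivative of `T ^ m * s` differs from `T ^ m * s'` by a multiple of `s`, which drops out
  -- of the minors.
  have hfin : cross4 s (fun l => (s l).derivative) r i = Polynomial.C c₀ * aeval s (pderiv i F) := by
    have hX : ((Polynomial.X : Polynomial K) ^ m) ^ 2 ≠ 0 := by simp
    apply mul_left_cancel₀ hX
    rw [mul_left_comm, ← hgrad, ← hcross]
    simp only [← hder, hs, Polynomial.derivative_mul]
    generalize Polynomial.derivative ((Polynomial.X : Polynomial K) ^ m) = δ
    generalize (Polynomial.X : Polynomial K) ^ m = μ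
    fin_cases i <;> simp [cross4] <;> ring
  have := congrArg (Polynomial.eval 0) hfin
  rw [Polynomial.eval_mul, Polynomial.eval_C, polynomial_eval_aeval] at this
  have h0 : (cross4 s (fun l => (s l).derivative) r i).eval 0 =
      cross4 (fun i => (s i).eval 0) (fun i => (s i).derivative.eval 0) (dirDeriv q u w) i := by
    have hr : ∀ l, (r l).eval 0 = dirDeriv q u w l := by
      intro l
      simp [r, dirDeriv, Polynomial.eval_finsetSum, polynomial_eval_aeval, hy]
    fin_cases i <;> simp [cross4, hr]
  rw [h0, hcr] at this
  exact (mul_eq_zero.1 this.symm).resolve_left hc₀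

end CubicParametrization

namespace CubicParametrization

variable {K : Type*} [Field K] {F : MvPolynomial (Fin 4) K} {q : Fin 4 → MvPolynomial (Fin 3) K}
  {M : (Fin 4 → K) → (Fin 3 → K) → Prop}

/-- Along a line through a base point the forms are divisible by the parameter, and the quotient at
`T = 0` is the derivative. A nonzero derivative is thus the limit of the points `q(u + T v)` of the
surface. -/
theorem exists_restriction_eq {u : Fin 3 → K} (hu : ∀ i, aeval u (q i) = 0) (v : Fin 3 → K) :
    ∃ s : Fin 4 → Polynomial K, (∀ i, aeval (fun a => Polynomial.C (u a) +
      Polynomial.X * Polynomial.C (v a)) (q i) = Polynomial.X ^ 1 * s i) ∧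
      ∀ i, (s i).eval 0 = dirDeriv q u v i := by
  set y : Fin 3 → Polynomial K := fun a => Polynomial.C (u a) + Polynomial.X * Polynomial.C (v a)
    with hy
  have hd : ∀ i, ∃ t, aeval y (q i) = Polynomial.X * t := fun i =>
    Polynomial.X_dvd_iff.2 (by
      rw [Polynomial.coeff_zero_eq_eval_zero, polynomial_eval_aeval]
      simpa [hy] using hu i)
  choose s hs using hd
  refine ⟨s, fun i => by rw [hs, pow_one], fun i => ?_⟩
  have hyd : ∀ a, Polynomial.derivative (y a) = Polynomial.C (v a) := fun a => by simp [hy]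
  have := derivation_aeval (Polynomial.derivative' (R := K)) y (q i)
  rw [hs i] at this
  change Polynomial.derivative _ = ∑ a, _ * Polynomial.derivative (y a) at this
  simp only [hyd] at this
  have h0 := congrArg (Polynomial.eval 0) this
  simp only [Polynomial.derivative_mul, Polynomial.derivative_X, Polynomial.eval_add,
    Polynomial.eval_mul, Polynomial.eval_X, zero_mul, add_zero, one_mul,
    Polynomial.eval_finsetSum, polynomial_eval_aeval, Polynomial.eval_C, hy] at h0
  rw [h0, dirDeriv]
  exact Finset.sum_congr rfl fun a _ => mul_comm _ _

/-- At a base point of the parametrization, the derivative has rank two. -/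
theorem exists_independent_dirDeriv [Infinite K] (h : CubicParametrization F q M) {u : Fin 3 → K}
    (hu0 : u ≠ 0) (hu : ∀ i, aeval u (q i) = 0) :
    ∃ v w, det3 u v w = 1 ∧
      ∀ α β : K, α • dirDeriv q u v + β • dirDeriv q u w = 0 → α = 0 ∧ β = 0 := by
  -- Two lines through `u` are used. On the line towards `y'` the form `q i₀` is not identically
  -- zero, and `cross4_ne_zero` makes the derivative along `w` nonzero. The line in direction `w`
  -- then has `m = 1` and `s(0)` equal to that derivative, so a second application makes it
  -- independent of the derivative along `y' - u`.
  obtain ⟨y', i₀, hi₀⟩ := h.exists_aeval_ne_zero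
  have hpar : ¬ ∀ i j, u i * (y' - u) j = u j * (y' - u) i := by
    intro hp
    obtain ⟨c, hc⟩ := Function.ne_iff.1 hu0
    apply hi₀
    have : y' = (y' c / u c) • u := by
      funext j
      have := hp c j
      simp only [Pi.sub_apply] at this
      rw [Pi.smul_apply, smul_eq_mul, div_mul_eq_mul_div, eq_div_iff hc]
      linear_combination this
    rw [this, (h.homog i₀).aeval_smul_vec, hu, mul_zero]
  obtain ⟨w, hw⟩ := exists_det3_eq_one hpar
  -- the derivative in the direction `w` does not vanish
  have hw0 : dirDeriv q u w ≠ 0 := by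
    obtain ⟨m, s, hs, hs0⟩ := exists_eq_X_pow_mul (fun i => aeval (fun a => Polynomial.C (u a) +
      Polynomial.X * Polynomial.C ((y' - u) a)) (q i)) ⟨i₀, fun h0 => hi₀ (by
        have := congrArg (Polynomial.eval 1) h0
        rw [polynomial_eval_aeval] at this
        simpa using this)⟩
    obtain ⟨i, hi⟩ := h.cross4_ne_zero hw hs hs0
    intro h0
    apply hi
    rw [h0]
    fin_cases i <;> simp [cross4]
  -- The sign keeps the determinant equal to one after the two directions are exchanged.
  refine ⟨w, -(y' - u), ?_, fun α β hαβ => ?_⟩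
  · rw [← hw]; simp [det3]; ring
  obtain ⟨s, hs, hs0⟩ := exists_restriction_eq hu w
  have hdet : det3 u w (-(y' - u)) = 1 := by rw [← hw]; simp [det3]; ring
  obtain ⟨i, hi⟩ := h.cross4_ne_zero hdet hs (by
    by_contra! hz
    exact hw0 (funext fun i => by rw [← hs0, hz, Pi.zero_apply]))
  rw [show (fun i => (s i).eval 0) = dirDeriv q u w from funext hs0] at hi
  generalize dirDeriv q u w = e at hi hαβ
  generalize dirDeriv q u (-(y' - u)) = e' at hi hαβ
  generalize (fun i => (s i).derivative.eval 0) = b at hi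
  have hc := fun i => congrFun hαβ i
  simp only [Pi.add_apply, Pi.smul_apply, smul_eq_mul, Pi.zero_apply] at hc
  have h0 := hc 0
  have h1 := hc 1
  have h2 := hc 2
  have h3 := hc 3
  have hα : α * cross4 e b e' i = 0 := by
    have : cross4 (fun i => α * e i + β * e' i) b e' i = α * cross4 e b e' i := by
      fin_cases i <;> simp [cross4] <;> ring
    rw [← this]
    simp only [hc]
    fin_cases i <;> simp [cross4]
  have hβ : β * cross4 e b e' i = 0 := by
    have : cross4 e b (fun i => α * e i + β * e' i) i = β * cross4 e b e' i := by
      fin_cases i <;> simp [cross4] <;> ring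
    rw [← this]
    simp only [hc]
    fin_cases i <;> simp [cross4]
  exact ⟨(mul_eq_zero.1 hα).resolve_right hi, (mul_eq_zero.1 hβ).resolve_right hi⟩

/-- The values of the derivative at a base point lie on the surface over the base point. -/
theorem rel_dirDeriv (h : CubicParametrization F q M) {u : Fin 3 → K} (hu0 : u ≠ 0)
    (hu : ∀ i, aeval u (q i) = 0) {v : Fin 3 → K} (hv : dirDeriv q u v ≠ 0) :
    M (dirDeriv q u v) u := by
  obtain ⟨s, hs, hs0⟩ := exists_restriction_eq hu v
  set y : Fin 3 → Polynomial K := fun a => Polynomial.C (u a) + Polynomial.X * Polynomial.C (v a)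
    with hy
  have hs' : (fun i => (s i).eval 0) = dirDeriv q u v := funext hs0
  have h2 : (fun l => aeval y (q l)) = (Polynomial.X : Polynomial K) • s := funext fun i => by
    rw [hs i, pow_one]; rfl
  have hF : aeval (dirDeriv q u v) F = 0 := by
    have h1 := congrArg (aeval y) h.relation
    rw [aeval_aeval_vec, map_zero, h2, h.cubic.aeval_smul_vec] at h1
    rw [← hs', ← polynomial_eval_aeval, (mul_eq_zero.1 h1).resolve_left (by simp),
      Polynomial.eval_zero]
  obtain ⟨e, f, hf, hfy, hR, hM⟩ := h.exists_local _ hv hF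
  refine (hM _ hv hF hfy u).2 ⟨hu0, fun i j => ?_⟩
  have h3 := congrArg (aeval y) (hR i j)
  rw [map_mul, map_mul, aeval_aeval_vec, aeval_aeval_vec, aeval_X, aeval_X, h2,
    (hf i).aeval_smul_vec, (hf j).aeval_smul_vec, mul_assoc, mul_assoc] at h3
  have h4 := congrArg (Polynomial.eval 0) (mul_left_cancel₀ (by simp) h3)
  rw [Polynomial.eval_mul, Polynomial.eval_mul, polynomial_eval_aeval, polynomial_eval_aeval,
    hs'] at h4
  simpa [hy] using h4

/-! ### Density of the image, inversion of the morphism, and its fibres over base points. -/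

theorem X_pow_mul_aeval (h : CubicParametrization F q M) {f : Fin 3 → MvPolynomial (Fin 4) K}
    (hR : ∀ i j, aeval q (f i) * X j = aeval q (f j) * X i) (l : Fin 3) (i : Fin 4) :
    X l ^ 3 * aeval (fun j => aeval q (f j)) (q i) = aeval q (f l) ^ 3 * q i := by
  have h1 : (X l : MvPolynomial (Fin 3) K) • (fun j => aeval q (f j)) =
      aeval q (f l) • (X : Fin 3 → MvPolynomial (Fin 3) K) := by
    funext j
    have := hR j l
    simp only [Pi.smul_apply, smul_eq_mul]
    linear_combination this
  have h2 := (h.homog i).aeval_smul_vec (X l) (fun j => aeval q (f j))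
  rw [h1, (h.homog i).aeval_smul_vec, aeval_X_left_apply] at h2
  exact h2.symm

/-- The image of the parametrization is Zariski dense in the surface. -/
theorem dvd_of_aeval_eq_zero [IsAlgClosed K] (h : CubicParametrization F q M)
    {G : MvPolynomial (Fin 4) K} (hG : aeval q G = 0) : F ∣ G := by
  classical
  have : Infinite K := IsAlgClosed.instInfinite
  have hirr := irreducible_of_smooth h.cubic h.smooth
  refine dvd_of_algHom_eq_zero hirr.prime (aeval q) ?_ h.relation hG
  obtain ⟨u₀, i₀, hi₀⟩ := h.exists_aeval_ne_zero
  obtain ⟨e, f, -, ⟨j₀, hj₀⟩, hR, -⟩ := h.exists_local (fun i => aeval u₀ (q i))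
    (fun h0 => hi₀ (congrFun h0 i₀)) (h.aeval_eq_zero u₀)
  let φ : Fin 3 → MvPolynomial (Fin 3) K := fun j => aeval q (f j)
  have hφ : φ j₀ ≠ 0 := by
    intro h0
    apply hj₀
    have := congrArg (aeval u₀) h0
    rwa [aeval_aeval_vec, map_zero] at this
  have hrel := h.X_pow_mul_aeval hR
  obtain ⟨i₁, hi₁⟩ := h.ne_zero
  -- By `X_pow_mul_aeval`, `X l ^ 3` times a nonzero element of the image of `aeval q` lies in that
  -- image; so each variable is algebraic over it.
  have hX : ∀ l, IsAlgebraic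
      (aeval q : MvPolynomial (Fin 4) K →ₐ[K] MvPolynomial (Fin 3) K).range (X l : MvPolynomial (Fin 3) K) := by
    intro l
    have hφl : φ l ≠ 0 := by
      intro h0
      have := hR l j₀
      change φ l * _ = φ j₀ * _ at this
      rw [h0, zero_mul] at this
      exact mul_ne_zero hφ (X_ne_zero l) this.symm
    have hne : aeval φ (q i₁) ≠ 0 := by
      intro h0
      have := hrel l i₁
      rw [h0, mul_zero] at this
      exact mul_ne_zero (pow_ne_zero 3 hφl) hi₁ this.symm
    let a : (aeval q : MvPolynomial (Fin 4) K →ₐ[K] MvPolynomial (Fin 3) K).range :=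
      ⟨aeval φ (q i₁), aeval f (q i₁), by
        exact aeval_aeval_vec q f (q i₁)⟩
    let b : (aeval q : MvPolynomial (Fin 4) K →ₐ[K] MvPolynomial (Fin 3) K).range :=
      ⟨φ l ^ 3 * q i₁, f l ^ 3 * X i₁, by simp [φ]⟩
    refine ⟨Polynomial.C a * Polynomial.X ^ 3 - Polynomial.C b, fun h0 => ?_, ?_⟩
    · have := congrArg (fun p => p.coeff 3) h0
      simp only [Polynomial.coeff_sub, Polynomial.coeff_C_mul, Polynomial.coeff_X_pow,
        Polynomial.coeff_C, Polynomial.coeff_zero] at this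
      rw [if_pos trivial, mul_one, if_neg (by decide), sub_zero] at this
      exact hne (congrArg Subtype.val this)
    · simp only [map_sub, map_mul, map_pow, Polynomial.aeval_C, Polynomial.aeval_X]
      change aeval φ (q i₁) * X l ^ 3 - φ l ^ 3 * q i₁ = 0
      rw [← hrel l i₁]; ring
  refine ⟨fun G => ?_⟩
  induction G using MvPolynomial.induction_on with
  | C a => exact isAlgebraic_algebraMap (⟨C a, C a, by simp [algHom_C]⟩ :
      (aeval q : MvPolynomial (Fin 4) K →ₐ[K] MvPolynomial (Fin 3) K).range)
  | add p q hp hq => exact hp.add hq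
  | mul_X p l hp => exact hp.mul (hX l)

end CubicParametrization

theorem mk_eq_mk_iff_mul {K : Type*} [Field K] {n : ℕ} {a b : Fin n → K} (ha : a ≠ 0)
    (hb : b ≠ 0) : Projectivization.mk K a ha = Projectivization.mk K b hb ↔
      ∀ i j, a i * b j = a j * b i := by
  rw [Projectivization.mk_eq_mk_iff']
  constructor
  · rintro ⟨c, rfl⟩ i j
    simp only [Pi.smul_apply, smul_eq_mul]; ring
  · intro h
    obtain ⟨c, hc⟩ := Function.ne_iff.1 hb
    refine ⟨a c / b c, funext fun j => ?_⟩
    rw [Pi.smul_apply, smul_eq_mul, div_mul_eq_mul_div, div_eq_iff hc, h]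

theorem exists_eq_smul_of_mul_comm {K : Type*} [Field K] {n : ℕ} {a b : Fin n → K} (ha : a ≠ 0)
    (hb : b ≠ 0) (h : ∀ i j, a i * b j = a j * b i) : ∃ c : K, c ≠ 0 ∧ a = c • b := by
  obtain ⟨c, hc⟩ := (Projectivization.mk_eq_mk_iff' K a b ha hb).1 ((mk_eq_mk_iff_mul ha hb).2 h)
  exact ⟨c, fun h0 => ha (by rw [← hc, h0, zero_smul]), hc.symm⟩

/-- Linearly independent vectors have dual functionals. -/
theorem exists_dual {K : Type*} [Field K] {n m : ℕ} {v : Fin n → Fin m → K}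
    (hv : LinearIndependent K v) :
    ∃ ε : Fin n → Fin m → K, ∀ i j, ∑ l, ε i l * v j l = if i = j then 1 else 0 := by
  classical
  have hinj : LinearMap.ker (Fintype.linearCombination K v) = ⊥ :=
    LinearMap.ker_eq_bot'.2 fun g hg => funext (Fintype.linearIndependent_iff.1 hv g
      (by rwa [Fintype.linearCombination_apply] at hg))
  obtain ⟨g, hg⟩ := LinearMap.exists_leftInverse_of_injective _ hinj
  refine ⟨fun i l => g (Pi.single l 1) i, fun i j => ?_⟩
  have h1 : g (v j) = Pi.single j 1 := by
    have := LinearMap.congr_fun hg (Pi.single j 1)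
    simpa [Fintype.linearCombination_apply_single] using this
  have h2 : v j = ∑ l, v j l • (Pi.single l 1 : Fin m → K) := by
    funext a
    simp [Finset.sum_apply, Pi.single_apply]
  have h3 := congrFun h1 i
  rw [h2, map_sum] at h3
  simp only [map_smul, Finset.sum_apply, Pi.smul_apply, smul_eq_mul] at h3
  rw [Pi.single_apply] at h3
  rw [← h3]
  exact Finset.sum_congr rfl fun l _ => mul_comm _ _

/-- An algebraic inverse function argument. The two expressions are linear in `z₁`, `z₂` with a
coefficient matrix whose determinant maps to `χ L ^ 2 ≠ 0` and hence lies outside `Q`; Cramer's rule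
and primality finish. -/
theorem mem_prime_of_linear_system {R S : Type*} [CommRing R] [CommRing S] [IsDomain S]
    {Q : Ideal R} (hQ : Q.IsPrime) {χ : R →+* S} (hχ : ∀ x ∈ Q, χ x = 0)
    {L z₁ z₂ a₁ b₁ c₁ a₂ b₂ c₂ : R} (hL : χ L ≠ 0) (h₁ : χ z₁ = 0) (h₂ : χ z₂ = 0)
    (e₁ : L * z₁ + (z₁ ^ 2 * a₁ + z₁ * z₂ * b₁ + z₂ ^ 2 * c₁) ∈ Q)
    (e₂ : L * z₂ + (z₁ ^ 2 * a₂ + z₁ * z₂ * b₂ + z₂ ^ 2 * c₂) ∈ Q) : z₁ ∈ Q ∧ z₂ ∈ Q := by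
  have hΔ : (L + z₁ * a₁ + z₂ * b₁) * (L + z₁ * b₂ + z₂ * c₂) - (z₂ * c₁) * (z₁ * a₂) ∉ Q := by
    intro hmem
    have := hχ _ hmem
    simp only [map_sub, map_mul, map_add, h₁, h₂, zero_mul, add_zero, sub_zero] at this
    exact mul_ne_zero hL hL this
  constructor
  · refine (hQ.mem_or_mem (x := z₁) (y := (L + z₁ * a₁ + z₂ * b₁) * (L + z₁ * b₂ + z₂ * c₂) -
      (z₂ * c₁) * (z₁ * a₂)) ?_).resolve_right hΔ
    have := Q.sub_mem (Q.mul_mem_left (L + z₁ * b₂ + z₂ * c₂) e₁) (Q.mul_mem_left (z₂ * c₁) e₂)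
    convert this using 1
    ring
  · refine (hQ.mem_or_mem (x := z₂) (y := (L + z₁ * a₁ + z₂ * b₁) * (L + z₁ * b₂ + z₂ * c₂) -
      (z₂ * c₁) * (z₁ * a₂)) ?_).resolve_right hΔ
    have := Q.sub_mem (Q.mul_mem_left (L + z₁ * a₁ + z₂ * b₁) e₂) (Q.mul_mem_left (z₁ * a₂) e₁)
    convert this using 1
    ring

namespace CubicParametrization

variable {K : Type*} [Field K] {F : MvPolynomial (Fin 4) K} {q : Fin 4 → MvPolynomial (Fin 3) K}
  {M : (Fin 4 → K) → (Fin 3 → K) → Prop}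

/-- Expansion of the parametrization at a base point. -/
theorem exists_expansion (h : CubicParametrization F q M) {u : Fin 3 → K}
    (hu : ∀ i, aeval u (q i) = 0) (v w : Fin 3 → K) {R : Type*} [CommRing R] [Algebra K R]
    (z₀ z₁ z₂ : R) (ε : Fin 4 → K) :
    ∃ a b c : R, ∑ i, algebraMap K R (ε i) * aeval (fun j => z₀ * algebraMap K R (u j) +
      z₁ * algebraMap K R (v j) + z₂ * algebraMap K R (w j)) (q i) =
      z₀ ^ 2 * (z₁ * algebraMap K R (∑ i, ε i * dirDeriv q u v i) +
        z₂ * algebraMap K R (∑ i, ε i * dirDeriv q u w i)) +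
      (z₁ ^ 2 * a + z₁ * z₂ * b + z₂ ^ 2 * c) := by
  have key : ∀ i, ∃ a b c : R, aeval (fun j => z₀ * algebraMap K R (u j) +
      z₁ * algebraMap K R (v j) + z₂ * algebraMap K R (w j)) (q i) =
      z₀ ^ 2 * (z₁ * algebraMap K R (dirDeriv q u v i) +
        z₂ * algebraMap K R (dirDeriv q u w i)) +
      (z₁ ^ 2 * a + z₁ * z₂ * b + z₂ ^ 2 * c) := by
    intro i
    obtain ⟨r, hr⟩ := exists_aeval_add (z₀ • fun j => algebraMap K R (u j))
      (fun j => z₁ * algebraMap K R (v j) + z₂ * algebraMap K R (w j)) (q i)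
    have hmap : ∀ G : MvPolynomial (Fin 3) K,
        aeval (fun j => algebraMap K R (u j)) G = algebraMap K R (aeval u G) := fun G =>
      aeval_algebraMap_apply R u G
    have h1 : (z₀ • fun j => algebraMap K R (u j)) +
        (fun j => z₁ * algebraMap K R (v j) + z₂ * algebraMap K R (w j)) =
        fun j => z₀ * algebraMap K R (u j) + z₁ * algebraMap K R (v j) +
          z₂ * algebraMap K R (w j) := by
      funext j
      simp only [Pi.add_apply, Pi.smul_apply, smul_eq_mul]; ring
    rw [h1, (h.homog i).aeval_smul_vec, hmap, hu, map_zero, mul_zero, zero_add] at hr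
    simp only [((h.homog i).pderiv).aeval_smul_vec, hmap] at hr
    refine ⟨∑ a, ∑ b, algebraMap K R (v a) * algebraMap K R (v b) * r a b,
      ∑ a, ∑ b, (algebraMap K R (v a) * algebraMap K R (w b) +
        algebraMap K R (w a) * algebraMap K R (v b)) * r a b,
      ∑ a, ∑ b, algebraMap K R (w a) * algebraMap K R (w b) * r a b, ?_⟩
    rw [hr]
    simp only [dirDeriv, map_mul, map_add, Fin.sum_univ_three]
    ring
  choose a b c habc using key
  refine ⟨∑ i, algebraMap K R (ε i) * a i, ∑ i, algebraMap K R (ε i) * b i,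
    ∑ i, algebraMap K R (ε i) * c i, ?_⟩
  simp only [habc, map_mul, map_add, Fin.sum_univ_four]
  ring

/-- Coordinates in a constant basis of determinant one. They serve both for the forms `f` of the
morphism and for the variables themselves. -/
theorem coord_eq {R : Type*} [CommRing R] [Algebra K R] {u v w : Fin 3 → K}
    (hd : det3 u v w = 1) (x : Fin 3 → R) :
    (fun j => det3 x (fun a => algebraMap K R (v a)) (fun a => algebraMap K R (w a)) *
        algebraMap K R (u j) +
      det3 (fun a => algebraMap K R (u a)) x (fun a => algebraMap K R (w a)) *
        algebraMap K R (v j) +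
      det3 (fun a => algebraMap K R (u a)) (fun a => algebraMap K R (v a)) x *
        algebraMap K R (w j)) = x := by
  funext j
  have e := det3_smul_eq (fun a => algebraMap K R (u a)) (fun a => algebraMap K R (v a))
    (fun a => algebraMap K R (w a)) x j
  have : det3 (fun a => algebraMap K R (u a)) (fun a => algebraMap K R (v a))
      (fun a => algebraMap K R (w a)) = algebraMap K R (det3 u v w) := by
    simp only [det3, map_add, map_sub, map_mul]
  rw [this, hd, map_one, one_mul] at e
  exact e.symm

/-- This says that `q ∘ f` is the identity of the surface up to a factor. By density it can be
tested after substituting `q`, where it follows from `X_pow_mul_aeval`. -/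
theorem dvd_of_local [IsAlgClosed K] (h : CubicParametrization F q M)
    {f : Fin 3 → MvPolynomial (Fin 4) K}
    (hR : ∀ i j, aeval q (f i) * X j = aeval q (f j) * X i) (i j : Fin 4) :
    F ∣ aeval f (q i) * X j - aeval f (q j) * X i := by
  apply h.dvd_of_aeval_eq_zero
  simp only [map_sub, map_mul, aeval_X, aeval_aeval_vec]
  have h1 := h.X_pow_mul_aeval hR 0 i
  have h2 := h.X_pow_mul_aeval hR 0 j
  have h3 : (X 0 : MvPolynomial (Fin 3) K) ^ 3 ≠ 0 := pow_ne_zero 3 (X_ne_zero 0)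
  apply mul_left_cancel₀ h3
  linear_combination q j * h1 - q i * h2

/-- The parametrization inverts the morphism. -/
theorem aeval_mul_comm_of_rel [IsAlgClosed K] (h : CubicParametrization F q M) {y : Fin 4 → K}
    {u : Fin 3 → K} (hM : M y u) (i j : Fin 4) :
    aeval u (q i) * y j = aeval u (q j) * y i := by
  obtain ⟨hy, hF, hu0⟩ := h.mem y u hM
  obtain ⟨e, f, hf, hfy, hR, hloc⟩ := h.exists_local y hy hF
  obtain ⟨j₀, hj₀⟩ := hfy
  obtain ⟨l, hl, hfl⟩ := exists_eq_smul_of_mul_comm (a := fun j => aeval y (f j))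
    (fun h0 => hj₀ (congrFun h0 j₀)) hu0 ((hloc y hy hF ⟨j₀, hj₀⟩ u).1 hM).2
  obtain ⟨t, ht⟩ := h.dvd_of_local hR i j
  have := congrArg (aeval y) ht
  simp only [map_sub, map_mul, aeval_X, aeval_aeval_vec, hF, zero_mul, hfl,
    (h.homog _).aeval_smul_vec] at this
  apply mul_left_cancel₀ (pow_ne_zero 3 hl)
  linear_combination this

/-- The points of the surface over a base point form a line. -/
theorem exists_eq_of_rel [IsAlgClosed K] (h : CubicParametrization F q M) {y : Fin 4 → K}
    {u v w : Fin 3 → K} (hM : M y u) (hu : ∀ i, aeval u (q i) = 0) (hd : det3 u v w = 1)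
    (hind : ∀ α β : K, α • dirDeriv q u v + β • dirDeriv q u w = 0 → α = 0 ∧ β = 0) :
    ∃ α β : K, y = α • dirDeriv q u v + β • dirDeriv q u w := by
  -- Suppose `y` lies off the line spanned by the two derivatives. Write the local forms `f` of the
  -- morphism at `y` in the basis `u, v, w`, with coordinates `z₀, z₁, z₂`; at `y` the last two
  -- vanish. Modulo `F`, `q(f)` is proportional to the variables. Expanding it at `u` and pairing
  -- with functionals dual to the two derivatives and `y` gives equations for `z₁`, `z₂` with linear
  -- coefficient `z₀ ^ 2 * ℓ`, nonzero at `y`, and remaining terms quadratic in `z₁`, `z₂`. Hence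
  -- `z₁` and `z₂` vanish on the whole surface.
  by_contra! hcon
  obtain ⟨hy, hF, hu0⟩ := h.mem y u hM
  have hli : LinearIndependent K ![dirDeriv q u v, dirDeriv q u w, y] := by
    rw [Fintype.linearIndependent_iff]
    intro g hg
    simp only [Fin.sum_univ_three, Matrix.cons_val] at hg
    have h2 : g 2 = 0 := by
      by_contra h2
      apply hcon (-(g 0 / g 2)) (-(g 1 / g 2))
      have := congrArg (fun x => (g 2)⁻¹ • x) hg
      simp only [smul_add, smul_smul, smul_zero, inv_mul_cancel₀ h2, one_smul] at this
      rw [eq_comm, ← sub_eq_zero, ← neg_eq_zero, ← this]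
      simp only [div_eq_inv_mul]
      module
    rw [h2, zero_smul, add_zero] at hg
    obtain ⟨h0, h1⟩ := hind _ _ hg
    intro i
    fin_cases i
    · exact h0
    · exact h1
    · exact h2
  obtain ⟨ε, hε⟩ := exists_dual hli
  obtain ⟨e, f, hf, hfy, hR, hloc⟩ := h.exists_local y hy hF
  obtain ⟨j₀, hj₀⟩ := hfy
  obtain ⟨l, hl, hfl⟩ := exists_eq_smul_of_mul_comm (a := fun j => aeval y (f j))
    (fun h0 => hj₀ (congrFun h0 j₀)) hu0 ((hloc y hy hF ⟨j₀, hj₀⟩ u).1 hM).2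
  have hrel := h.dvd_of_local hR
  have hirr := irreducible_of_smooth h.cubic h.smooth
  have hQ : (Ideal.span {F}).IsPrime := (Ideal.span_singleton_prime hirr.ne_zero).2 hirr.prime
  set z₀ := det3 f (fun a => algebraMap K (MvPolynomial (Fin 4) K) (v a))
    (fun a => algebraMap K (MvPolynomial (Fin 4) K) (w a)) with hz₀
  set z₁ := det3 (fun a => algebraMap K (MvPolynomial (Fin 4) K) (u a)) f
    (fun a => algebraMap K (MvPolynomial (Fin 4) K) (w a)) with hz₁
  set z₂ := det3 (fun a => algebraMap K (MvPolynomial (Fin 4) K) (u a))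
    (fun a => algebraMap K (MvPolynomial (Fin 4) K) (v a)) f with hz₂
  have hcoord := coord_eq (R := MvPolynomial (Fin 4) K) hd f
  rw [← hz₀, ← hz₁, ← hz₂] at hcoord
  have hexp := h.exists_expansion hu v w z₀ z₁ z₂
  rw [hcoord] at hexp
  obtain ⟨a₁, b₁, c₁, h₁⟩ := hexp (ε 0)
  obtain ⟨a₂, b₂, c₂, h₂⟩ := hexp (ε 1)
  obtain ⟨a₃, b₃, c₃, h₃⟩ := hexp (ε 2)
  have d00 := hε 0 0
  have d01 := hε 0 1
  have d10 := hε 1 0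
  have d11 := hε 1 1
  have d20 := hε 2 0
  have d21 := hε 2 1
  have d22 := hε 2 2
  simp only [Matrix.cons_val, if_true] at d00 d01 d10 d11 d20 d21 d22
  simp at d01 d10 d20 d21
  rw [d00, d01, map_one, map_zero] at h₁
  rw [d10, d11, map_one, map_zero] at h₂
  rw [d20, d21, map_zero] at h₃
  have hFQ : ∀ ε' : Fin 4 → K, (∑ i, algebraMap K (MvPolynomial (Fin 4) K) (ε' i) * aeval f (q i)) *
      (∑ j, algebraMap K (MvPolynomial (Fin 4) K) (ε 2 j) * X j) -
      (∑ j, algebraMap K (MvPolynomial (Fin 4) K) (ε 2 j) * aeval f (q j)) *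
      (∑ i, algebraMap K (MvPolynomial (Fin 4) K) (ε' i) * X i) ∈ Ideal.span {F} := by
    intro ε'
    have : (∑ i, algebraMap K (MvPolynomial (Fin 4) K) (ε' i) * aeval f (q i)) *
      (∑ j, algebraMap K (MvPolynomial (Fin 4) K) (ε 2 j) * X j) -
      (∑ j, algebraMap K (MvPolynomial (Fin 4) K) (ε 2 j) * aeval f (q j)) *
      (∑ i, algebraMap K (MvPolynomial (Fin 4) K) (ε' i) * X i) = ∑ i, ∑ j, algebraMap K (MvPolynomial (Fin 4) K) (ε' i) *
        algebraMap K (MvPolynomial (Fin 4) K) (ε 2 j) * (aeval f (q i) * X j - aeval f (q j) * X i) := by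
      simp only [Fin.sum_univ_four]; ring
    rw [this]
    exact Ideal.sum_mem _ fun i _ => Ideal.sum_mem _ fun j _ => Ideal.mul_mem_left _ _
      (Ideal.mem_span_singleton.2 (hrel i j))
  set ℓ : MvPolynomial (Fin 4) K := ∑ j, algebraMap K (MvPolynomial (Fin 4) K) (ε 2 j) * X j with hℓ
  have hev : ∀ G : MvPolynomial (Fin 4) K, G ∈ Ideal.span {F} →
      (aeval y : MvPolynomial (Fin 4) K →ₐ[K] K).toRingHom G = 0 := by
    intro G hG
    obtain ⟨t, rfl⟩ := Ideal.mem_span_singleton.1 hG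
    change aeval y (F * t) = 0
    rw [map_mul, hF, zero_mul]
  have hfa : ∀ a, aeval y (f a) = l * u a := fun a => congrFun hfl a
  have hz : ∀ r, aeval y (algebraMap K (MvPolynomial (Fin 4) K) r) = r := fun r => by simp
  have hz₀y : aeval y z₀ = l := by
    rw [← mul_one l, ← hd]
    simp only [hz₀, det3, map_add, map_mul, map_sub, hz, hfa]; ring
  have hz₁y : aeval y z₁ = 0 := by
    simp only [hz₁, det3, map_add, map_mul, map_sub, hz, hfa]; ring
  have hz₂y : aeval y z₂ = 0 := by
    simp only [hz₂, det3, map_add, map_mul, map_sub, hz, hfa]; ring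
  have hℓy : aeval y ℓ = 1 := by
    rw [← d22]
    simp only [hℓ, map_sum, map_mul, hz, aeval_X]
  obtain ⟨hm₁, hm₂⟩ := mem_prime_of_linear_system (L := z₀ ^ 2 * ℓ) (z₁ := z₁) (z₂ := z₂)
    (χ := (aeval y : MvPolynomial (Fin 4) K →ₐ[K] K).toRingHom) hQ hev
    (by
      change aeval y (z₀ ^ 2 * ℓ) ≠ 0
      rw [map_mul, map_pow, hz₀y, hℓy, mul_one]
      exact pow_ne_zero 2 hl) hz₁y hz₂y
    (a₁ := a₁ * ℓ - a₃ * ∑ i, algebraMap K (MvPolynomial (Fin 4) K) (ε 0 i) * X i)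
    (b₁ := b₁ * ℓ - b₃ * ∑ i, algebraMap K (MvPolynomial (Fin 4) K) (ε 0 i) * X i)
    (c₁ := c₁ * ℓ - c₃ * ∑ i, algebraMap K (MvPolynomial (Fin 4) K) (ε 0 i) * X i)
    (a₂ := a₂ * ℓ - a₃ * ∑ i, algebraMap K (MvPolynomial (Fin 4) K) (ε 1 i) * X i)
    (b₂ := b₂ * ℓ - b₃ * ∑ i, algebraMap K (MvPolynomial (Fin 4) K) (ε 1 i) * X i)
    (c₂ := c₂ * ℓ - c₃ * ∑ i, algebraMap K (MvPolynomial (Fin 4) K) (ε 1 i) * X i)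
    (by
      have := hFQ (ε 0)
      rw [h₁, h₃] at this
      convert this using 1
      ring)
    (by
      have := hFQ (ε 1)
      rw [h₂, h₃] at this
      convert this using 1
      ring)
  have hq0 : ∀ G, G ∈ Ideal.span {F} → aeval q G = 0 := by
    intro G hG
    obtain ⟨t, rfl⟩ := Ideal.mem_span_singleton.1 hG
    rw [map_mul, h.relation, zero_mul]
  -- Now `f(q)` is a multiple of the constant vector `u`, yet proportional to the variables. This
  -- forces `z₀(q) = 0`, so `z₀` vanishes on the surface, against its value `l ≠ 0` at `y`.
  have hφ : ∀ i, aeval q (f i) = aeval q z₀ * C (u i) := by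
    intro i
    have := congrArg (aeval q) (congrFun hcoord i)
    rw [← this]
    simp only [map_add, map_mul, hq0 _ hm₁, hq0 _ hm₂, zero_mul, add_zero]
    congr 1
    exact (aeval q).commutes (u i)
  obtain ⟨i, hi⟩ := Function.ne_iff.1 hu0
  have h4 := hR i (i + 1)
  rw [hφ, hφ, mul_assoc, mul_assoc, ← sub_eq_zero, ← mul_sub] at h4
  have h5 : aeval q z₀ = 0 := by
    refine (mul_eq_zero.1 h4).resolve_right fun h0 => hi ?_
    have := congrArg (aeval (Pi.single (i + 1) 1 : Fin 3 → K)) h0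
    have hne : i ≠ i + 1 := by fin_cases i <;> decide
    simp only [map_sub, map_mul, aeval_X, Pi.single_eq_same, Pi.single_eq_of_ne hne, mul_zero,
      sub_zero, mul_one, map_zero] at this
    simpa using this
  obtain ⟨t, ht⟩ := h.dvd_of_aeval_eq_zero h5
  apply hl
  rw [← hz₀y, ht, map_mul, hF, zero_mul]

end CubicParametrization

namespace Parametrization

variable {K : Type*} [Field K] {F : MvPolynomial (Fin 4) K} {q : Fin 4 → MvPolynomial (Fin 3) K}
  {M : (Fin 4 → K) → (Fin 3 → K) → Prop}

theorem rel_eval (h : Parametrization F q M) {u : Fin 3 → K} (hu0 : u ≠ 0)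
    (hu : ∃ i, aeval u (q i) ≠ 0) : M (fun i => aeval u (q i)) u := by
  have hy : (fun i => aeval u (q i)) ≠ 0 := fun h0 => by
    obtain ⟨i, hi⟩ := hu
    exact hi (congrFun h0 i)
  obtain ⟨e, f, -, hfy, hR, hM⟩ := h.exists_local _ hy (h.aeval_eq_zero u)
  refine (hM _ hy (h.aeval_eq_zero u) hfy u).2 ⟨hu0, fun i j => ?_⟩
  have := congrArg (aeval u) (hR i j)
  simpa only [map_mul, aeval_X, aeval_aeval_vec] using this

theorem rel_unique (h : Parametrization F q M) {y : Fin 4 → K} {u u' : Fin 3 → K} (hu : M y u)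
    (hu' : M y u') : ∀ i j, u i * u' j = u j * u' i := by
  obtain ⟨hy, hF, hu0⟩ := h.mem y u hu
  obtain ⟨e, f, -, ⟨l, hl⟩, -, hM⟩ := h.exists_local y hy hF
  have h1 := ((hM y hy hF ⟨l, hl⟩ _).1 hu).2
  have h2 := ((hM y hy hF ⟨l, hl⟩ _).1 hu').2
  intro i j
  apply mul_left_cancel₀ (mul_ne_zero hl hl)
  linear_combination aeval y (f l) * u' j * h1 l i - aeval y (f l) * u' i * h1 l j +
    aeval y (f i) * u l * h2 l j - aeval y (f j) * u l * h2 l i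

end Parametrization

/-! ### Finiteness of the base locus, and separated pairs of points. -/

namespace CubicParametrization

variable {K : Type*} [Field K] {F : MvPolynomial (Fin 4) K} {q : Fin 4 → MvPolynomial (Fin 3) K}
  {M : (Fin 4 → K) → (Fin 3 → K) → Prop}

/-- The restriction of polynomials to the line through the origin spanned by `u`. -/
noncomputable def _root_.restrictLine (u : Fin 3 → K) :
    MvPolynomial (Fin 3) K →ₐ[K] Polynomial K :=
  aeval fun a => Polynomial.X * Polynomial.C (u a)

/-- The ideal of a base point is minimal over the base ideal. -/
theorem mem_of_restrictLine_eq_zero [Infinite K] (h : CubicParametrization F q M)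
    {u : Fin 3 → K} (hu0 : u ≠ 0) (hu : ∀ i, aeval u (q i) = 0)
    {Q : Ideal (MvPolynomial (Fin 3) K)} (hQ : Q.IsPrime) (hJ : ∀ i, q i ∈ Q)
    (hle : ∀ G ∈ Q, restrictLine u G = 0) {G : MvPolynomial (Fin 3) K}
    (hG : restrictLine u G = 0) : G ∈ Q := by
  obtain ⟨v, w, hd, hind⟩ := h.exists_independent_dirDeriv hu0 hu
  have hli : LinearIndependent K ![dirDeriv q u v, dirDeriv q u w] :=
    LinearIndependent.pair_iff.2 hind
  obtain ⟨ε, hε⟩ := exists_dual hli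
  set z₀ := det3 (X : Fin 3 → MvPolynomial (Fin 3) K) (fun a => algebraMap K _ (v a))
    (fun a => algebraMap K _ (w a)) with hz₀
  set z₁ := det3 (fun a => algebraMap K _ (u a)) (X : Fin 3 → MvPolynomial (Fin 3) K)
    (fun a => algebraMap K _ (w a)) with hz₁
  set z₂ := det3 (fun a => algebraMap K _ (u a)) (fun a => algebraMap K _ (v a))
    (X : Fin 3 → MvPolynomial (Fin 3) K) with hz₂
  have hcoord := coord_eq hd (X : Fin 3 → MvPolynomial (Fin 3) K)
  rw [← hz₀, ← hz₁, ← hz₂] at hcoord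
  have hexp := h.exists_expansion hu v w z₀ z₁ z₂
  rw [hcoord] at hexp
  obtain ⟨a₁, b₁, c₁, h₁⟩ := hexp (ε 0)
  obtain ⟨a₂, b₂, c₂, h₂⟩ := hexp (ε 1)
  have d00 := hε 0 0
  have d01 := hε 0 1
  have d10 := hε 1 0
  have d11 := hε 1 1
  simp only [Matrix.cons_val, if_true] at d00 d01 d10 d11
  simp at d01 d10
  rw [d00, d01, map_one, map_zero] at h₁
  rw [d10, d11, map_one, map_zero] at h₂
  have hmem : ∀ ε' : Fin 4 → K, ∑ i, algebraMap K (MvPolynomial (Fin 3) K) (ε' i) *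
      aeval X (q i) ∈ Q := fun ε' => Ideal.sum_mem _ fun i _ => Ideal.mul_mem_left _ _ (by
    rw [aeval_X_left_apply]
    exact hJ i)
  have hm₁ := hmem (ε 0)
  have hm₂ := hmem (ε 1)
  rw [h₁] at hm₁
  rw [h₂] at hm₂
  have hz : ∀ r, aeval u (algebraMap K (MvPolynomial (Fin 3) K) r) = r := fun r => by simp
  have hχ : ∀ G ∈ Q, (aeval u : MvPolynomial (Fin 3) K →ₐ[K] K).toRingHom G = 0 := by
    intro G hG
    have h0 : restrictLine u G = 0 := hle G hG
    have := congrArg (Polynomial.eval 1) h0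
    rw [restrictLine, polynomial_eval_aeval] at this
    simpa using this
  -- Since the derivative has rank two at `u`, the transverse coordinates `z₁`, `z₂` lie in `Q`.
  -- Modulo `Q` the variables then equal `z₀ * u`, and `G` becomes its restriction to the line,
  -- evaluated at `z₀`.
  obtain ⟨hq₁, hq₂⟩ := mem_prime_of_linear_system (L := z₀ ^ 2) (z₁ := z₁) (z₂ := z₂) hQ hχ
    (by
      change aeval u (z₀ ^ 2) ≠ 0
      have : aeval u z₀ = 1 := by
        rw [← hd]
        simp only [hz₀, det3, map_add, map_mul, map_sub, hz, aeval_X]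
      rw [map_pow, this]; simp)
    (by
      change aeval u z₁ = 0
      simp only [hz₁, det3, map_add, map_mul, map_sub, hz, aeval_X]; ring)
    (by
      change aeval u z₂ = 0
      simp only [hz₂, det3, map_add, map_mul, map_sub, hz, aeval_X]; ring)
    (a₁ := a₁) (b₁ := b₁) (c₁ := c₁) (a₂ := a₂) (b₂ := b₂) (c₂ := c₂)
    (by simpa using hm₁) (by simpa using hm₂)
  rw [← Ideal.Quotient.eq_zero_iff_mem]
  have h3 := congrArg (Polynomial.aeval (Ideal.Quotient.mkₐ K Q z₀)) hG
  rw [restrictLine, map_zero, ← AlgHom.comp_apply, MvPolynomial.comp_aeval] at h3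
  have h4 : (fun a => Polynomial.aeval (Ideal.Quotient.mkₐ K Q z₀)
      (Polynomial.X * Polynomial.C (u a))) = fun a => Ideal.Quotient.mkₐ K Q (X a) := by
    funext a
    have h5 := congrArg (Ideal.Quotient.mkₐ K Q) (congrFun hcoord a)
    have h6 : Ideal.Quotient.mkₐ K Q z₁ = 0 := Ideal.Quotient.eq_zero_iff_mem.2 hq₁
    have h7 : Ideal.Quotient.mkₐ K Q z₂ = 0 := Ideal.Quotient.eq_zero_iff_mem.2 hq₂
    rw [map_add, map_add, map_mul, map_mul, map_mul, h6, h7, zero_mul, zero_mul, add_zero,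
      add_zero, AlgHom.commutes] at h5
    rw [map_mul, Polynomial.aeval_X, Polynomial.aeval_C]
    exact h5
  rw [h4] at h3
  rw [← h3]
  change Ideal.Quotient.mkₐ K Q G = _
  exact congrArg (fun φ : MvPolynomial (Fin 3) K →ₐ[K] _ => φ G)
    (MvPolynomial.aeval_unique (Ideal.Quotient.mkₐ K Q))

/-- The parametrization has finitely many base points. -/
theorem finite_base [Infinite K] (h : CubicParametrization F q M) :
    {x : Projectivization K (Fin 3 → K) | ∀ i, aeval x.rep (q i) = 0}.Finite := by
  -- The ideals of the base points are distinct minimal primes over the ideal of the `q i`, and a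
  -- Noetherian ring has finitely many of these.
  refine Set.Finite.of_injOn (f := fun x => RingHom.ker (restrictLine x.rep))
    (t := (Ideal.span (Set.range q)).minimalPrimes) ?_ ?_
    (Ideal.finite_minimalPrimes_of_isNoetherianRing _ _)
  · intro x hx
    have hx : ∀ i, aeval x.rep (q i) = 0 := hx
    refine ⟨⟨RingHom.ker_isPrime _, Ideal.span_le.2 ?_⟩, fun Q hQ hle G hG => ?_⟩
    · rintro _ ⟨i, rfl⟩
      have h1 := (h.homog i).aeval_smul_vec (Polynomial.X : Polynomial K)
        (algebraMap K (Polynomial K) ∘ x.rep)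
      rw [aeval_algebraMap_apply, hx, map_zero, mul_zero] at h1
      exact h1
    · exact h.mem_of_restrictLine_eq_zero x.rep_nonzero hx hQ.1
        (fun i => hQ.2 (Ideal.subset_span ⟨i, rfl⟩)) (fun G hG => hle hG) hG
  · intro x _ y _ hxy
    have hxy : RingHom.ker (restrictLine x.rep) = RingHom.ker (restrictLine y.rep) := hxy
    rw [← x.mk_rep, ← y.mk_rep, mk_eq_mk_iff_mul]
    intro i j
    have h1 : C (x.rep i) * X j - C (x.rep j) * X i ∈ RingHom.ker (restrictLine x.rep) := by
      rw [RingHom.mem_ker]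
      simp [restrictLine, algHom_C]
      ring
    rw [hxy, RingHom.mem_ker] at h1
    have h2 := congrArg (Polynomial.eval 1) h1
    simp [restrictLine, algHom_C] at h2
    linear_combination h2

/-- By density the corresponding linear form would be divisible by the cubic `F`. -/
theorem eq_zero_of_sum_eq_zero [IsAlgClosed K] (h : CubicParametrization F q M) {l : Fin 4 → K}
    (hl : ∑ i, C (l i) * q i = 0) : l = 0 := by
  by_contra hne
  have hL : ∑ i, C (l i) * X i ≠ (0 : MvPolynomial (Fin 4) K) := by
    intro h0
    apply hne
    funext i
    have := congrArg (aeval (Pi.single i 1 : Fin 4 → K)) h0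
    simpa [Pi.single_apply] using this
  obtain ⟨t, ht⟩ := h.dvd_of_aeval_eq_zero (G := ∑ i, C (l i) * X i) (by simpa [algHom_C] using hl)
  have hhom : (∑ i, C (l i) * X i : MvPolynomial (Fin 4) K).IsHomogeneous 1 :=
    IsHomogeneous.sum _ _ _ fun i _ => isHomogeneous_C_mul_X _ i
  obtain ⟨a, b, hab, ha, -⟩ := MvPolynomial.IsHomogeneous.exists_of_mul (ht ▸ hhom) (ht ▸ hL)
  have := ha.inj_right h.cubic (left_ne_zero_of_mul (ht ▸ hL))
  omega

theorem dirDeriv_smul (h : CubicParametrization F q M) (c : K) (u v : Fin 3 → K) :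
    dirDeriv q (c • u) v = c ^ 2 • dirDeriv q u v := by
  funext i
  simp only [dirDeriv, ((h.homog i).pderiv).aeval_smul_vec, Pi.smul_apply, smul_eq_mul,
    Finset.mul_sum]
  exact Finset.sum_congr rfl fun a _ => by ring

/-- No plane through the points parametrized by `a` and `b` contains the line over a base
point. -/
def _root_.Separated (q : Fin 4 → MvPolynomial (Fin 3) K) (a b : Fin 3 → K) : Prop :=
  ∀ u : Fin 3 → K, u ≠ 0 → (∀ i, aeval u (q i) = 0) → ∀ l : Fin 4 → K, l ≠ 0 →
    ∑ i, l i * aeval a (q i) = 0 → ∑ i, l i * aeval b (q i) = 0 →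
      ∃ v, ∑ i, l i * dirDeriv q u v i ≠ 0

theorem _root_.Separated.symm {a b : Fin 3 → K} (h : Separated q a b) : Separated q b a :=
  fun u hu hqu l hl ha hb => h u hu hqu l hl hb ha

/-- The line over `u` and the point `q(z)` off it span exactly one plane, with coefficients `n`; the
points `a` to avoid satisfy the single cubic equation `∑ n i * q i = 0`. -/
theorem exists_separating_at [IsAlgClosed K] (h : CubicParametrization F q M) {z u : Fin 3 → K}
    (hz0 : z ≠ 0) (hz : ∃ i, aeval z (q i) ≠ 0) (hu0 : u ≠ 0) (hu : ∀ i, aeval u (q i) = 0) :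
    ∃ Φ : MvPolynomial (Fin 3) K, Φ ≠ 0 ∧ ∀ a, aeval a Φ ≠ 0 → ∀ l : Fin 4 → K, l ≠ 0 →
      ∑ i, l i * aeval a (q i) = 0 → ∑ i, l i * aeval z (q i) = 0 →
        ∃ v, ∑ i, l i * dirDeriv q u v i ≠ 0 := by
  have : Infinite K := IsAlgClosed.instInfinite
  obtain ⟨v, w, hd, hind⟩ := h.exists_independent_dirDeriv hu0 hu
  set n := cross4 (dirDeriv q u v) (dirDeriv q u w) (fun i => aeval z (q i)) with hn
  have hn0 : n ≠ 0 := by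
    intro h0
    obtain ⟨α, β, γ, hne, hrel⟩ := exists_relation_of_cross4_eq_zero h0
    by_cases hγ : γ = 0
    · obtain ⟨hα, hβ⟩ := hind α β (funext fun i => by
        have := hrel i
        rw [hγ, zero_mul, add_zero] at this
        simpa using this)
      exact hne ⟨hα, hβ, hγ⟩
    -- If `q(z)` lay on the line over `u`, the morphism would send it both to `z` and to `u`, making
    -- `z` a base point.
    · have he : (fun i => aeval z (q i)) = dirDeriv q u ((-(α / γ)) • v + (-(β / γ)) • w) := by
        rw [dirDeriv_add_smul]
        funext i
        have := hrel i
        simp only [Pi.add_apply, Pi.smul_apply, smul_eq_mul]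
        field_simp
        linear_combination this
      have hM := h.rel_eval hz0 hz
      have hM' := h.rel_dirDeriv hu0 hu (v := (-(α / γ)) • v + (-(β / γ)) • w) (by
        rw [← he]; exact (h.mem _ _ hM).1)
      rw [← he] at hM'
      obtain ⟨c, hc, rfl⟩ := exists_eq_smul_of_mul_comm hz0 hu0 (h.rel_unique hM hM')
      obtain ⟨i, hi⟩ := hz
      exact hi (by rw [(h.homog i).aeval_smul_vec, hu, mul_zero])
  refine ⟨∑ i, C (n i) * q i, fun h0 => hn0 (h.eq_zero_of_sum_eq_zero h0), ?_⟩
  intro a ha l hl hla hlz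
  by_contra! hcon
  have hcomm := cross4_mul_comm (g := l) (a := dirDeriv q u v) (b := dirDeriv q u w)
    (c := fun i => aeval z (q i)) (by simpa only [mul_comm] using hcon v)
    (by simpa only [mul_comm] using hcon w) (by simpa only [mul_comm] using hlz)
  rw [← hn] at hcomm
  obtain ⟨j, hj⟩ := Function.ne_iff.1 hl
  apply ha
  have : l j * aeval a (∑ i, C (n i) * q i) = n j * ∑ i, l i * aeval a (q i) := by
    simp only [map_sum, map_mul, Finset.mul_sum, algHom_C, Algebra.algebraMap_self,
      RingHom.id_apply]
    refine Finset.sum_congr rfl fun i _ => ?_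
    linear_combination aeval a (q i) * hcomm i j
  rw [hla, mul_zero] at this
  exact (mul_eq_zero.1 this).resolve_left hj

/-- A generic point is separated from a given one. -/
theorem exists_separating [IsAlgClosed K] (h : CubicParametrization F q M) {z : Fin 3 → K}
    (hz0 : z ≠ 0) (hz : ∃ i, aeval z (q i) ≠ 0) :
    ∃ Φ : MvPolynomial (Fin 3) K, Φ ≠ 0 ∧ ∀ a, aeval a Φ ≠ 0 → Separated q a z := by
  classical
  have : Infinite K := IsAlgClosed.instInfinite
  choose Φ hΦ hsep using fun x : {x : Projectivization K (Fin 3 → K) //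
    ∀ i, aeval x.rep (q i) = 0} => h.exists_separating_at hz0 hz x.1.rep_nonzero x.2
  have : Fintype {x : Projectivization K (Fin 3 → K) // ∀ i, aeval x.rep (q i) = 0} :=
    h.finite_base.fintype
  refine ⟨∏ x, Φ x, Finset.prod_ne_zero_iff.2 fun x _ => hΦ x, fun a ha u hu0 hu l hl hla hlz => ?_⟩
  rw [map_prod, Finset.prod_ne_zero_iff] at ha
  obtain ⟨c, hc⟩ := Projectivization.exists_smul_eq_mk_rep K u hu0
  have hc' : (Projectivization.mk K u hu0).rep = (c : K) • u := hc.symm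
  obtain ⟨v, hv⟩ := hsep ⟨Projectivization.mk K u hu0, fun i => by
    rw [hc', (h.homog i).aeval_smul_vec, hu, mul_zero]⟩ a (ha _ (Finset.mem_univ _)) l hl hla hlz
  refine ⟨v, fun h0 => hv ?_⟩
  simp only [hc', h.dirDeriv_smul, Pi.smul_apply, smul_eq_mul, mul_left_comm _ ((c : K) ^ 2)]
  rw [← Finset.mul_sum, h0, mul_zero]

end CubicParametrization

/-! ### From a birational morphism to a cubic parametrization. -/

namespace CubicSurface

theorem exists_rep_mk_eq {K : Type*} [Field K] {n : ℕ} (y : Fin (n + 1) → K) (hy : y ≠ 0) :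
    ∃ c : K, c ≠ 0 ∧ (Projectivization.mk K y hy).rep = c • y := by
  obtain ⟨c, hc⟩ := Projectivization.exists_smul_eq_mk_rep K y hy
  exact ⟨c, c.ne_zero, hc.symm⟩

section

variable {k K : Type*} [Field k] [Field K] [Algebra k K]

theorem vanishes_mk {n e : ℕ} {G : MvPolynomial (Fin (n + 1)) k} (hG : G.IsHomogeneous e)
    (y : Fin (n + 1) → K) (hy : y ≠ 0) :
    Vanishes G (Projectivization.mk K y hy) ↔ aeval y G = 0 := by
  obtain ⟨c, hc, h⟩ := exists_rep_mk_eq y hy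
  rw [Vanishes, h, hG.aeval_smul_vec]
  simp [hc]

theorem exists_evalTuple_mk {n m e : ℕ} {f : Fin (m + 1) → MvPolynomial (Fin (n + 1)) k}
    (hf : ∀ j, (f j).IsHomogeneous e) (y : Fin (n + 1) → K) (hy : y ≠ 0) :
    ∃ c : K, c ≠ 0 ∧ evalTuple f (Projectivization.mk K y hy) = c • fun j => aeval y (f j) := by
  obtain ⟨c, hc, h⟩ := exists_rep_mk_eq y hy
  refine ⟨c ^ e, pow_ne_zero e hc, funext fun j => ?_⟩
  rw [evalTuple, h, (hf j).aeval_smul_vec]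
  rfl

theorem evalTuple_mk_ne_zero {n m e : ℕ} {f : Fin (m + 1) → MvPolynomial (Fin (n + 1)) k}
    (hf : ∀ j, (f j).IsHomogeneous e) (y : Fin (n + 1) → K) (hy : y ≠ 0) :
    evalTuple f (Projectivization.mk K y hy) ≠ 0 ↔ ∃ j, aeval y (f j) ≠ 0 := by
  obtain ⟨c, hc, h⟩ := exists_evalTuple_mk hf y hy
  rw [h, smul_ne_zero_iff, Function.ne_iff]
  exact ⟨fun h => h.2, fun h => ⟨hc, h⟩⟩

theorem mk_evalTuple {n m e : ℕ} {f : Fin (m + 1) → MvPolynomial (Fin (n + 1)) k}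
    (hf : ∀ j, (f j).IsHomogeneous e) (y : Fin (n + 1) → K) (hy : y ≠ 0)
    (h : evalTuple f (Projectivization.mk K y hy) ≠ 0)
    (h' : (fun j => aeval y (f j)) ≠ 0) :
    Projectivization.mk K _ h = Projectivization.mk K _ h' := by
  obtain ⟨c, -, hc⟩ := exists_evalTuple_mk hf y hy
  rw [Projectivization.mk_eq_mk_iff']
  exact ⟨c, hc.symm⟩

/-- A polynomial over `k` that vanishes at all nonzero vectors over an infinite extension is
zero. -/
theorem eq_zero_of_forall_ne_zero [Infinite K] {n : ℕ} {G : MvPolynomial (Fin (n + 1)) k}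
    (h : ∀ u : Fin (n + 1) → K, u ≠ 0 → aeval u G = 0) : G = 0 := by
  -- The factor `X 0` makes the product vanish at the origin too.
  have hX : X 0 * G = 0 := by
    apply MvPolynomial.map_injective (algebraMap k K) (algebraMap k K).injective
    refine MvPolynomial.funext fun u => ?_
    rw [eval_map, map_zero, map_zero, ← aeval_def, map_mul, aeval_X]
    by_cases hu : u = 0
    · rw [hu]; simp
    · rw [h u hu, mul_zero]
  exact (mul_eq_zero.1 hX).resolve_left (X_ne_zero 0)

end

variable {k : Type*} [Field k] {F : MvPolynomial (Fin 4) k}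

/-- The graph of `p`, as a relation between coordinate vectors. -/
def graphRel (p : GeomPt F → ProjPt (AlgebraicClosure k) 2) (y : Fin 4 → AlgebraicClosure k)
    (u : Fin 3 → AlgebraicClosure k) : Prop :=
  ∃ (hy : y ≠ 0) (hV : Vanishes (n := 3) F (Projectivization.mk (AlgebraicClosure k) y hy))
    (hu : u ≠ 0), p ⟨Projectivization.mk (AlgebraicClosure k) y hy, hV⟩ =
      Projectivization.mk (AlgebraicClosure k) u hu

/-- A birational morphism to the plane is inverted by cubic forms. -/
theorem exists_cubicParametrization (hF : IsSmoothCubicSurface F)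
    {p : GeomPt F → ProjPt (AlgebraicClosure k) 2} (hp : IsMorphism F p)
    (hbir : IsBirational F p) :
    ∃ q : Fin 4 → MvPolynomial (Fin 3) k, CubicParametrization F q (graphRel p) := by
  set K := AlgebraicClosure k
  have hinf : Infinite K := IsAlgClosed.instInfinite
  obtain ⟨d, q₀, hq₀, hq₀ne, hpq, -⟩ := hbir
  obtain ⟨i₀, hi₀⟩ := Function.ne_iff.1 hq₀ne
  have hi₀ : q₀ i₀ ≠ 0 := hi₀
  -- The Jacobian argument needs coprime forms, so the common factor is removed; the relations
  -- proved for `q₀` are later divided by powers of `D`.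
  obtain ⟨D, q, hD, hqD, hcop⟩ := exists_eq_mul_coprime q₀ ⟨i₀, hi₀⟩
  obtain ⟨δ, d', -, hDhom, hi₀hom⟩ := MvPolynomial.IsHomogeneous.exists_of_mul
    (hqD i₀ ▸ hq₀ i₀) (hqD i₀ ▸ hi₀)
  have hq : ∀ i, (q i).IsHomogeneous (d - δ) := by
    intro i
    by_cases hi : q i = 0
    · rw [hi]; exact isHomogeneous_zero _ _ _
    · have hne : D * q i ≠ 0 := mul_ne_zero hD hi
      obtain ⟨a, b, hab, ha, hb⟩ := MvPolynomial.IsHomogeneous.exists_of_mul (hqD i ▸ hq₀ i) hne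
      have := ha.inj_right hDhom hD
      rwa [show d - δ = b by omega]
  have hvec : q₀ = D • q := funext hqD
  -- the first half of birationality, on vectors
  have hgraph : ∀ u : Fin 3 → K, u ≠ 0 → (∃ i, aeval u (q₀ i) ≠ 0) →
      graphRel p (fun i => aeval u (q₀ i)) u := by
    intro u hu hqu
    have hne := (evalTuple_mk_ne_zero hq₀ u hu).2 hqu
    obtain ⟨hV, hpu⟩ := hpq (Projectivization.mk K u hu) hne
    have hqu' : (fun i => aeval u (q₀ i)) ≠ 0 := Function.ne_iff.2 hqu
    have hmk := mk_evalTuple hq₀ u hu hne hqu'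
    refine ⟨hqu', hmk ▸ hV, hu, ?_⟩
    refine Eq.trans ?_ hpu
    congr 2
    exact hmk.symm
  have hrel₀ : aeval q₀ F = 0 := by
    refine eq_zero_of_forall_ne_zero (K := K) fun u hu => ?_
    rw [aeval_aeval_vec]
    by_cases hqu : ∃ i, aeval u (q₀ i) ≠ 0
    · obtain ⟨hy, hV, -⟩ := hgraph u hu hqu
      exact (vanishes_mk hF.1 _ hy).1 hV
    · push Not at hqu
      have : (fun i => aeval u (q₀ i)) = (0 : K) • (0 : Fin 4 → K) := funext fun i => by
        simp [hqu i]
      rw [this, hF.1.aeval_smul_vec]; simp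
  have hrel : aeval q F = 0 := by
    rw [hvec, hF.1.aeval_smul_vec] at hrel₀
    exact (mul_eq_zero.1 hrel₀).resolve_left (pow_ne_zero _ hD)
  have hpar : Parametrization F q (graphRel p) := by
    refine { cubic := hF.1, smooth := ?_, ne_zero := ⟨i₀, fun h0 => hi₀ ?_⟩, relation := hrel,
             mem := ?_, exists_local := ?_ }
    · intro y hy hFy
      obtain ⟨i, hi⟩ := hF.2 (Projectivization.mk K y hy) ((vanishes_mk hF.1 y hy).2 hFy)
      exact ⟨i, fun h0 => hi ((vanishes_mk hF.1.pderiv y hy).2 h0)⟩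
    · rw [hqD, h0, mul_zero]
    · rintro y u ⟨hy, hV, hu, -⟩
      exact ⟨hy, (vanishes_mk hF.1 y hy).1 hV, hu⟩
    · intro y hy hFy
      obtain ⟨e, f, hf, hne, hpf⟩ := hp ⟨Projectivization.mk K y hy, (vanishes_mk hF.1 y hy).2 hFy⟩
      have hM : ∀ y' : Fin 4 → K, y' ≠ 0 → aeval y' F = 0 → (∃ j, aeval y' (f j) ≠ 0) →
          ∀ u : Fin 3 → K, graphRel p y' u ↔
            u ≠ 0 ∧ ∀ i j, aeval y' (f i) * u j = aeval y' (f j) * u i := by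
        intro y' hy' hFy' hfy' u
        have hV := (vanishes_mk hF.1 y' hy').2 hFy'
        have hne' := (evalTuple_mk_ne_zero hf y' hy').2 hfy'
        have hfv : (fun j => aeval y' (f j)) ≠ 0 := Function.ne_iff.2 hfy'
        have hpy := hpf ⟨Projectivization.mk K y' hy', hV⟩ hne'
        rw [mk_evalTuple hf y' hy' hne' hfv] at hpy
        constructor
        · rintro ⟨_, _, hu, h⟩
          rw [hpy] at h
          exact ⟨hu, (mk_eq_mk_iff_mul hfv hu).1 h⟩
        · rintro ⟨hu, h⟩
          exact ⟨hy', hV, hu, hpy.trans ((mk_eq_mk_iff_mul hfv hu).2 h)⟩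
      refine ⟨e, f, hf, (evalTuple_mk_ne_zero hf y hy).1 hne, fun i j => ?_, hM⟩
      -- The graph relation is available only where `q₀` does not vanish, hence the auxiliary factor
      -- `q₀ i₀`.
      have h₀ : aeval q₀ (f i) * X j - aeval q₀ (f j) * X i = 0 := by
        refine (mul_eq_zero.1 (eq_zero_of_forall_ne_zero (K := K) (G := q₀ i₀ *
          (aeval q₀ (f i) * X j - aeval q₀ (f j) * X i)) fun u hu => ?_)).resolve_left hi₀
        simp only [map_mul, map_sub, aeval_aeval_vec, aeval_X]
        by_cases hqu : aeval u (q₀ i₀) = 0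
        · rw [hqu, zero_mul]
        · have hg := hgraph u hu ⟨i₀, hqu⟩
          obtain ⟨hy', hV', -⟩ := id hg
          by_cases hfq : ∃ j, aeval (fun i => aeval u (q₀ i)) (f j) ≠ 0
          · have := ((hM _ hy' ((vanishes_mk hF.1 _ hy').1 hV') hfq u).1 hg).2 i j
            rw [this, sub_self, mul_zero]
          · push Not at hfq
            rw [hfq, hfq]; ring
      rw [hvec, (hf i).aeval_smul_vec, (hf j).aeval_smul_vec, mul_assoc, mul_assoc, ← mul_sub]
        at h₀
      exact sub_eq_zero.1 ((mul_eq_zero.1 h₀).resolve_left (pow_ne_zero _ hD))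
  obtain ⟨hd3, hJ⟩ := hpar.exists_jacobian hq hcop
  rw [hd3] at hq
  exact ⟨q, { toParametrization := hpar, homog := hq, jacobian := hJ }⟩

end CubicSurface

/-! ### Generating the points of the plane by lines. -/

/-- A nonzero polynomial over an extension of an infinite field does not vanish identically on
vectors over the field. -/
theorem exists_aeval_algebraMap_ne_zero {k K σ : Type*} [Field k] [Infinite k] [Field K]
    [Algebra k K] {Φ : MvPolynomial σ K} (hΦ : Φ ≠ 0) :
    ∃ a : σ → k, aeval (algebraMap k K ∘ a) Φ ≠ 0 := by
  by_contra! hcon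
  apply hΦ
  refine funext_set (fun _ => Set.range (algebraMap k K))
    (fun _ => Set.infinite_range_of_injective (algebraMap k K).injective) fun x hx => ?_
  choose a ha using fun i => hx i trivial
  have : algebraMap k K ∘ a = x := funext ha
  have h := hcon a
  rw [this] at h
  rw [map_zero]
  exact h

namespace CubicParametrization

variable {k K : Type*} [Field k] [Field K] [Algebra k K] {q : Fin 4 → MvPolynomial (Fin 3) k}

theorem aeval_comp_map (a : Fin 3 → k) (G : MvPolynomial (Fin 3) k) :
    aeval (algebraMap k K ∘ a) (MvPolynomial.map (algebraMap k K) G) =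
      algebraMap k K (aeval a G) := by
  rw [aeval_map_algebraMap]
  exact aeval_algebraMap_apply K a G

/-- Three points generate all points off the base locus, under passage to further points of a line
through two known points when a pair of points is separated. -/
theorem exists_generators [Infinite k] [IsAlgClosed K] {F : MvPolynomial (Fin 4) K}
    {M : (Fin 4 → K) → (Fin 3 → K) → Prop}
    (h : CubicParametrization F (fun i => MvPolynomial.map (algebraMap k K) (q i)) M) :
    ∃ a₀ b₀ c₀ : Fin 3 → k, (∃ i, aeval a₀ (q i) ≠ 0) ∧ (∃ i, aeval b₀ (q i) ≠ 0) ∧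
      (∃ i, aeval c₀ (q i) ≠ 0) ∧ ∀ T : Set (Fin 3 → k), a₀ ∈ T → b₀ ∈ T → c₀ ∈ T →
        (∀ a ∈ T, ∀ c : k, c ≠ 0 → c • a ∈ T) →
        (∀ a ∈ T, ∀ b ∈ T, ∀ s t : k, (¬ ∀ i j, a i * b j = a j * b i) → s ≠ 0 → t ≠ 0 →
          (∃ i, aeval (s • a + t • b) (q i) ≠ 0) →
          (Separated (fun i => MvPolynomial.map (algebraMap k K) (q i)) (algebraMap k K ∘ a)
              (algebraMap k K ∘ b) ∨
            Separated (fun i => MvPolynomial.map (algebraMap k K) (q i)) (algebraMap k K ∘ a)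
              (algebraMap k K ∘ (s • a + t • b))) → s • a + t • b ∈ T) →
        ∀ z, (∃ i, aeval z (q i) ≠ 0) → z ∈ T := by
  set qK : Fin 4 → MvPolynomial (Fin 3) K := fun i => MvPolynomial.map (algebraMap k K) (q i)
    with hqK
  have hinj := (algebraMap k K).injective
  have hq0 : ∀ z : Fin 3 → k, (∃ i, aeval z (q i) ≠ 0) → z ≠ 0 := by
    rintro z ⟨i, hi⟩ rfl
    have h1 := (h.homog i).aeval_smul_vec (0 : K) (algebraMap k K ∘ (0 : Fin 3 → k))
    rw [show (0 : K) • (algebraMap k K ∘ (0 : Fin 3 → k)) = algebraMap k K ∘ (0 : Fin 3 → k) from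
      funext fun _ => by simp, hqK, aeval_comp_map] at h1
    exact hi (hinj (by rw [h1]; simp))
  have hqne : ∀ (z : Fin 3 → k) i, aeval (algebraMap k K ∘ z) (qK i) ≠ 0 → aeval z (q i) ≠ 0 := by
    intro z i hz h0
    rw [hqK, aeval_comp_map, h0, map_zero] at hz
    exact hz rfl
  have hsep : ∀ z : Fin 3 → k, (∃ i, aeval z (q i) ≠ 0) → ∃ Φ : MvPolynomial (Fin 3) K, Φ ≠ 0 ∧
      ∀ a, aeval a Φ ≠ 0 → Separated qK a (algebraMap k K ∘ z) := by
    rintro z ⟨i, hi⟩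
    refine h.exists_separating (fun h0 => hq0 z ⟨i, hi⟩ (funext fun j => hinj ?_)) ⟨i, ?_⟩
    · simpa using congrFun h0 j
    · rw [aeval_comp_map]
      exact fun h0 => hi (hinj (by rw [h0, map_zero]))
  -- generic vectors are not proportional to a given one
  have hpar : ∀ z : Fin 3 → k, z ≠ 0 → ∃ Φ : MvPolynomial (Fin 3) K, Φ ≠ 0 ∧
      ∀ a : Fin 3 → k, aeval (algebraMap k K ∘ a) Φ ≠ 0 → ¬ ∀ i j, z i * a j = z j * a i := by
    intro z hz
    obtain ⟨i, hi⟩ := Function.ne_iff.1 hz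
    have hne : i ≠ i + 1 := by fin_cases i <;> decide
    refine ⟨C (algebraMap k K (z i)) * X (i + 1) - C (algebraMap k K (z (i + 1))) * X i, ?_, ?_⟩
    · intro h0
      have := congrArg (aeval (Pi.single (i + 1) 1 : Fin 3 → K)) h0
      simp only [map_sub, map_mul, aeval_X, Pi.single_eq_same, Pi.single_eq_of_ne hne, mul_zero,
        sub_zero, mul_one, map_zero, algHom_C] at this
      exact hi (hinj (by simpa using this))
    · intro a ha hcon
      apply ha
      have := congrArg (algebraMap k K) (hcon i (i + 1))
      rw [map_mul, map_mul] at this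
      simp [this]
  -- Choice of the generators: `c₀` off the base locus, `a₀` separated from it and not parallel to
  -- it, `b₀` separated from `a₀` and off the line `a₀ c₀`.
  obtain ⟨i₀, hi₀⟩ := h.ne_zero
  obtain ⟨c₀, hc₀⟩ := exists_aeval_algebraMap_ne_zero (k := k) hi₀
  have hc₀q := hqne c₀ i₀ hc₀
  obtain ⟨Φc, hΦc, hΦcs⟩ := hsep c₀ ⟨i₀, hc₀q⟩
  obtain ⟨Λ, hΛ, hΛs⟩ := hpar c₀ (hq0 c₀ ⟨i₀, hc₀q⟩)
  obtain ⟨a₀, ha₀⟩ := exists_aeval_algebraMap_ne_zero (k := k) (mul_ne_zero (mul_ne_zero hi₀ hΦc) hΛ)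
  rw [map_mul, map_mul] at ha₀
  have ha₀q := hqne a₀ i₀ (left_ne_zero_of_mul (left_ne_zero_of_mul ha₀))
  have ha₀Φ := right_ne_zero_of_mul (left_ne_zero_of_mul ha₀)
  have hac := hΛs a₀ (right_ne_zero_of_mul ha₀)
  obtain ⟨Φa, hΦa, hΦas⟩ := hsep a₀ ⟨i₀, ha₀q⟩
  obtain ⟨w₀, hw₀⟩ := exists_det3_eq_one hac
  have hdetpoly : det3 (fun i => C (algebraMap k K (a₀ i))) (X : Fin 3 → MvPolynomial (Fin 3) K)
      (fun i => C (algebraMap k K (c₀ i))) ≠ 0 := by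
    intro h0
    have := congrArg (aeval (algebraMap k K ∘ w₀)) h0
    have h1 : aeval (algebraMap k K ∘ w₀) (det3 (fun i => C (algebraMap k K (a₀ i)))
        (X : Fin 3 → MvPolynomial (Fin 3) K) (fun i => C (algebraMap k K (c₀ i)))) =
        algebraMap k K (det3 c₀ a₀ w₀) := by
      simp [det3]; ring
    rw [h1, hw₀, map_one, map_zero] at this
    exact one_ne_zero this
  obtain ⟨b₀, hb₀⟩ := exists_aeval_algebraMap_ne_zero (k := k)
    (mul_ne_zero (mul_ne_zero hi₀ hΦa) hdetpoly)
  rw [map_mul, map_mul] at hb₀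
  have hb₀q := hqne b₀ i₀ (left_ne_zero_of_mul (left_ne_zero_of_mul hb₀))
  have hab : Separated qK (algebraMap k K ∘ a₀) (algebraMap k K ∘ b₀) :=
    (hΦas _ (right_ne_zero_of_mul (left_ne_zero_of_mul hb₀))).symm
  set Δ := det3 a₀ b₀ c₀ with hΔ
  have hΔ0 : Δ ≠ 0 := by
    intro h0
    apply right_ne_zero_of_mul hb₀
    have h1 : aeval (algebraMap k K ∘ b₀) (det3 (fun i => C (algebraMap k K (a₀ i)))
        (X : Fin 3 → MvPolynomial (Fin 3) K) (fun i => C (algebraMap k K (c₀ i)))) =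
        algebraMap k K Δ := by
      simp [det3, hΔ]
    rw [h1, h0, map_zero]
  refine ⟨a₀, b₀, c₀, ⟨i₀, ha₀q⟩, ⟨i₀, hb₀q⟩, ⟨i₀, hc₀q⟩, fun T hTa hTb hTc hTs hT => ?_⟩
  have hline : ∀ x y : k, (∃ i, aeval (x • a₀ + y • b₀) (q i) ≠ 0) → x • a₀ + y • b₀ ∈ T := by
    intro x y hxy
    have h0 := hq0 _ hxy
    by_cases hx : x = 0
    · rw [hx, zero_smul, zero_add] at h0 ⊢
      exact hTs _ hTb _ fun hy => h0 (by rw [hy, zero_smul])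
    by_cases hy : y = 0
    · rw [hy, zero_smul, add_zero] at h0 ⊢
      exact hTs _ hTa _ hx
    · refine hT _ hTa _ hTb x y (fun hp => hΔ0 ?_) hx hy hxy (Or.inl hab)
      rw [hΔ]
      simp only [det3]
      linear_combination c₀ 2 * hp 0 1 + c₀ 0 * hp 1 2 + c₀ 1 * hp 2 0
  -- the projection of a vector to the plane of `a₀`, `b₀` along `c₀`
  let B : Fin 3 → MvPolynomial (Fin 3) K := fun j =>
    det3 X (C ∘ algebraMap k K ∘ b₀) (C ∘ algebraMap k K ∘ c₀) * C (algebraMap k K (a₀ j)) +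
      det3 (C ∘ algebraMap k K ∘ a₀) X (C ∘ algebraMap k K ∘ c₀) * C (algebraMap k K (b₀ j))
  let W : MvPolynomial (Fin 3) K := det3 (C ∘ algebraMap k K ∘ a₀) (C ∘ algebraMap k K ∘ b₀) X
  have hB : ∀ z : Fin 3 → k, (fun j => aeval (algebraMap k K ∘ z) (B j)) =
      algebraMap k K ∘ (det3 z b₀ c₀ • a₀ + det3 a₀ z c₀ • b₀) := by
    intro z
    funext j
    simp [B, det3]
  have hW : ∀ z : Fin 3 → k, aeval (algebraMap k K ∘ z) W = algebraMap k K (det3 a₀ b₀ z) := by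
    intro z
    simp [W, det3]
  -- `Ψ` is nonzero at `z` when the projection of `z` from `c₀` to the line `a₀ b₀` is off the base
  -- locus and meets the condition of separation from `c₀`, and `z` is not on that line. To see that
  -- `Ψ ≠ 0`, its first factor is tested at `Δ⁻¹ • a₀`, which projects to `a₀`, and its second at
  -- `c₀`.
  let Ψ : MvPolynomial (Fin 3) K := aeval B (Φc * qK i₀) * W
  have hBa : (fun j => aeval (algebraMap k K ∘ (Δ⁻¹ • a₀)) (B j)) = algebraMap k K ∘ a₀ := by
    rw [hB]
    have h1 : det3 (Δ⁻¹ • a₀) b₀ c₀ = 1 := by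
      rw [← inv_mul_cancel₀ hΔ0, hΔ]
      generalize (det3 a₀ b₀ c₀)⁻¹ = r
      simp [det3]; ring
    have h2 : det3 a₀ (Δ⁻¹ • a₀) c₀ = 0 := by
      generalize Δ⁻¹ = r
      simp [det3]; ring
    rw [h1, h2, one_smul, zero_smul, add_zero]
  have hΨ : Ψ ≠ 0 := by
    refine mul_ne_zero (fun h0 => ?_) (fun h0 => hΔ0 (hinj ?_))
    · have := congrArg (aeval (algebraMap k K ∘ (Δ⁻¹ • a₀))) h0
      rw [aeval_aeval_vec, hBa, map_mul, map_zero] at this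
      exact mul_ne_zero ha₀Φ (left_ne_zero_of_mul (left_ne_zero_of_mul ha₀)) this
    · have := congrArg (aeval (algebraMap k K ∘ c₀)) h0
      rw [hW, map_zero] at this
      rw [map_zero]; exact this
  have hgen : ∀ z : Fin 3 → k, aeval (algebraMap k K ∘ z) Ψ ≠ 0 → (∃ i, aeval z (q i) ≠ 0) →
      z ∈ T := by
    intro z hz hzq
    rw [map_mul, aeval_aeval_vec, hB, hW, map_mul] at hz
    set x := det3 z b₀ c₀
    set y := det3 a₀ z c₀
    have hw : det3 a₀ b₀ z ≠ 0 := fun h0 => right_ne_zero_of_mul hz (by rw [h0, map_zero])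
    have hbq := hqne _ _ (right_ne_zero_of_mul (left_ne_zero_of_mul hz))
    have hbT := hline x y ⟨_, hbq⟩
    have hdec : z = Δ⁻¹ • (x • a₀ + y • b₀) + (Δ⁻¹ * det3 a₀ b₀ z) • c₀ := by
      funext j
      have := det3_smul_eq a₀ b₀ c₀ z j
      simp only [Pi.add_apply, Pi.smul_apply, smul_eq_mul]
      rw [mul_assoc, ← mul_add, ← this, inv_mul_cancel_left₀ hΔ0]
    rw [hdec]
    refine hT _ hbT _ hTc _ _ (fun hp => ?_) (inv_ne_zero hΔ0) (mul_ne_zero (inv_ne_zero hΔ0) hw)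
      (hdec ▸ hzq) (Or.inl (hΦcs _ (left_ne_zero_of_mul (left_ne_zero_of_mul hz))))
    refine hq0 _ ⟨_, hbq⟩ ?_
    have h1 : x * Δ = 0 := by
      have h01 := hp 0 1
      have h12 := hp 1 2
      have h20 := hp 2 0
      simp only [Pi.add_apply, Pi.smul_apply, smul_eq_mul] at h01 h12 h20
      rw [hΔ]
      simp only [det3]
      linear_combination -b₀ 2 * h01 - b₀ 0 * h12 - b₀ 1 * h20
    have h2 : y * Δ = 0 := by
      have h01 := hp 0 1
      have h12 := hp 1 2
      have h20 := hp 2 0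
      simp only [Pi.add_apply, Pi.smul_apply, smul_eq_mul] at h01 h12 h20
      rw [hΔ]
      simp only [det3]
      linear_combination a₀ 2 * h01 + a₀ 0 * h12 + a₀ 1 * h20
    rw [(mul_eq_zero.1 h1).resolve_right hΔ0, (mul_eq_zero.1 h2).resolve_right hΔ0]
    simp
  -- An arbitrary `z` lies on the line through the generic points `a` and `a + s • z`. Here `a` is
  -- separated from the point `z` under construction, which is what the second alternative in the
  -- closure property of `T` is for.
  intro z hz
  obtain ⟨Φz, hΦz, hΦzs⟩ := hsep z hz
  obtain ⟨Λz, hΛz, hΛzs⟩ := hpar z (hq0 z hz)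
  obtain ⟨a, ha⟩ := exists_aeval_algebraMap_ne_zero (k := k)
    (mul_ne_zero (mul_ne_zero (mul_ne_zero hi₀ hΨ) hΦz) hΛz)
  rw [map_mul, map_mul, map_mul] at ha
  have haq := left_ne_zero_of_mul (left_ne_zero_of_mul (left_ne_zero_of_mul ha))
  have haΨ := right_ne_zero_of_mul (left_ne_zero_of_mul (left_ne_zero_of_mul ha))
  have haΦ := right_ne_zero_of_mul (left_ne_zero_of_mul ha)
  have haz := hΛzs a (right_ne_zero_of_mul ha)
  have haT := hgen a haΨ ⟨_, hqne a i₀ haq⟩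
  let P : Polynomial K := aeval (fun j => Polynomial.C (algebraMap k K (a j)) +
    Polynomial.X * Polynomial.C (algebraMap k K (z j))) (qK i₀ * Ψ)
  have hPev : ∀ s : k, P.eval (algebraMap k K s) =
      aeval (algebraMap k K ∘ (a + s • z)) (qK i₀ * Ψ) := by
    intro s
    rw [polynomial_eval_aeval]
    congr 2
    funext j
    simp
    exact mul_comm _ _
  -- The extra factor ensures `s ≠ 0`.
  have hP : Polynomial.X * P ≠ 0 := by
    refine mul_ne_zero Polynomial.X_ne_zero fun h0 => ?_
    have := hPev 0
    rw [h0, Polynomial.eval_zero, zero_smul, add_zero, map_mul] at this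
    exact mul_ne_zero haq haΨ this.symm
  obtain ⟨s, hs⟩ : ∃ s : k, (Polynomial.X * P).eval (algebraMap k K s) ≠ 0 := by
    by_contra! hcon
    apply hP
    refine Polynomial.eq_zero_of_infinite_isRoot _ (Set.Infinite.mono ?_
      (Set.infinite_range_of_injective hinj))
    rintro _ ⟨s, rfl⟩
    exact hcon s
  rw [Polynomial.eval_mul, Polynomial.eval_X, hPev, map_mul] at hs
  have hs0 : s ≠ 0 := fun h0 => left_ne_zero_of_mul hs (by rw [h0, map_zero])
  have hbT := hgen (a + s • z) (right_ne_zero_of_mul (right_ne_zero_of_mul hs))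
    ⟨_, hqne _ i₀ (left_ne_zero_of_mul (right_ne_zero_of_mul hs))⟩
  have hdec : z = (-s⁻¹) • a + s⁻¹ • (a + s • z) := by
    rw [smul_add, smul_smul, inv_mul_cancel₀ hs0, one_smul, neg_smul]
    abel
  rw [hdec]
  refine hT a haT _ hbT _ _ (fun hp => haz fun i j => ?_) (neg_ne_zero.2 (inv_ne_zero hs0))
    (inv_ne_zero hs0) (hdec ▸ hz) (Or.inr (hdec ▸ hΦzs _ haΦ))
  have := hp i j
  simp only [Pi.add_apply, Pi.smul_apply, smul_eq_mul] at this
  apply mul_left_cancel₀ hs0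
  linear_combination -this

end CubicParametrization

/-! ### Blown-down lines, and rational points as values of `q`. -/

namespace CubicSurface

theorem submodule_mk_le {K : Type*} [Field K] {n : ℕ} {y : Fin n → K} (hy : y ≠ 0)
    {l : Submodule K (Fin n → K)} : (Projectivization.mk K y hy).submodule ≤ l ↔ y ∈ l := by
  rw [Projectivization.submodule_mk, Submodule.span_singleton_le_iff_mem]

theorem algebraMap_comp_ne_zero {k K : Type*} [Field k] [Field K] [Algebra k K] {n : ℕ}
    {v : Fin n → k} (hv : v ≠ 0) : algebraMap k K ∘ v ≠ 0 := by
  obtain ⟨i, hi⟩ := Function.ne_iff.1 hv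
  refine Function.ne_iff.2 ⟨i, ?_⟩
  simpa using hi

theorem toGeom_mk {k : Type*} [Field k] {n : ℕ} (v : Fin (n + 1) → k) (hv : v ≠ 0) :
    toGeom (Projectivization.mk k v hv) = Projectivization.mk (AlgebraicClosure k)
      (algebraMap k (AlgebraicClosure k) ∘ v) (algebraMap_comp_ne_zero hv) := by
  obtain ⟨c, -, hc⟩ := exists_rep_mk_eq v hv
  rw [toGeom, mk_eq_mk_iff_mul]
  intro i j
  simp only [hc, Function.comp_apply, Pi.smul_apply, smul_eq_mul, map_mul]
  ring

section

variable {k : Type*} [Field k] {F : MvPolynomial (Fin 4) k}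
  {p : GeomPt F → ProjPt (AlgebraicClosure k) 2} {F' : MvPolynomial (Fin 4) (AlgebraicClosure k)}
  {q : Fin 4 → MvPolynomial (Fin 3) (AlgebraicClosure k)} {u v w : Fin 3 → AlgebraicClosure k}

theorem graphRel_of_eq_add (h : CubicParametrization F' q (graphRel p)) (hu0 : u ≠ 0)
    (hu : ∀ i, aeval u (q i) = 0) {α β : AlgebraicClosure k} {y : Fin 4 → AlgebraicClosure k}
    (hy0 : y ≠ 0) (hy : α • dirDeriv q u v + β • dirDeriv q u w = y) : graphRel p y u := by
  rw [← dirDeriv_add_smul] at hy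
  subst hy
  exact h.rel_dirDeriv hu0 hu hy0

theorem finrank_span_pair {K V : Type*} [Field K] [AddCommGroup V] [Module K V] {x y : V}
    (h : ∀ α β : K, α • x + β • y = 0 → α = 0 ∧ β = 0) :
    Module.finrank K (Submodule.span K {x, y}) = 2 := by
  have := finrank_span_eq_card (LinearIndependent.pair_iff.2 h)
  rwa [Matrix.range_cons, Matrix.range_cons, Matrix.range_empty, Set.union_empty,
    Set.singleton_union, Fintype.card_fin] at this

/-- The line of tangent directions at a base point is blown down. -/
theorem isBlownDownLine_span (h : CubicParametrization F' q (graphRel p)) (hu0 : u ≠ 0)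
    (hu : ∀ i, aeval u (q i) = 0)
    (hind : ∀ α β : AlgebraicClosure k,
      α • dirDeriv q u v + β • dirDeriv q u w = 0 → α = 0 ∧ β = 0) :
    IsBlownDownLine p (Submodule.span (AlgebraicClosure k) {dirDeriv q u v, dirDeriv q u w}) := by
  refine ⟨finrank_span_pair hind, fun x hx => ?_, Projectivization.mk _ u hu0, ?_⟩
  · induction x using Projectivization.ind with
    | h y hy =>
      obtain ⟨α, β, hαβ⟩ := Submodule.mem_span_pair.1 ((submodule_mk_le hy).1 hx)
      obtain ⟨_, hV, -⟩ := graphRel_of_eq_add h hu0 hu hy hαβ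
      exact hV
  · rintro ⟨x, hV⟩ hx
    induction x using Projectivization.ind with
    | h y hy =>
      obtain ⟨α, β, hαβ⟩ := Submodule.mem_span_pair.1 ((submodule_mk_le hy).1 hx)
      obtain ⟨_, _, _, hp⟩ := graphRel_of_eq_add h hu0 hu hy hαβ
      exact hp

/-- Every blown-down line is the line of tangent directions at a base point. -/
theorem IsBlownDownLine.exists_base (h : CubicParametrization F' q (graphRel p))
    {l : Submodule (AlgebraicClosure k) (Fin 4 → AlgebraicClosure k)} (hl : IsBlownDownLine p l) :
    ∃ u : Fin 3 → AlgebraicClosure k, u ≠ 0 ∧ (∀ i, aeval u (q i) = 0) ∧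
      (∀ v, dirDeriv q u v ∈ l) ∧ ∀ y ∈ l, y ≠ 0 → graphRel p y u := by
  have hinf : Infinite (AlgebraicClosure k) := IsAlgClosed.instInfinite
  obtain ⟨hrank, hV, U, hU⟩ := hl
  have hrel : ∀ y ∈ l, y ≠ 0 → graphRel p y U.rep := fun y hy hy0 =>
    ⟨hy0, hV _ ((submodule_mk_le hy0).2 hy), U.rep_nonzero,
      (hU ⟨_, hV _ ((submodule_mk_le hy0).2 hy)⟩ ((submodule_mk_le hy0).2 hy)).trans U.mk_rep.symm⟩
  -- Off the base locus `q` recovers a point from its image, so the fibre is a single point and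
  -- cannot contain a line.
  have hbase : ∀ i, aeval U.rep (q i) = 0 := by
    by_contra! hne
    obtain ⟨i, hi⟩ := hne
    have hle : l ≤ Submodule.span (AlgebraicClosure k) {fun j => aeval U.rep (q j)} := by
      intro y hy
      by_cases hy0 : y = 0
      · rw [hy0]; exact zero_mem _
      have hcomm := h.aeval_mul_comm_of_rel (hrel y hy hy0)
      refine Submodule.mem_span_singleton.2 ⟨y i * (aeval U.rep (q i))⁻¹, funext fun j => ?_⟩
      simp only [Pi.smul_apply, smul_eq_mul]
      field_simp
      linear_combination -hcomm i j
    have h1 := Submodule.finrank_mono hle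
    have h2 := finrank_span_le_card (R := AlgebraicClosure k)
      ({fun j => aeval U.rep (q j)} : Set (Fin 4 → AlgebraicClosure k))
    simp only [Set.toFinset_singleton, Finset.card_singleton] at h2
    omega
  obtain ⟨v, w, hd, hind⟩ := h.exists_independent_dirDeriv U.rep_nonzero hbase
  have hmem : ∀ y, graphRel p y U.rep →
      y ∈ Submodule.span (AlgebraicClosure k) {dirDeriv q U.rep v, dirDeriv q U.rep w} := by
    intro y hy
    obtain ⟨α, β, rfl⟩ := h.exists_eq_of_rel hy hbase hd hind
    exact Submodule.mem_span_pair.2 ⟨α, β, rfl⟩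
  have heq : l = Submodule.span (AlgebraicClosure k) {dirDeriv q U.rep v, dirDeriv q U.rep w} := by
    refine Submodule.eq_of_le_of_finrank_eq (fun y hy => ?_) ?_
    · by_cases hy0 : y = 0
      · rw [hy0]; exact zero_mem _
      · exact hmem y (hrel y hy hy0)
    · rw [hrank, finrank_span_pair hind]
  refine ⟨U.rep, U.rep_nonzero, hbase, fun v' => ?_, hrel⟩
  by_cases hv : dirDeriv q U.rep v' = 0
  · rw [hv]; exact zero_mem _
  · rw [heq]
    exact hmem _ (h.rel_dirDeriv U.rep_nonzero hbase hv)

end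

variable {k : Type*} [Field k] {F : MvPolynomial (Fin 4) k}
  {p : GeomPt F → ProjPt (AlgebraicClosure k) 2} {q : Fin 4 → MvPolynomial (Fin 3) k}

/-- The rational point `x` has the homogeneous coordinates `q(a)`. -/
def IsImage (q : Fin 4 → MvPolynomial (Fin 3) k) (a : Fin 3 → k) (x : RatPt F) : Prop :=
  ∃ h : (fun i => aeval a (q i)) ≠ 0, x.1 = Projectivization.mk k _ h

theorem aeval_map_comp (a : Fin 3 → k) (G : MvPolynomial (Fin 3) k) :
    aeval (algebraMap k (AlgebraicClosure k) ∘ a)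
      (MvPolynomial.map (algebraMap k (AlgebraicClosure k)) G) =
      algebraMap k (AlgebraicClosure k) (aeval a G) :=
  CubicParametrization.aeval_comp_map a G

theorem vec_ne_zero (h : CubicParametrization F q (graphRel p)) {a : Fin 3 → k}
    (ha : (fun i => aeval a (q i)) ≠ 0) : a ≠ 0 := by
  rintro rfl
  apply ha
  funext i
  have := (h.homog i).aeval_smul_vec (0 : k) (0 : Fin 3 → k)
  rw [smul_zero] at this
  simpa using this

/-- The map `q` sends a vector at which it does not vanish to a point of the graph. -/
theorem graphRel_aeval (h : CubicParametrization F q (graphRel p)) {a : Fin 3 → k}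
    (ha : (fun i => aeval a (q i)) ≠ 0) :
    graphRel p (algebraMap k (AlgebraicClosure k) ∘ fun i => aeval a (q i))
      (algebraMap k (AlgebraicClosure k) ∘ a) := by
  have := h.map.rel_eval (algebraMap_comp_ne_zero (K := AlgebraicClosure k) (vec_ne_zero h ha))
    (Function.ne_iff.1 (by
      have := algebraMap_comp_ne_zero (K := AlgebraicClosure k) ha
      rwa [show (algebraMap k (AlgebraicClosure k) ∘ fun i => aeval a (q i)) = _ from
        funext fun i => (aeval_map_comp a (q i)).symm] at this))
  convert this using 1
  funext i
  exact (aeval_map_comp a (q i)).symm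

theorem IsImage.geom_eq {a : Fin 3 → k} {x : RatPt F} (hx : IsImage q a x) :
    x.geom.1 = Projectivization.mk (AlgebraicClosure k)
      (algebraMap k (AlgebraicClosure k) ∘ fun i => aeval a (q i))
      (algebraMap_comp_ne_zero hx.choose) := by
  obtain ⟨ha, hxa⟩ := hx
  exact (congrArg toGeom hxa).trans (toGeom_mk _ ha)

theorem IsImage.apply_geom (h : CubicParametrization F q (graphRel p)) {a : Fin 3 → k}
    {x : RatPt F} (hx : IsImage q a x) :
    p x.geom = Projectivization.mk (AlgebraicClosure k)
      (algebraMap k (AlgebraicClosure k) ∘ a)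
      (algebraMap_comp_ne_zero (vec_ne_zero h hx.choose)) := by
  obtain ⟨_, hV, _, hp⟩ := graphRel_aeval h hx.choose
  rw [← hp]
  congr 1
  exact Subtype.ext hx.geom_eq

theorem exists_isImage (h : CubicParametrization F q (graphRel p)) {a : Fin 3 → k}
    (ha : (fun i => aeval a (q i)) ≠ 0) : ∃ x : RatPt F, IsImage q a x := by
  obtain ⟨_, hV, -⟩ := graphRel_aeval h ha
  exact ⟨⟨Projectivization.mk k _ ha, by rw [toGeom_mk]; exact hV⟩, ha, rfl⟩

theorem parallel_of_algebraMap {n : ℕ} {a b : Fin n → k}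
    (h : ∀ i j, (algebraMap k (AlgebraicClosure k) ∘ a) i * (algebraMap k _ ∘ b) j =
      (algebraMap k (AlgebraicClosure k) ∘ a) j * (algebraMap k _ ∘ b) i) (i j : Fin n) :
    a i * b j = a j * b i := by
  apply (algebraMap k (AlgebraicClosure k)).injective
  rw [map_mul, map_mul]
  exact h i j

/-- A blown-down line maps to a base point, whereas `p` sends the point `q(a)` to `a`, at which `q`
does not vanish. -/
theorem IsImage.mem_complement (h : CubicParametrization F q (graphRel p)) {a : Fin 3 → k}
    {x : RatPt F} (hx : IsImage q a x) : x ∈ complementOfBlownDownLines p := by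
  intro l hl hxl
  obtain ⟨u, hu0, hu, -, hlu⟩ := hl.exists_base h.map
  have hne := hx.choose
  rw [hx.geom_eq, submodule_mk_le] at hxl
  have hpar := h.map.rel_unique (graphRel_aeval h hne)
    (hlu _ hxl (algebraMap_comp_ne_zero hne))
  obtain ⟨c, -, hc⟩ := exists_eq_smul_of_mul_comm
    (algebraMap_comp_ne_zero (vec_ne_zero h hne)) hu0 hpar
  obtain ⟨i, hi⟩ := Function.ne_iff.1 hne
  apply hi
  apply (algebraMap k (AlgebraicClosure k)).injective
  rw [← aeval_map_comp, hc, (h.map.homog i).aeval_smul_vec, hu, mul_zero]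
  simp

/-- As `p` is defined over `k`, the image of `x` has a rational coordinate vector `u`. If `u` were a
base point, `x` would lie on the blown-down line over it; otherwise `q(u)` gives back `x`. -/
theorem exists_isImage_of_mem_complement (h : CubicParametrization F q (graphRel p))
    {x : RatPt F} (hx : x ∈ complementOfBlownDownLines p) : ∃ a, IsImage q a x := by
  have hinf : Infinite (AlgebraicClosure k) := IsAlgClosed.instInfinite
  set y := x.1.rep with hy
  have hy0 : y ≠ 0 := x.1.rep_nonzero
  have hyK := algebraMap_comp_ne_zero (K := AlgebraicClosure k) hy0
  have hFy : aeval (algebraMap k (AlgebraicClosure k) ∘ y) F = 0 :=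
    (vanishes_mk h.cubic _ hyK).1 x.2
  obtain ⟨e, f, -, hfy, -, hM⟩ := h.exists_local _ hyK hFy
  have hf : ∀ j, aeval (algebraMap k (AlgebraicClosure k) ∘ y) (f j) =
      algebraMap k (AlgebraicClosure k) (aeval y (f j)) := fun j => aeval_algebraMap_apply _ y (f j)
  set u : Fin 3 → k := fun j => aeval y (f j) with hu
  have hu0 : algebraMap k (AlgebraicClosure k) ∘ u ≠ 0 := by
    obtain ⟨j, hj⟩ := hfy
    exact Function.ne_iff.2 ⟨j, by rw [hf] at hj; exact hj⟩
  have hrel : graphRel p (algebraMap k (AlgebraicClosure k) ∘ y)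
      (algebraMap k (AlgebraicClosure k) ∘ u) := by
    refine (hM _ hyK hFy hfy _).2 ⟨hu0, fun i j => ?_⟩
    rw [hf, hf]
    exact mul_comm _ _
  have hne : (fun i => aeval u (q i)) ≠ 0 := by
    intro h0
    have hbase : ∀ i, aeval (algebraMap k (AlgebraicClosure k) ∘ u)
        (MvPolynomial.map (algebraMap k (AlgebraicClosure k)) (q i)) = 0 := by
      intro i
      rw [aeval_map_comp, show aeval u (q i) = 0 from congrFun h0 i, map_zero]
    obtain ⟨v, w, hd, hind⟩ := h.map.exists_independent_dirDeriv hu0 hbase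
    obtain ⟨α, β, hαβ⟩ := h.map.exists_eq_of_rel hrel hbase hd hind
    refine hx _ (isBlownDownLine_span h.map hu0 hbase hind) ?_
    exact (submodule_mk_le hyK).2 (Submodule.mem_span_pair.2 ⟨α, β, hαβ.symm⟩)
  refine ⟨u, hne, ?_⟩
  rw [← x.1.mk_rep, mk_eq_mk_iff_mul]
  refine parallel_of_algebraMap fun i j => ?_
  have := h.map.aeval_mul_comm_of_rel hrel j i
  simp only [aeval_map_comp] at this
  simp only [Function.comp_apply] at this ⊢
  linear_combination this

end CubicSurface

/-! ### Collinear points on image cubics of plane sections. -/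

theorem exists_ne_zero_orthogonal {K : Type*} [Field K] (a b c : Fin 4 → K) :
    ∃ l : Fin 4 → K, l ≠ 0 ∧ ∑ i, l i * a i = 0 ∧ ∑ i, l i * b i = 0 ∧ ∑ i, l i * c i = 0 := by
  have := LinearMap.ker_ne_bot_of_finrank_lt (f := Matrix.mulVecLin (Matrix.of ![a, b, c]))
    (by simp)
  obtain ⟨l, hl, hl0⟩ := Submodule.exists_mem_ne_zero_of_ne_bot this
  have hl : (Matrix.of ![a, b, c]).mulVec l = 0 := hl
  have h : ∀ j, ∑ i, l i * ![a, b, c] j i = 0 := fun j => by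
    exact (Finset.sum_congr rfl fun i _ => mul_comm _ _).trans (congrFun hl j)
  exact ⟨l, hl0, h 0, h 1, h 2⟩

/-- The terms of a binary cubic form. -/
theorem exists_eq_binary_cubic {K : Type*} [Field K]
    {f : MvPolynomial (Fin 2) K} (hf : f.IsHomogeneous 3) : ∃ c : ℕ → K,
    f = C (c 0) * X 0 ^ 3 + C (c 1) * (X 0 ^ 2 * X 1) + C (c 2) * (X 0 * X 1 ^ 2) +
      C (c 3) * X 1 ^ 3 := by
  classical
  let e : ℕ → Fin 2 →₀ ℕ := fun i => Finsupp.single 0 (3 - i) + Finsupp.single 1 i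
  have he : ∀ i, e i 1 = i := fun i => by simp [e]
  have hsub : f.support ⊆ (Finset.range 4).image e := by
    intro d hd
    have h3 := hf (mem_support_iff.1 hd)
    rw [Finsupp.weight_apply, Finsupp.sum_fintype _ _ (by simp), Fin.sum_univ_two] at h3
    simp at h3
    refine Finset.mem_image.2 ⟨d 1, Finset.mem_range.2 (by omega), ?_⟩
    ext i
    fin_cases i
    · simp [e]; omega
    · simp [e]
  refine ⟨fun i => coeff (e i) f, ?_⟩
  have hm : ∀ i (c : K), monomial (e i) c = C c * (X 0 ^ (3 - i) * X 1 ^ i) := by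
    intro i c
    rw [← mul_one c, ← C_mul_monomial, mul_one, X_pow_eq_monomial, X_pow_eq_monomial,
      monomial_mul, one_mul]
  conv_lhs => rw [f.as_sum]
  rw [Finset.sum_subset hsub fun d _ hd => by rw [notMem_support_iff.1 hd, monomial_zero],
    Finset.sum_image fun i _ j _ hij => by rw [← he i, hij, he]]
  simp only [hm, Finset.sum_range_succ, Finset.sum_range_zero]
  simp

/-- A binary cubic form is determined up to a factor by three zeros. -/
theorem exists_eq_C_mul_prod {K : Type*} [Field K]
    {f : MvPolynomial (Fin 2) K} (hf : f.IsHomogeneous 3) {s t : K} (ht : t ≠ 0) (hs : s ≠ 0)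
    (h₁ : aeval ![(1 : K), 0] f = 0) (h₂ : aeval ![(0 : K), 1] f = 0) (h₃ : aeval ![s, t] f = 0) :
    ∃ c : K, f = C c * ∏ j, (C (![0, 1, t] j) * X 0 - C (![1, 0, s] j) * X 1) := by
  obtain ⟨c, rfl⟩ := exists_eq_binary_cubic hf
  simp at h₁ h₂ h₃
  have h0 : c 1 * s + c 2 * t = 0 := by
    rw [h₁, h₂] at h₃
    apply mul_left_cancel₀ (mul_ne_zero hs ht)
    linear_combination h₃
  have hc1 : c 1 = c 1 / t * t := by field_simp
  have hc2 : c 2 = -(c 1 / t * s) := by field_simp; linear_combination h0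
  -- The zeros `(1 : 0)` and `(0 : 1)` remove the pure cubes, and the third zero leaves a multiple
  -- of `X 0 * X 1 * (t X 0 - s X 1)`. The sign comes from the factor `-X 1` attached to `(1 : 0)`.
  refine ⟨-(c 1 / t), ?_⟩
  rw [h₁, h₂, hc2]
  nth_rewrite 1 [hc1]
  simp only [Fin.prod_univ_three]
  simp
  ring

namespace CubicSurface

theorem aeval_lineRestriction {k : Type*} [Field k] {n : ℕ} (G : MvPolynomial (Fin (n + 1)) k)
    (a b : Fin (n + 1) → k) (x y : k) :
    aeval ![x, y] (lineRestriction G a b) = aeval (x • a + y • b) G := by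
  rw [lineRestriction, aeval_aeval_vec]
  congr 2
  funext i
  simp [mul_comm]

theorem isHomogeneous_lineRestriction {k : Type*} [Field k] {n d : ℕ}
    {G : MvPolynomial (Fin (n + 1)) k} (hG : G.IsHomogeneous d) (a b : Fin (n + 1) → k) :
    (lineRestriction G a b).IsHomogeneous d := by
  have := hG.aeval (fun i => C (a i) * X 0 + C (b i) * X 1 : Fin (n + 1) → MvPolynomial (Fin 2) k)
    (n := 1) fun i => (isHomogeneous_C_mul_X _ _).add (isHomogeneous_C_mul_X _ _)
  rwa [one_mul] at this

/-- Two distinct points of a plane cubic, and a further point of it on the line through them, are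
collinear on the cubic. -/
theorem collinearOnCubic_of_aeval_eq_zero {k : Type*} [Field k] {n : ℕ}
    {G : MvPolynomial (Fin (n + 1)) k} (hG : G.IsHomogeneous 3) {a b : Fin (n + 1) → k}
    (hab : ¬ ∀ i j, a i * b j = a j * b i) {s t : k} (hs : s ≠ 0) (ht : t ≠ 0) (ha0 : a ≠ 0)
    (hb0 : b ≠ 0) (hc0 : s • a + t • b ≠ 0) (ha : aeval a G = 0) (hb : aeval b G = 0)
    (hc : aeval (s • a + t • b) G = 0) :
    CollinearOnCubic G ![Projectivization.mk k a ha0, Projectivization.mk k b hb0,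
      Projectivization.mk k _ hc0] := by
  refine ⟨a, b, LinearIndependent.pair_iff.2 fun x y hxy => ?_, ![1, 0, s], ![0, 1, t], ?_, ?_⟩
  · push Not at hab
    obtain ⟨i, j, hij⟩ := hab
    have hi := congrFun hxy i
    have hj := congrFun hxy j
    simp only [Pi.add_apply, Pi.smul_apply, smul_eq_mul, Pi.zero_apply] at hi hj
    constructor
    · refine (mul_eq_zero.1 (?_ : x * (a i * b j - a j * b i) = 0)).resolve_right
        (sub_ne_zero.2 hij)
      linear_combination b j * hi - b i * hj
    · refine (mul_eq_zero.1 (?_ : y * (a i * b j - a j * b i) = 0)).resolve_right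
        (sub_ne_zero.2 hij)
      linear_combination a i * hj - a j * hi
  · intro j
    fin_cases j
    · exact ⟨by simpa using ha0, by simp⟩
    · exact ⟨by simpa using hb0, by simp⟩
    · exact ⟨by simpa using hc0, by simp⟩
  · obtain ⟨c, hcf⟩ := exists_eq_C_mul_prod (isHomogeneous_lineRestriction hG a b) ht hs
      (by rw [aeval_lineRestriction]; simpa using ha)
      (by rw [aeval_lineRestriction]; simpa using hb)
      (by rw [aeval_lineRestriction]; exact hc)
    by_cases h0 : c = 0
    · left; rw [hcf, h0, map_zero, zero_mul]
    · exact Or.inr ⟨c, h0, hcf⟩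

variable {k : Type*} [Field k] {F : MvPolynomial (Fin 4) k}
  {p : GeomPt F → ProjPt (AlgebraicClosure k) 2} {q : Fin 4 → MvPolynomial (Fin 3) k}

/-- The image of the section of the surface by a plane is cut out by the corresponding combination
of the cubic forms `q`. -/
theorem isImageCubic (h : CubicParametrization F q (graphRel p)) {l : Fin 4 → k} (hl : l ≠ 0) :
    IsImageCubic p l (∑ i, C (l i) * q i) := by
  have hinf : Infinite (AlgebraicClosure k) := IsAlgClosed.instInfinite
  have hhom : (∑ i, C (l i) * q i).IsHomogeneous 3 :=
    IsHomogeneous.sum _ _ _ fun i _ => (h.homog i).C_mul _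
  have hev : ∀ u : Fin 3 → AlgebraicClosure k, aeval u (∑ i, C (l i) * q i) =
      ∑ i, algebraMap k _ (l i) *
        aeval u (MvPolynomial.map (algebraMap k (AlgebraicClosure k)) (q i)) := by
    intro u
    simp only [map_sum, map_mul, algHom_C, aeval_map_algebraMap]
  refine ⟨hhom, fun h0 => ?_, fun u => ?_⟩
  · have h1 := congrArg (MvPolynomial.map (algebraMap k (AlgebraicClosure k))) h0
    simp only [map_sum, map_mul, map_C, map_zero] at h1
    have := h.map.eq_zero_of_sum_eq_zero (l := algebraMap k _ ∘ l) h1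
    exact algebraMap_comp_ne_zero hl this
  · induction u using Projectivization.ind with
    | h u hu0 =>
    rw [vanishes_mk hhom, hev]
    constructor
    · intro hsum
      suffices ∃ y, graphRel p y u ∧ ∑ i, algebraMap k _ (l i) * y i = 0 by
        obtain ⟨y, ⟨hy, hV, hu, hp⟩, hly⟩ := this
        exact ⟨_, (submodule_mk_le hy).2 hly, hp⟩
      -- Off the base locus the point over `u` is `q(u)`. Every combination of the `q i` vanishes at
      -- a base point, and correspondingly every plane meets the line over it: one linear condition
      -- on a two-dimensional space has a nontrivial solution.
      by_cases hq : ∃ i, aeval u (MvPolynomial.map (algebraMap k (AlgebraicClosure k)) (q i)) ≠ 0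
      · exact ⟨_, h.map.rel_eval hu0 hq, hsum⟩
      push Not at hq
      obtain ⟨v, w, -, hind⟩ := h.map.exists_independent_dirDeriv hu0 hq
      set ev := dirDeriv (fun i => MvPolynomial.map (algebraMap k (AlgebraicClosure k)) (q i)) u v
      set ew := dirDeriv (fun i => MvPolynomial.map (algebraMap k (AlgebraicClosure k)) (q i)) u w
      obtain ⟨α, β, hαβ, h0⟩ : ∃ α β : AlgebraicClosure k, ¬ (α = 0 ∧ β = 0) ∧
          α * ∑ i, algebraMap k _ (l i) * ev i + β * ∑ i, algebraMap k _ (l i) * ew i = 0 := by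
        by_cases hv : ∑ i, algebraMap k _ (l i) * ev i = 0
        · exact ⟨1, 0, by simp, by rw [hv]; simp⟩
        · exact ⟨-∑ i, algebraMap k _ (l i) * ew i, ∑ i, algebraMap k _ (l i) * ev i,
            fun h => hv h.2, by ring⟩
      refine ⟨α • ev + β • ew, graphRel_of_eq_add h.map hu0 hq (fun h1 => hαβ (hind _ _ h1)) rfl,
        ?_⟩
      rw [← h0, Finset.mul_sum, Finset.mul_sum, ← Finset.sum_add_distrib]
      refine Finset.sum_congr rfl fun i _ => ?_
      simp only [Pi.add_apply, Pi.smul_apply, smul_eq_mul]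
      ring
    · rintro ⟨⟨x, hV⟩, hx, hp⟩
      induction x using Projectivization.ind with
      | h y hy =>
      have hly : ∑ i, algebraMap k _ (l i) * y i = 0 := (submodule_mk_le hy).1 hx
      have hrel : graphRel p y u := ⟨hy, hV, hu0, hp⟩
      obtain ⟨j, hj⟩ := Function.ne_iff.1 hy
      refine (mul_eq_zero.1 (?_ : _ * y j = 0)).resolve_right hj
      rw [Finset.sum_mul, ← mul_zero (aeval u (MvPolynomial.map (algebraMap k (AlgebraicClosure k)) (q j))),
        ← hly, Finset.mul_sum]
      refine Finset.sum_congr rfl fun i _ => ?_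
      linear_combination
        algebraMap k (AlgebraicClosure k) (l i) * h.map.aeval_mul_comm_of_rel hrel i j

theorem sum_map_eq_zero {l y : Fin 4 → k} (h : ∑ i, l i * y i = 0) :
    ∑ i, algebraMap k (AlgebraicClosure k) (l i) * algebraMap k (AlgebraicClosure k) (y i) = 0 := by
  rw [← map_zero (algebraMap k (AlgebraicClosure k)), ← h, map_sum]
  simp only [map_mul]

/-- A plane through two separated points contains no blown-down line. -/
theorem not_le_planeSpace (h : CubicParametrization F q (graphRel p)) {a b : Fin 3 → k}
    (hsep : Separated (fun i => MvPolynomial.map (algebraMap k (AlgebraicClosure k)) (q i))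
      (algebraMap k (AlgebraicClosure k) ∘ a) (algebraMap k (AlgebraicClosure k) ∘ b))
    {l : Fin 4 → k} (hl : l ≠ 0) (ha : ∑ i, l i * aeval a (q i) = 0)
    (hb : ∑ i, l i * aeval b (q i) = 0)
    {m : Submodule (AlgebraicClosure k) (Fin 4 → AlgebraicClosure k)} (hm : IsBlownDownLine p m) :
    ¬ m ≤ planeSpace l := by
  intro hle
  obtain ⟨u, hu0, hu, hum, -⟩ := hm.exists_base h.map
  obtain ⟨v, hv⟩ := hsep u hu0 hu (algebraMap k _ ∘ l) (algebraMap_comp_ne_zero hl)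
    (by simp only [aeval_map_comp]; exact sum_map_eq_zero ha)
    (by simp only [aeval_map_comp]; exact sum_map_eq_zero hb)
  exact hv (hle (hum v))

theorem IsImage.mem_planeSection {a : Fin 3 → k} {x : RatPt F} (hx : IsImage q a x)
    {l : Fin 4 → k} (hl : ∑ i, l i * aeval a (q i) = 0) : x.geom ∈ planeSection F l := by
  change x.geom.1.submodule ≤ planeSpace l
  rw [hx.geom_eq, submodule_mk_le]
  exact sum_map_eq_zero hl

/-- A point of the line through the images of two points is obtained from them by a modified
composition, if one of the two points is separated from a further point of the line. -/
theorem exists_isModifiedComposition (h : CubicParametrization F q (graphRel p))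
    {a b : Fin 3 → k} {x y z : RatPt F} {s t : k} (hx : IsImage q a x) (hy : IsImage q b y)
    (hz : IsImage q (s • a + t • b) z) (hs : s ≠ 0) (ht : t ≠ 0)
    (hab : ¬ ∀ i j, a i * b j = a j * b i)
    (hsep : Separated (fun i => MvPolynomial.map (algebraMap k (AlgebraicClosure k)) (q i))
        (algebraMap k (AlgebraicClosure k) ∘ a) (algebraMap k (AlgebraicClosure k) ∘ b) ∨
      Separated (fun i => MvPolynomial.map (algebraMap k (AlgebraicClosure k)) (q i))
        (algebraMap k (AlgebraicClosure k) ∘ a)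
        (algebraMap k (AlgebraicClosure k) ∘ (s • a + t • b))) :
    ∃ l, IsModifiedComposition p l x y z := by
  -- Three linear conditions on four coefficients always have a nonzero solution, so the three
  -- points need not be independent.
  obtain ⟨l, hl, ha, hb, hc⟩ := exists_ne_zero_orthogonal (fun i => aeval a (q i))
    (fun i => aeval b (q i)) (fun i => aeval (s • a + t • b) (q i))
  have hev : ∀ u : Fin 3 → k, aeval u (∑ i, C (l i) * q i) = ∑ i, l i * aeval u (q i) := by
    intro u
    simp only [map_sum, map_mul, algHom_C]
    rfl
  have ha0 := vec_ne_zero h hx.choose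
  have hb0 := vec_ne_zero h hy.choose
  have hc0 := vec_ne_zero h hz.choose
  have hG := isImageCubic h hl
  refine ⟨l, hl, fun m hm => hsep.elim (fun hsep => not_le_planeSpace h hsep hl ha hb hm)
    (fun hsep => not_le_planeSpace h hsep hl ha hc hm), hx.mem_planeSection ha,
    hy.mem_planeSection hb, hz.mem_planeSection hc, _, hG, Projectivization.mk k a ha0,
    Projectivization.mk k b hb0, Projectivization.mk k _ hc0, ?_, ?_, ?_, ?_⟩
  · rw [toGeom_mk, hx.apply_geom h]
  · rw [toGeom_mk, hy.apply_geom h]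
  · rw [toGeom_mk, hz.apply_geom h]
  · exact collinearOnCubic_of_aeval_eq_zero hG.1 hab hs ht ha0 hb0 hc0 ((hev a).trans ha)
      ((hev b).trans hb) ((hev _).trans hc)

/-! ### Conclusion over infinite and finite fields. -/

theorem Generated.mem_complement {S : Set (RatPt F)} (hS : S ⊆ complementOfBlownDownLines p)
    {x : RatPt F} (hx : Generated p S x) : x ∈ complementOfBlownDownLines p := by
  cases hx with
  | base _ hx => exact hS hx
  | step _ _ _ _ _ _ _ hz _ => exact hz

theorem finite_ratPt [Finite k] : Finite (RatPt F) :=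
  have : Finite (ProjPt k 3) := Finite.of_injective Projectivization.rep fun x y hxy => by
    rw [← x.mk_rep, ← y.mk_rep]
    simp only [hxy]
  Subtype.finite

/-- Three points generate the complement of the blown-down lines over an infinite field. -/
theorem exists_finite_generators [Infinite k] (h : CubicParametrization F q (graphRel p)) :
    ∃ S : Set (RatPt F), S.Finite ∧ S ⊆ complementOfBlownDownLines p ∧
      ∀ x ∈ complementOfBlownDownLines p, Generated p S x := by
  obtain ⟨a, b, c, ha, hb, hc, hT⟩ := h.map.exists_generators
  obtain ⟨x, hx⟩ := exists_isImage h (Function.ne_iff.2 ha)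
  obtain ⟨y, hy⟩ := exists_isImage h (Function.ne_iff.2 hb)
  obtain ⟨z, hz⟩ := exists_isImage h (Function.ne_iff.2 hc)
  refine ⟨{x, y, z}, Set.toFinite _, ?_, fun P hP => ?_⟩
  · rintro P (rfl | rfl | rfl)
    exacts [hx.mem_complement h, hy.mem_complement h, hz.mem_complement h]
  obtain ⟨d, hd⟩ := exists_isImage_of_mem_complement h hP
  -- Coordinate vectors of generated points: closure of `T` under the two moves of
  -- `exists_generators` transfers generation from the plane to the surface.
  let T : Set (Fin 3 → k) := {a | ∃ P : RatPt F, IsImage q a P ∧ Generated p {x, y, z} P}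
  suffices d ∈ T by
    obtain ⟨P', hP', hgen⟩ := this
    rwa [show P = P' from Subtype.ext (hd.choose_spec.trans hP'.choose_spec.symm)]
  refine hT T ⟨x, hx, .base _ (by simp)⟩ ⟨y, hy, .base _ (by simp)⟩ ⟨z, hz, .base _ (by simp)⟩
    ?_ ?_ d (Function.ne_iff.1 hd.choose)
  · rintro a ⟨P, ⟨hne, hPa⟩, hgen⟩ c hc
    have hsm : (fun i => aeval (c • a) (q i)) = c ^ 3 • fun i => aeval a (q i) :=
      funext fun i => (h.homog i).aeval_smul_vec c a
    have hne' : (fun i => aeval (c • a) (q i)) ≠ 0 := by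
      rw [hsm]
      exact smul_ne_zero (pow_ne_zero 3 hc) hne
    refine ⟨P, ⟨hne', hPa.trans ?_⟩, hgen⟩
    rw [mk_eq_mk_iff_mul]
    intro i j
    simp only [(h.homog _).aeval_smul_vec]
    ring
  · rintro a ⟨P, hPa, hPgen⟩ b ⟨Q, hQb, hQgen⟩ s t hab hs ht hne hsep
    obtain ⟨R, hR⟩ := exists_isImage h (Function.ne_iff.2 hne)
    obtain ⟨l, hl⟩ := exists_isModifiedComposition h hPa hQb hR hs ht hab hsep
    refine ⟨R, hR, .step l P Q R hPgen hQgen ?_ (hR.mem_complement h) hl⟩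
    -- Restriction (**C**) holds because `p` recovers `a` and `b` up to scaling, so equal points
    -- would make them parallel.
    rintro rfl
    refine hab (parallel_of_algebraMap ?_)
    exact (mk_eq_mk_iff_mul _ _).1 ((hPa.apply_geom h).symm.trans (hQb.apply_geom h))

end CubicSurface

end

theorem mainTheorem2 {k : Type*} [Field k] (hk : Field.FG k)
    (F : MvPolynomial (Fin 4) k) (hF : CubicSurface.IsSmoothCubicSurface F)
    (p : CubicSurface.GeomPt F → CubicSurface.ProjPt (AlgebraicClosure k) 2)
    (hp : CubicSurface.IsMorphism F p) (hbir : CubicSurface.IsBirational F p) :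
    ∃ S : Set (CubicSurface.RatPt F), S.Finite ∧
      S ⊆ CubicSurface.complementOfBlownDownLines p ∧
      {z | CubicSurface.Generated p S z} = CubicSurface.complementOfBlownDownLines p := by
  suffices ∃ S : Set (CubicSurface.RatPt F), S.Finite ∧
      S ⊆ CubicSurface.complementOfBlownDownLines p ∧
      ∀ x ∈ CubicSurface.complementOfBlownDownLines p, CubicSurface.Generated p S x by
    obtain ⟨S, hfin, hS, hgen⟩ := this
    exact ⟨S, hfin, hS, Set.Subset.antisymm (fun _ hx => hx.mem_complement hS) hgen⟩
  rcases finite_or_infinite k with hfin | hinf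
  · have := CubicSurface.finite_ratPt (F := F)
    exact ⟨_, Set.toFinite _, subset_rfl, fun x hx => .base x hx⟩
  · obtain ⟨q, hq⟩ := CubicSurface.exists_cubicParametrization hF hp hbir
    exact CubicSurface.exists_finite_generators hq
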